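/- **Proposition (Scattering for far-away profiles, $p\le 2$).** Let $0<p\le 2$ and consider on $\mathbb{R}\times\mathbb{R}^2$ the equation $$i\partial_t u+\Delta u=a(x)|u|^pu. \tag{NLS}$$ Call $a:\mathbb{R}^2\to\mathbb{R}$ *admissible* if $a\ge 0$, $x\cdot\nabla a(x)\le 0$ for almost every $x$, $a,\nabla a\in L^1(\mathbb{R}^2)\cap L^\infty(\mathbb{R}^2)$ (in particular $a$ is Lipschitz), and the radial limit $\tilde a(\omega)=\lim_{\rho\to\infty}a(\rho\omega)$, $\omega\in\mathbb{S}^1$, is a continuous function on $\mathbb{S}^1$. Let $e^{it\Delta}$ be the free Schrödinger group and let $$\|u\|_{X(\mathbb{R})}=\big\|\,\|u(t,\cdot)\|_{L^r_x(\mathbb{R}^2)}\big\|_{L^q_t(\mathbb{R})},\qquad q=2p+4,\quad r=\frac{4p+8}{p}.$$ A global solution of (NLS) is a function $u\in C(\mathbb{R};H^1(\mathbb{R}^2))$ with $u(t)=e^{it\Delta}u(0)-i\int_0^te^{i(t-s)\Delta}\big(a|u(s)|^pu(s)\big)\,ds$ for all $t\in\mathbb{R}$. There is a function $C:[0,\infty)\to[0,\infty)$,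 depending only on $p$, such that the following holds. Let $a$ be admissible, let $\varphi\in H^1(\mathbb{R}^2)$, let $(t_n)\subset\mathbb{R}$ satisfy $t_n\equiv 0$ or $|t_n|\to\infty$, and let $(x_n)\subset\mathbb{R}^2$ satisfy $|x_n|\to\infty$. Then for all sufficiently large $n$ there exists a global solution $v_n$ of (NLS) with $$v_n(0,x)=\big[e^{it_n\Delta}\varphi\big](x-x_n)\qquad\text{and}\qquad \|v_n\|_{X(\mathbb{R})}\le C(\|\varphi\|_{H^1}),$$ and $v_n$ scatters in $H^1$ both forward and backward in time: there are $v_n^{\pm}\in H^1(\mathbb{R}^2)$ with $\lim_{t\to\pm\infty}\|v_n(t)-e^{it\Delta}v_n^\pm\|_{H^1}=0$. Furthermore, for every $\varepsilon>0$ there exist $N$ and $\psi\in C_c^\infty(\mathbb{R}\times\mathbb{R}^2)$ such that for all $n\ge N$ $$\|v_n(t,x)-\psi(t+t_n,x-x_n)\|_{X(\mathbb{R})}<\varepsilon .$$ -/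

import Mathlib

open MeasureTheory Filter Topology FourierTransform
open scoped NNReal ENNReal

noncomputable section

namespace InhomNLS

/-- The plane `ℝ²` with its Euclidean structure. -/
abbrev Plane : Type := EuclideanSpace ℝ (Fin 2)

/-- The complex Hilbert space `L²(ℝ²; ℂ)`. -/
abbrev L2 : Type := Lp (α := Plane) ℂ 2

/-- A weight `a : ℝ² → ℝ` is admissible for the power `p` if it is nonnegative, repulsive
(`x · ∇a(x) ≤ 0`), satisfies `a, ∇a ∈ L^∞` (and moreover `a, ∇a ∈ L¹` if `p ≤ 2`), and has a
radial limit at infinity that depends continuously on the direction.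

That `a` and `∇a` are in `L^∞` is expressed by saying that `a` is bounded and Lipschitz; the
gradient then exists almost everywhere and is the distributional gradient. -/
structure Admissible (p : ℝ) (a : Plane → ℝ) : Prop where
  nonneg : ∀ x, 0 ≤ a x
  bounded : ∃ M : ℝ, ∀ x, a x ≤ M
  lipschitz : ∃ K : ℝ≥0, LipschitzWith K a
  repulsive : ∀ᵐ x : Plane, inner ℝ x (gradient a x) ≤ 0
  integrable : p ≤ 2 → Integrable a ∧ Integrable (gradient a)
  radialLimit : ∃ aTilde : Metric.sphere (0 : Plane) 1 → ℝ, Continuous aTilde ∧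
    ∀ ω : Metric.sphere (0 : Plane) 1,
      Tendsto (fun ρ : ℝ => a (ρ • (ω : Plane))) atTop (𝓝 (aTilde ω))

/-- The `H¹(ℝ²)` norm `(‖f‖² + ‖∇f‖²)^{1/2} = ‖(1 + 4π²|ξ|²)^{1/2} 𝓕f‖` (norms in `L²`) of an
`L²` function, where `𝓕f(ξ) = ∫ e^{-2πi x·ξ} f(x) dx`; it is `∞` if `f ∉ H¹`. -/
def h1Norm (f : L2) : ℝ≥0∞ :=
  eLpNorm (fun ξ : Plane => (Real.sqrt (1 + (2 * Real.pi * ‖ξ‖) ^ 2) : ℂ) * (𝓕 f : L2) ξ)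
    2 volume

/-- `f ∈ H¹(ℝ²)`. -/
def MemH1 (f : L2) : Prop := h1Norm f < ⊤

/-- The symbol of `e^{itΔ}` in the variable dual to `x` under `e^{-2πi x·ξ}`. -/
def freeSymbol (t : ℝ) (ξ : Plane) : ℂ :=
  Complex.exp ((-(t * (2 * Real.pi * ‖ξ‖) ^ 2) : ℝ) * Complex.I)

theorem memLp_freeSymbol_mul (t : ℝ) (g : L2) :
    MemLp (fun ξ : Plane => freeSymbol t ξ * g ξ) 2 volume := by
  have hc : Continuous (freeSymbol t) := by
    unfold freeSymbol
    fun_prop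
  refine (Lp.memLp g).of_le
    (hc.aestronglyMeasurable.mul (Lp.aestronglyMeasurable g)) (ae_of_all _ fun ξ => ?_)
  have h1 : ‖freeSymbol t ξ‖ = 1 := by
    rw [freeSymbol, Complex.norm_exp_ofReal_mul_I]
  rw [norm_mul, h1, one_mul]

/-- The free Schrödinger propagator `e^{itΔ}` on `L²(ℝ²)`. -/
def freeProp (t : ℝ) (f : L2) : L2 :=
  𝓕⁻ ((memLp_freeSymbol_mul t (𝓕 f)).toLp (fun ξ : Plane => freeSymbol t ξ * (𝓕 f : L2) ξ))

/-- `u` is a global `H¹` solution of `i ∂ₜ u + Δ u = a |u|^p u`: it belongs to `C(ℝ; H¹)` and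
satisfies the Duhamel formula
`u(t) = e^{itΔ} u(0) - i ∫₀ᵗ e^{i(t-s)Δ} (a |u(s)|^p u(s)) ds`, as an integral in `L²`. -/
structure IsGlobalSolution (p : ℝ) (a : Plane → ℝ) (u : ℝ → L2) : Prop where
  memH1 : ∀ t, MemH1 (u t)
  continuous : ∀ t₀, Tendsto (fun t => h1Norm (u t - u t₀)) (𝓝 t₀) (𝓝 0)
  duhamel : ∃ F : ℝ → L2,
    (∀ s, F s =ᵐ[volume] fun x : Plane => (a x : ℂ) * (‖u s x‖ ^ p : ℝ) * u s x) ∧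
    ∀ t, IntervalIntegrable (fun s => freeProp (t - s) (F s)) volume 0 t ∧
      u t = freeProp t (u 0) - Complex.I • ∫ s in (0 : ℝ)..t, freeProp (t - s) (F s)

/-- `u` scatters in `H¹` forward in time. -/
def ScattersForward (u : ℝ → L2) : Prop :=
  ∃ f : L2, MemH1 f ∧ Tendsto (fun t => h1Norm (u t - freeProp t f)) atTop (𝓝 0)

/-- `u` scatters in `H¹` backward in time. -/
def ScattersBackward (u : ℝ → L2) : Prop :=
  ∃ f : L2, MemH1 f ∧ Tendsto (fun t => h1Norm (u t - freeProp t f)) atBot (𝓝 0)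

/-- The time exponent of the scattering space `X`. -/
def qExp (p : ℝ) : ℝ := if p ≤ 2 then 2 * p + 4 else (p ^ 2 + 2 * p) / 2

/-- The space exponent of the scattering space `X`. -/
def rExp (p : ℝ) : ℝ := if p ≤ 2 then (4 * p + 8) / p else p + 2

/-- The norm of `X(ℝ) = L_t^q L_x^r (ℝ × ℝ²)` with `q = qExp p` and `r = rExp p`. -/
def xNorm (p : ℝ) (u : ℝ → Plane → ℂ) : ℝ≥0∞ :=
  eLpNorm (fun t : ℝ => eLpNorm (u t) (ENNReal.ofReal (rExp p)) volume)
    (ENNReal.ofReal (qExp p)) volume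

end InhomNLS

end

open MeasureTheory Filter Topology FourierTransform
open scoped NNReal ENNReal

noncomputable section

namespace InhomNLS

theorem ae_fourier_eq_of_integrable (f : L2) (hf : Integrable f) :
    (𝓕 f : L2) =ᵐ[volume] 𝓕 (f : Plane → ℂ) := by
  have hcont : Continuous (𝓕 (f : Plane → ℂ)) :=
    VectorFourier.fourierIntegral_continuous Real.continuous_fourierChar
      (by exact continuous_inner) hf
  refine ae_eq_of_integral_contDiff_smul_eq ((Lp.memLp _).locallyIntegrable (by norm_num))
    hcont.locallyIntegrable ?_
  intro g hg hgc
  have hg₁ : HasCompactSupport (Complex.ofRealCLM ∘ g) := hgc.comp_left rfl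
  have hg₂ : ContDiff ℝ (⊤ : ℕ∞) (Complex.ofRealCLM ∘ g) := by fun_prop
  have h1 := congrArg (fun T => T (hg₁.toSchwartzMap hg₂)) (Lp.fourier_toTemperedDistribution_eq f)
  simp only [TemperedDistribution.fourier_apply, Lp.toTemperedDistribution_apply] at h1
  have h2 := VectorFourier.integral_fourierIntegral_smul_eq_flip (μ := volume) (ν := volume)
    (L := (innerₗ Plane)) (f := (hg₁.toSchwartzMap hg₂)) (g := (f : Plane → ℂ)) Real.continuous_fourierChar (by exact continuous_inner)
    (SchwartzMap.integrable _) hf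
  have h3 : ∀ x, 𝓕 (hg₁.toSchwartzMap hg₂) x = 𝓕 ((hg₁.toSchwartzMap hg₂ : SchwartzMap Plane ℂ): Plane → ℂ) x := fun x => by
    rw [SchwartzMap.fourier_coe]
  simp only [h3] at h1
  change ∫ x, g x • (𝓕 f : L2) x = ∫ x, g x • 𝓕 (f : Plane → ℂ) x
  rw [flip_innerₗ] at h2
  have h4 := h1.symm.trans h2
  exact h4

theorem fourier_freeProp (t : ℝ) (f : L2) :
    (𝓕 (freeProp t f) : L2) =ᵐ[volume] fun ξ => freeSymbol t ξ * (𝓕 f : L2) ξ := by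
  unfold freeProp
  rw [FourierTransform.fourier_fourierInv_eq]
  exact MemLp.coeFn_toLp _

theorem fourier_injective : Function.Injective (fun f : L2 => (𝓕 f : L2)) :=
  (Lp.fourierTransformₗᵢ Plane ℂ).injective

theorem norm_freeSymbol (t : ℝ) (ξ : Plane) : ‖freeSymbol t ξ‖ = 1 := by
  rw [freeSymbol, Complex.norm_exp_ofReal_mul_I]

theorem freeSymbol_add (s t : ℝ) (ξ : Plane) :
    freeSymbol (s + t) ξ = freeSymbol s ξ * freeSymbol t ξ := by
  simp only [freeSymbol]
  rw [← Complex.exp_add]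
  congr 1
  push_cast
  ring

theorem freeSymbol_zero (ξ : Plane) : freeSymbol 0 ξ = 1 := by simp [freeSymbol]

theorem continuous_freeSymbol : Continuous (fun x : ℝ × Plane => freeSymbol x.1 x.2) := by
  unfold freeSymbol
  fun_prop

/-- The propagator as a linear isometry. -/
def freePropₗᵢ (t : ℝ) : L2 →ₗᵢ[ℂ] L2 where
  toFun := freeProp t
  map_add' f g := by
    apply fourier_injective
    apply Lp.ext
    simp only
    rw [FourierTransform.fourier_add]
    filter_upwards [fourier_freeProp t (f + g), fourier_freeProp t f, fourier_freeProp t g,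
      Lp.coeFn_add (𝓕 (freeProp t f)) (𝓕 (freeProp t g)), Lp.coeFn_add (𝓕 f : L2) (𝓕 g)]
      with ξ h1 h2 h3 h4 h5
    rw [h1, h4, Pi.add_apply, h2, h3, FourierTransform.fourier_add, h5, Pi.add_apply, mul_add]
  map_smul' c f := by
    apply fourier_injective
    apply Lp.ext
    simp only [RingHom.id_apply]
    rw [FourierTransform.fourier_smul]
    filter_upwards [fourier_freeProp t (c • f), fourier_freeProp t f,
      Lp.coeFn_smul c (𝓕 (freeProp t f)), Lp.coeFn_smul c (𝓕 f : L2)]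
      with ξ h1 h2 h4 h5
    rw [h1, h4, Pi.smul_apply, h2, FourierTransform.fourier_smul, h5, Pi.smul_apply,
      smul_eq_mul, smul_eq_mul, mul_left_comm]
  norm_map' f := by
    change ‖freeProp t f‖ = ‖f‖
    rw [← Lp.norm_fourier_eq (freeProp t f), ← Lp.norm_fourier_eq f, Lp.norm_def, Lp.norm_def]
    congr 1
    apply eLpNorm_congr_norm_ae
    filter_upwards [fourier_freeProp t f] with ξ h
    rw [h, norm_mul, norm_freeSymbol, one_mul]

theorem freeProp_add_left (s t : ℝ) (f : L2) :
    freeProp (s + t) f = freeProp s (freeProp t f) := by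
  apply fourier_injective
  apply Lp.ext
  filter_upwards [fourier_freeProp (s + t) f, fourier_freeProp t f,
    fourier_freeProp s (freeProp t f)] with ξ h1 h2 h3
  rw [h1, h3, h2, freeSymbol_add, mul_assoc]

@[simp] theorem freeProp_zero_left (f : L2) : freeProp 0 f = f := by
  apply fourier_injective
  apply Lp.ext
  filter_upwards [fourier_freeProp 0 f] with ξ h1
  rw [h1, freeSymbol_zero, one_mul]

theorem freeProp_sub (t : ℝ) (f g : L2) : freeProp t (f - g) = freeProp t f - freeProp t g :=
  (freePropₗᵢ t).map_sub f g

theorem freeProp_smul (t : ℝ) (c : ℂ) (f : L2) : freeProp t (c • f) = c • freeProp t f :=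
  (freePropₗᵢ t).map_smul c f

theorem norm_freeProp (t : ℝ) (f : L2) : ‖freeProp t f‖ = ‖f‖ := (freePropₗᵢ t).norm_map f

theorem inner_freeProp_freeProp (t : ℝ) (f g : L2) :
    inner ℂ (freeProp t f) (freeProp t g) = inner ℂ f g :=
  (freePropₗᵢ t).inner_map_map f g

theorem freeProp_neg_freeProp (t : ℝ) (f : L2) : freeProp (-t) (freeProp t f) = f := by
  rw [← freeProp_add_left]; simp

theorem inner_freeProp_left (t : ℝ) (f g : L2) :
    inner ℂ (freeProp t f) g = inner ℂ f (freeProp (-t) g) := by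
  rw [← inner_freeProp_freeProp (-t), freeProp_neg_freeProp]

/-- Translation `f ↦ f (· + h)` on `L²`. -/
def translate (h : Plane) : L2 →ₗᵢ[ℂ] L2 :=
  Lp.compMeasurePreservingₗᵢ ℂ (fun x => x + h) (measurePreserving_add_right volume h)

theorem coeFn_translate (h : Plane) (f : L2) : translate h f =ᵐ[volume] fun x => f (x + h) :=
  Lp.coeFn_compMeasurePreserving f (measurePreserving_add_right volume h)

theorem eLpNorm_comp_add_right {E : Type*} [NormedAddCommGroup E] (f : Plane → E)
    (hf : AEStronglyMeasurable f) (e : ℝ≥0∞) (h : Plane) :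
    eLpNorm (fun x => f (x + h)) e volume = eLpNorm f e volume :=
  eLpNorm_comp_measurePreserving hf (measurePreserving_add_right volume h)

/-- The symbol of the translation by `h`. -/
def translateSymbol (h ξ : Plane) : ℂ := Complex.exp ((2 * Real.pi * inner ℝ h ξ : ℝ) * Complex.I)

theorem norm_translateSymbol (h ξ : Plane) : ‖translateSymbol h ξ‖ = 1 := by
  rw [translateSymbol, Complex.norm_exp_ofReal_mul_I]

theorem continuous_translateSymbol (h : Plane) : Continuous (translateSymbol h) := by
  unfold translateSymbol
  fun_prop

theorem memLp_translateSymbol_mul (h : Plane) (g : L2) :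
    MemLp (fun ξ : Plane => translateSymbol h ξ * g ξ) 2 volume := by
  refine (Lp.memLp g).of_le
    ((continuous_translateSymbol h).aestronglyMeasurable.mul (Lp.aestronglyMeasurable g))
    (ae_of_all _ fun ξ => ?_)
  rw [norm_mul, norm_translateSymbol, one_mul]

/-- Multiplication by the symbol of a translation. -/
def mulTranslateSymbol (h : Plane) : L2 →ₗᵢ[ℂ] L2 where
  toFun g := (memLp_translateSymbol_mul h g).toLp
  map_add' f g := by
    apply Lp.ext
    filter_upwards [(memLp_translateSymbol_mul h (f + g)).coeFn_toLp,
      (memLp_translateSymbol_mul h f).coeFn_toLp, (memLp_translateSymbol_mul h g).coeFn_toLp,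
      Lp.coeFn_add f g, Lp.coeFn_add (memLp_translateSymbol_mul h f).toLp
        (memLp_translateSymbol_mul h g).toLp] with ξ h1 h2 h3 h4 h5
    rw [h1, h5, Pi.add_apply, h2, h3, h4, Pi.add_apply, mul_add]
  map_smul' c f := by
    apply Lp.ext
    filter_upwards [(memLp_translateSymbol_mul h (c • f)).coeFn_toLp,
      (memLp_translateSymbol_mul h f).coeFn_toLp,
      Lp.coeFn_smul c f, Lp.coeFn_smul c (memLp_translateSymbol_mul h f).toLp]
      with ξ h1 h2 h4 h5
    rw [h1, RingHom.id_apply, h5, Pi.smul_apply, h2, h4, Pi.smul_apply, smul_eq_mul, smul_eq_mul,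
      mul_left_comm]
  norm_map' f := by
    change ‖(memLp_translateSymbol_mul h f).toLp‖ = ‖f‖
    rw [Lp.norm_def, Lp.norm_def]
    congr 1
    apply eLpNorm_congr_norm_ae
    filter_upwards [(memLp_translateSymbol_mul h f).coeFn_toLp] with ξ h
    rw [h, norm_mul, norm_translateSymbol, one_mul]

theorem fourier_translate_eq (h : Plane) (f : L2) :
    (𝓕 (translate h f) : L2) = mulTranslateSymbol h (𝓕 f) := by
  refine (SchwartzMap.denseRange_toLpCLM (E := Plane) (F := ℂ) (p := 2) (μ := volume)
    ENNReal.ofNat_ne_top).induction_on (p := fun f : L2 => (𝓕 (translate h f) : L2) =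
      mulTranslateSymbol h (𝓕 f)) f ?_ ?_
  · refine isClosed_eq ?_ ?_
    · exact (Lp.fourierTransformₗᵢ Plane ℂ).continuous.comp (translate h).continuous
    · exact (mulTranslateSymbol h).continuous.comp (Lp.fourierTransformₗᵢ Plane ℂ).continuous
  · intro f
    have hint : Integrable (f.toLp 2 : L2) := (integrable_congr (f.coeFn_toLp 2 volume)).2 f.integrable
    have hint' : Integrable (translate h (f.toLp 2)) :=
      (integrable_congr (coeFn_translate h _)).2 (hint.comp_add_right h)
    apply Lp.ext
    simp only [SchwartzMap.toLpCLM_apply]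
    filter_upwards [ae_fourier_eq_of_integrable _ hint, ae_fourier_eq_of_integrable _ hint',
      (memLp_translateSymbol_mul h (𝓕 (f.toLp 2 : L2))).coeFn_toLp] with ξ h1 h2 h3
    rw [h2]
    refine Eq.trans ?_ h3.symm
    rw [h1, Real.fourier_congr_ae (coeFn_translate h _)]
    have := congrFun (VectorFourier.fourierIntegral_comp_add_right Real.fourierChar volume
      (innerₗ Plane) (f.toLp 2 : L2) h) ξ
    refine Eq.trans this ?_
    simp only [translateSymbol, Circle.smul_def, Real.fourierChar_apply, innerₗ_apply_apply, smul_eq_mul]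
    rfl

theorem fourier_translate (h : Plane) (f : L2) :
    (𝓕 (translate h f) : L2) =ᵐ[volume] fun ξ => translateSymbol h ξ * (𝓕 f : L2) ξ := by
  rw [fourier_translate_eq]
  exact (memLp_translateSymbol_mul h (𝓕 f)).coeFn_toLp

theorem translate_freeProp (h : Plane) (t : ℝ) (f : L2) :
    translate h (freeProp t f) = freeProp t (translate h f) := by
  apply fourier_injective
  apply Lp.ext
  filter_upwards [fourier_translate h (freeProp t f), fourier_freeProp t f,
    fourier_freeProp t (translate h f), fourier_translate h f] with ξ h1 h2 h3 h4
  rw [h1, h2, h3, h4, mul_left_comm]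

theorem tendsto_eLpNorm_freeSymbol_sub_mul (g : Plane → ℂ) (hg : MemLp g 2 volume) (t₀ : ℝ) :
    Tendsto (fun t => eLpNorm (fun ξ => (freeSymbol t ξ - freeSymbol t₀ ξ) * g ξ) 2 volume)
      (𝓝 t₀) (𝓝 0) := by
  have h0 : ∀ t, eLpNorm (fun ξ => (freeSymbol t ξ - freeSymbol t₀ ξ) * g ξ) 2 volume =
      (∫⁻ ξ, ‖(freeSymbol t ξ - freeSymbol t₀ ξ) * g ξ‖ₑ ^ (2 : ℝ)) ^ (1 / (2 : ℝ)) := fun t => by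
    rw [eLpNorm_eq_lintegral_rpow_enorm_toReal (by norm_num) (by norm_num)]
    simp
  simp_rw [h0]
  have hc : ∀ t, Continuous (freeSymbol t) := fun t =>
    continuous_freeSymbol.comp (Continuous.prodMk_right t)
  have hc' : ∀ ξ, Continuous (fun t => freeSymbol t ξ) := fun ξ =>
    continuous_freeSymbol.comp (Continuous.prodMk_left ξ)
  have key : Tendsto (fun t => ∫⁻ ξ, ‖(freeSymbol t ξ - freeSymbol t₀ ξ) * g ξ‖ₑ ^ (2 : ℝ))
      (𝓝 t₀) (𝓝 (∫⁻ _ : Plane, 0)) := by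
    refine tendsto_lintegral_filter_of_dominated_convergence'
      (fun ξ => (2 * ‖g ξ‖ₑ) ^ (2 : ℝ)) ?_ ?_ ?_ ?_
    · refine Eventually.of_forall fun t => ?_
      exact (((hc t).sub (hc t₀)).aestronglyMeasurable.mul hg.1).enorm.pow_const _
    · refine Eventually.of_forall fun t => ae_of_all _ fun ξ => ?_
      refine ENNReal.rpow_le_rpow ?_ (by norm_num)
      rw [enorm_mul]
      gcongr
      refine (enorm_sub_le).trans ?_
      rw [← ofReal_norm, ← ofReal_norm, norm_freeSymbol, norm_freeSymbol]
      norm_num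
    · have h2 : ∀ ξ, (2 * ‖g ξ‖ₑ) ^ (2 : ℝ) = 4 * ‖g ξ‖ₑ ^ (2 : ℝ) := fun ξ => by
        rw [ENNReal.mul_rpow_of_nonneg _ _ (by norm_num)]
        norm_num
      simp_rw [h2]
      rw [lintegral_const_mul' _ _ (by norm_num)]
      refine ENNReal.mul_ne_top (by norm_num) ?_
      have := hg.eLpNorm_lt_top
      rw [eLpNorm_eq_lintegral_rpow_enorm_toReal (by norm_num) (by norm_num)] at this
      simp only [ENNReal.toReal_ofNat] at this
      intro h
      rw [h] at this
      simp at this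
    · refine ae_of_all _ fun ξ => ?_
      have : Tendsto (fun t => ‖(freeSymbol t ξ - freeSymbol t₀ ξ) * g ξ‖ₑ) (𝓝 t₀)
          (𝓝 ‖(freeSymbol t₀ ξ - freeSymbol t₀ ξ) * g ξ‖ₑ) :=
        ((((hc' ξ).sub continuous_const).mul continuous_const).enorm).tendsto t₀
      simp only [sub_self, zero_mul, enorm_zero] at this
      have h3 := this.ennrpow_const 2
      simpa using h3
  have := key.ennrpow_const (1 / 2)
  simpa using this

theorem eLpNorm_two_eq_of_fourier (f : L2) {g : Plane → ℂ} (h : (𝓕 f : L2) =ᵐ[volume] g) :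
    ‖f‖ₑ = eLpNorm g 2 volume := by
  rw [← eLpNorm_congr_ae h, ← Lp.enorm_def, ← ofReal_norm, ← ofReal_norm, Lp.norm_fourier_eq]

theorem fourier_sub_coe (f g : L2) :
    (𝓕 (f - g) : L2) =ᵐ[volume] fun ξ => (𝓕 f : L2) ξ - (𝓕 g : L2) ξ := by
  have : (𝓕 (f - g) : L2) = 𝓕 f - 𝓕 g := (Lp.fourierTransformₗᵢ Plane ℂ).map_sub f g
  rw [this]
  exact Lp.coeFn_sub _ _

theorem fourier_add_coe (f g : L2) :
    (𝓕 (f + g) : L2) =ᵐ[volume] fun ξ => (𝓕 f : L2) ξ + (𝓕 g : L2) ξ := by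
  rw [FourierTransform.fourier_add]
  exact Lp.coeFn_add _ _

theorem fourier_smul_coe (c : ℂ) (f : L2) :
    (𝓕 (c • f) : L2) =ᵐ[volume] fun ξ => c * (𝓕 f : L2) ξ := by
  rw [FourierTransform.fourier_smul]
  exact Lp.coeFn_smul _ _

theorem fourier_freeProp_sub_freeProp (t t₀ : ℝ) (f : L2) :
    (𝓕 (freeProp t f - freeProp t₀ f) : L2) =ᵐ[volume]
      fun ξ => (freeSymbol t ξ - freeSymbol t₀ ξ) * (𝓕 f : L2) ξ := by
  filter_upwards [fourier_sub_coe (freeProp t f) (freeProp t₀ f), fourier_freeProp t f,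
    fourier_freeProp t₀ f] with ξ h1 h2 h3
  rw [h1, h2, h3, sub_mul]

theorem continuous_freeProp_left (f : L2) : Continuous (fun t => freeProp t f) := by
  rw [continuous_iff_continuousAt]
  intro t₀
  rw [ContinuousAt, tendsto_iff_edist_tendsto_0]
  refine (tendsto_eLpNorm_freeSymbol_sub_mul _ (Lp.memLp (𝓕 f : L2)) t₀).congr fun t => ?_
  rw [edist_eq_enorm_sub, eLpNorm_two_eq_of_fourier _ (fourier_freeProp_sub_freeProp t t₀ f)]

theorem continuous_freeProp : Continuous (fun x : ℝ × L2 => freeProp x.1 x.2) := by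
  rw [continuous_iff_continuousAt]
  rintro ⟨t₀, f₀⟩
  have h : Tendsto (fun x : ℝ × L2 => ‖x.2 - f₀‖ + ‖freeProp x.1 f₀ - freeProp t₀ f₀‖)
      (𝓝 (t₀, f₀)) (𝓝 (‖f₀ - f₀‖ + ‖freeProp t₀ f₀ - freeProp t₀ f₀‖)) := by
    have h1 := (continuous_freeProp_left f₀).comp (continuous_fst (X := ℝ) (Y := L2))
    have h2 : Continuous (fun x : ℝ × L2 => ‖x.2 - f₀‖ + ‖freeProp x.1 f₀ - freeProp t₀ f₀‖) :=
      (continuous_snd.sub continuous_const).norm.add (h1.sub continuous_const).norm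
    exact h2.tendsto (t₀, f₀)
  simp only [sub_self, norm_zero, add_zero] at h
  rw [ContinuousAt, tendsto_iff_norm_sub_tendsto_zero]
  refine squeeze_zero (fun _ => norm_nonneg _) (fun x => ?_) h
  calc ‖freeProp x.1 x.2 - freeProp t₀ f₀‖
      = ‖freeProp x.1 (x.2 - f₀) + (freeProp x.1 f₀ - freeProp t₀ f₀)‖ := by
        rw [freeProp_sub]; congr 1; abel
    _ ≤ _ := by
        refine (norm_add_le _ _).trans ?_
        rw [norm_freeProp]

/-- The symbol defining the `H¹` norm. -/
def h1Symbol (ξ : Plane) : ℂ := (Real.sqrt (1 + (2 * Real.pi * ‖ξ‖) ^ 2) : ℂ)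

theorem h1Norm_eq (f : L2) :
    h1Norm f = eLpNorm (fun ξ => h1Symbol ξ * (𝓕 f : L2) ξ) 2 volume := rfl

theorem continuous_h1Symbol : Continuous h1Symbol := by
  unfold h1Symbol
  fun_prop

theorem aestronglyMeasurable_h1 (f : L2) :
    AEStronglyMeasurable (fun ξ => h1Symbol ξ * (𝓕 f : L2) ξ) volume :=
  continuous_h1Symbol.aestronglyMeasurable.mul (Lp.aestronglyMeasurable _)

theorem h1Norm_add_le (f g : L2) : h1Norm (f + g) ≤ h1Norm f + h1Norm g := by
  rw [h1Norm_eq, h1Norm_eq, h1Norm_eq]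
  refine le_trans (le_of_eq (eLpNorm_congr_ae ?_)) (eLpNorm_add_le (aestronglyMeasurable_h1 f)
    (aestronglyMeasurable_h1 g) (by norm_num))
  filter_upwards [fourier_add_coe f g] with ξ h
  rw [h, Pi.add_apply, mul_add]

theorem h1Norm_smul (c : ℂ) (f : L2) : h1Norm (c • f) = ‖c‖ₑ * h1Norm f := by
  rw [h1Norm_eq, h1Norm_eq, ← eLpNorm_const_smul]
  refine eLpNorm_congr_ae ?_
  filter_upwards [fourier_smul_coe c f] with ξ h
  rw [h, Pi.smul_apply, smul_eq_mul, mul_left_comm]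

theorem h1Norm_sub_le (f g : L2) : h1Norm (f - g) ≤ h1Norm f + h1Norm g := by
  have : f - g = f + (-1 : ℂ) • g := by simp [sub_eq_add_neg]
  rw [this]
  refine (h1Norm_add_le _ _).trans ?_
  rw [h1Norm_smul]
  simp

theorem h1Norm_freeProp (t : ℝ) (f : L2) : h1Norm (freeProp t f) = h1Norm f := by
  rw [h1Norm_eq, h1Norm_eq]
  refine eLpNorm_congr_norm_ae ?_
  filter_upwards [fourier_freeProp t f] with ξ h
  rw [h, norm_mul, norm_mul, norm_mul, norm_freeSymbol, one_mul]

theorem h1Norm_translate (h : Plane) (f : L2) : h1Norm (translate h f) = h1Norm f := by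
  rw [h1Norm_eq, h1Norm_eq]
  refine eLpNorm_congr_norm_ae ?_
  filter_upwards [fourier_translate h f] with ξ h
  rw [h, norm_mul, norm_mul, norm_mul, norm_translateSymbol, one_mul]

theorem tendsto_h1Norm_freeProp_sub (f : L2) (hf : MemH1 f) (t₀ : ℝ) :
    Tendsto (fun t => h1Norm (freeProp t f - freeProp t₀ f)) (𝓝 t₀) (𝓝 0) := by
  refine (tendsto_eLpNorm_freeSymbol_sub_mul _ ⟨aestronglyMeasurable_h1 f, hf⟩ t₀).congr
    fun t => ?_
  rw [h1Norm_eq]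
  refine eLpNorm_congr_ae ?_
  filter_upwards [fourier_freeProp_sub_freeProp t t₀ f] with ξ h
  rw [h, mul_left_comm]

theorem norm_h1Symbol (ξ : Plane) : ‖h1Symbol ξ‖ = Real.sqrt (1 + (2 * Real.pi * ‖ξ‖) ^ 2) := by
  rw [h1Symbol, Complex.norm_real, Real.norm_of_nonneg (Real.sqrt_nonneg _)]

theorem enorm_le_h1Norm (f : L2) : ‖f‖ₑ ≤ h1Norm f := by
  rw [eLpNorm_two_eq_of_fourier f (ae_eq_refl _), h1Norm_eq]
  refine eLpNorm_mono fun ξ => ?_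
  rw [norm_mul, norm_h1Symbol]
  refine le_mul_of_one_le_left (norm_nonneg _) ?_
  rw [Real.one_le_sqrt]
  nlinarith [sq_nonneg (2 * Real.pi * ‖ξ‖)]

theorem fourier_translate_sub (h : Plane) (f : L2) :
    (𝓕 (translate h f - f) : L2) =ᵐ[volume]
      fun ξ => (translateSymbol h ξ - 1) * (𝓕 f : L2) ξ := by
  filter_upwards [fourier_sub_coe (translate h f) f, fourier_translate h f] with ξ h1 h2
  rw [h1, h2, sub_mul, one_mul]

theorem enorm_translate_sub_le (h : Plane) (f : L2) :
    ‖translate h f - f‖ₑ ≤ ‖h‖ₑ * h1Norm f := by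
  rw [eLpNorm_two_eq_of_fourier _ (fourier_translate_sub h f), h1Norm_eq,
    ← enorm_norm h, ← eLpNorm_const_smul]
  refine eLpNorm_mono fun ξ => ?_
  rw [Pi.smul_apply, norm_smul, norm_mul, norm_mul, norm_h1Symbol, ← mul_assoc, norm_norm]
  gcongr
  rw [translateSymbol, mul_comm _ Complex.I]
  refine (Real.norm_exp_I_mul_ofReal_sub_one_le).trans ?_
  rw [Real.norm_eq_abs, abs_mul, abs_of_pos (by positivity : (0:ℝ) < 2 * Real.pi)]
  have h1 := abs_real_inner_le_norm h ξ
  have h2 : 2 * Real.pi * ‖ξ‖ ≤ Real.sqrt (1 + (2 * Real.pi * ‖ξ‖) ^ 2) := by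
    apply Real.le_sqrt_of_sq_le
    linarith
  calc 2 * Real.pi * |inner ℝ h ξ| ≤ 2 * Real.pi * (‖h‖ * ‖ξ‖) := by gcongr
    _ = ‖h‖ * (2 * Real.pi * ‖ξ‖) := by ring
    _ ≤ _ := by gcongr

theorem eLpNorm_two_sq {E : Type*} [NormedAddCommGroup E] (g : Plane → E) :
    eLpNorm g 2 volume ^ (2 : ℝ) = ∫⁻ ξ, ‖g ξ‖ₑ ^ (2 : ℝ) := by
  rw [eLpNorm_eq_lintegral_rpow_enorm_toReal (by norm_num) (by norm_num), ← ENNReal.rpow_mul]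
  simp

theorem hasDerivAt_translateSymbol (e ξ : Plane) :
    HasDerivAt (fun ε : ℝ => translateSymbol (ε • e) ξ)
      ((2 * Real.pi * inner ℝ e ξ : ℝ) * Complex.I) 0 := by
  have h1 : HasDerivAt (fun ε : ℝ => ((2 * Real.pi * inner ℝ (ε • e) ξ : ℝ) : ℂ) * Complex.I)
      ((2 * Real.pi * inner ℝ e ξ : ℝ) * Complex.I) 0 := by
    refine HasDerivAt.mul_const ?_ _
    refine HasDerivAt.ofReal_comp ?_
    simp_rw [real_inner_smul_left]
    have := ((hasDerivAt_id (0 : ℝ)).mul_const (inner ℝ e ξ)).const_mul (2 * Real.pi)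
    simpa using this
  have := h1.cexp
  simpa [translateSymbol] using this

theorem lintegral_inner_mul_fourier_le (f : L2) (B : ℝ≥0∞) (e : Plane) (he : ‖e‖ = 1)
    (hB : ∀ h, ‖h‖ ≤ 1 → ‖translate h f - f‖ₑ ≤ ‖h‖ₑ * B) :
    ∫⁻ ξ, ‖((2 * Real.pi * inner ℝ e ξ : ℝ) : ℂ) * (𝓕 f : L2) ξ‖ₑ ^ (2 : ℝ) ≤ B ^ (2 : ℝ) := by
  let ε : ℕ → ℝ := fun n => 1 / ((n : ℝ) + 1)
  have hε0 : ∀ n, 0 < ε n := fun n => by positivity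
  have hε1 : ∀ n, ε n ≤ 1 := fun n => by
    rw [div_le_one (by positivity)]
    simp
  have hεt : Tendsto ε atTop (𝓝 0) := tendsto_one_div_add_atTop_nhds_zero_nat
  have hbound : ∀ n, ∫⁻ ξ, ‖(ε n : ℂ)⁻¹ * ((translateSymbol (ε n • e) ξ - 1) *
      (𝓕 f : L2) ξ)‖ₑ ^ (2 : ℝ) ≤ B ^ (2 : ℝ) := fun n => by
    rw [← eLpNorm_two_sq]
    refine ENNReal.rpow_le_rpow ?_ (by norm_num)
    have h1 := hB (ε n • e) (by rw [norm_smul, he, mul_one, Real.norm_of_nonneg (hε0 n).le]; exact hε1 n)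
    rw [eLpNorm_two_eq_of_fourier _ (fourier_translate_sub _ f)] at h1
    have h2 := eLpNorm_const_smul ((ε n : ℂ)⁻¹)
      (fun ξ => (translateSymbol (ε n • e) ξ - 1) * (𝓕 f : L2) ξ) 2 volume
    refine (le_of_eq h2).trans ?_
    have h3 : ‖(ε n : ℂ)⁻¹‖ₑ * ‖ε n • e‖ₑ = 1 := by
      rw [← ofReal_norm, ← ofReal_norm, ← ENNReal.ofReal_mul (norm_nonneg _), norm_smul, he,
        mul_one, norm_inv, Complex.norm_real, inv_mul_cancel₀ (norm_ne_zero_iff.2 (hε0 n).ne')]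
      simp
    calc _ ≤ ‖(ε n : ℂ)⁻¹‖ₑ * (‖ε n • e‖ₑ * B) := by gcongr
      _ = B := by rw [← mul_assoc, h3, one_mul]
  have hF := lintegral_liminf_le' (μ := (volume : Measure Plane)) (u := atTop)
    (f := fun n ξ => ‖(ε n : ℂ)⁻¹ * ((translateSymbol (ε n • e) ξ - 1) *
      (𝓕 f : L2) ξ)‖ₑ ^ (2 : ℝ)) (fun n => by
        refine AEMeasurable.pow_const ?_ _
        exact ((((continuous_translateSymbol (ε n • e)).sub
          continuous_const).aestronglyMeasurable.mul (Lp.aestronglyMeasurable _)).const_mul _).enorm)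
  refine le_trans (le_of_eq ?_) (hF.trans (Filter.liminf_le_of_le (by isBoundedDefault) ?_))
  · refine lintegral_congr fun ξ => ?_
    symm
    refine Tendsto.liminf_eq ?_
    refine Tendsto.ennrpow_const _ ?_
    have h1 : Tendsto (fun n => (ε n : ℂ)⁻¹ * (translateSymbol (ε n • e) ξ - 1)) atTop
        (𝓝 ((2 * Real.pi * inner ℝ e ξ : ℝ) * Complex.I)) := by
      have h2 := (hasDerivAt_translateSymbol e ξ).tendsto_slope_zero
      have h3 := h2.comp (tendsto_nhdsWithin_iff.2 ⟨hεt, Eventually.of_forall fun n => (hε0 n).ne'⟩)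
      refine h3.congr fun n => ?_
      simp [translateSymbol]
    have h4 := ((h1.mul_const ((𝓕 f : L2) ξ)).enorm)
    have h5 : ‖((2 * Real.pi * inner ℝ e ξ : ℝ) : ℂ) * Complex.I * (𝓕 f : L2) ξ‖ₑ =
        ‖((2 * Real.pi * inner ℝ e ξ : ℝ) : ℂ) * (𝓕 f : L2) ξ‖ₑ := by
      have hI : ‖Complex.I‖ₑ = 1 := by rw [← ofReal_norm, Complex.norm_I, ENNReal.ofReal_one]
      rw [enorm_mul, enorm_mul, enorm_mul, hI, mul_one]
    rw [h5] at h4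
    simpa only [mul_assoc] using h4
  · intro b hb
    obtain ⟨n, hn⟩ := hb.exists
    exact hn.trans (hbound n)

theorem h1Norm_le_of_translate (f : L2) (B : ℝ≥0∞) (hf : ‖f‖ₑ ≤ B)
    (hB : ∀ h, ‖h‖ ≤ 1 → ‖translate h f - f‖ₑ ≤ ‖h‖ₑ * B) : h1Norm f ≤ 2 * B := by
  rw [← ENNReal.rpow_le_rpow_iff (by norm_num : (0:ℝ) < 2), h1Norm_eq, eLpNorm_two_sq]
  have e1 : ∀ ξ : Plane, ‖h1Symbol ξ * (𝓕 f : L2) ξ‖ₑ ^ (2 : ℝ) =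
      ‖(𝓕 f : L2) ξ‖ₑ ^ (2 : ℝ) +
      (‖((2 * Real.pi * inner ℝ (EuclideanSpace.single (0 : Fin 2) (1:ℝ)) ξ : ℝ) : ℂ) *
        (𝓕 f : L2) ξ‖ₑ ^ (2 : ℝ) +
      ‖((2 * Real.pi * inner ℝ (EuclideanSpace.single (1 : Fin 2) (1:ℝ)) ξ : ℝ) : ℂ) *
        (𝓕 f : L2) ξ‖ₑ ^ (2 : ℝ)) := fun ξ => by
    have h2 : ∀ z : ℂ, ‖z‖ₑ ^ (2 : ℝ) = ENNReal.ofReal (‖z‖ ^ 2) := fun z => by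
      rw [← ofReal_norm, ENNReal.ofReal_rpow_of_nonneg (norm_nonneg _) (by norm_num)]
      simp
    rw [h2, h2, h2, h2, ← ENNReal.ofReal_add (by positivity) (by positivity),
      ← ENNReal.ofReal_add (by positivity) (by positivity)]
    congr 1
    rw [norm_mul, norm_mul, norm_mul, norm_h1Symbol, mul_pow, Real.sq_sqrt (by positivity),
      Complex.norm_real, Complex.norm_real, mul_pow, mul_pow, EuclideanSpace.norm_sq_eq]
    simp only [Fin.sum_univ_two, EuclideanSpace.inner_single_left, Real.norm_eq_abs, sq_abs,
      map_one, one_mul, mul_pow]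
    ring
  have m1 : AEMeasurable (fun ξ => ‖(𝓕 f : L2) ξ‖ₑ ^ (2 : ℝ)) (volume : Measure Plane) :=
    (Lp.aestronglyMeasurable _).enorm.pow_const _
  have m2 : AEMeasurable (fun ξ => ‖((2 * Real.pi * inner ℝ (EuclideanSpace.single (0 : Fin 2)
      (1:ℝ)) ξ : ℝ) : ℂ) * (𝓕 f : L2) ξ‖ₑ ^ (2 : ℝ)) (volume : Measure Plane) := by
    refine AEMeasurable.pow_const (AEStronglyMeasurable.enorm ?_) _
    refine AEStronglyMeasurable.mul (Continuous.aestronglyMeasurable ?_) (Lp.aestronglyMeasurable _)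
    fun_prop
  simp_rw [e1]
  rw [lintegral_add_left' m1, lintegral_add_left' m2, ← eLpNorm_two_sq,
    ← eLpNorm_two_eq_of_fourier f (ae_eq_refl _), ENNReal.mul_rpow_of_nonneg _ _ (by norm_num)]
  have k0 := lintegral_inner_mul_fourier_le f B (EuclideanSpace.single (0 : Fin 2) (1:ℝ)) (by simp) hB
  have k1 := lintegral_inner_mul_fourier_le f B (EuclideanSpace.single (1 : Fin 2) (1:ℝ)) (by simp) hB
  have k2 : ‖f‖ₑ ^ (2 : ℝ) ≤ B ^ (2 : ℝ) := ENNReal.rpow_le_rpow hf (by norm_num)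
  have k3 : (2 : ℝ≥0∞) ^ (2 : ℝ) = 4 := by norm_num
  rw [k3]
  calc _ ≤ B ^ (2 : ℝ) + (B ^ (2 : ℝ) + B ^ (2 : ℝ)) := by gcongr
    _ = 3 * B ^ (2 : ℝ) := by ring
    _ ≤ _ := by gcongr; norm_num

theorem inner_eq_integral_fourier (g f : L2) :
    inner ℂ g f = ∫ ξ, (starRingEnd ℂ) ((𝓕 g : L2) ξ) * (𝓕 f : L2) ξ := by
  rw [← Lp.inner_fourier_eq, L2.inner_def]
  refine integral_congr_ae (ae_of_all _ fun ξ => ?_)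
  exact mul_comm _ _

/-- The Fourier integral of a regularised propagator symbol, tested against two integrable
functions. -/
theorem norm_integral_gaussian_fourier_le (b : ℂ) (hb : 0 < b.re) (g f : Plane → ℂ)
    (hg : Integrable g) (hf : Integrable f) :
    ‖∫ ξ, (starRingEnd ℂ) (𝓕 g ξ) * (Complex.exp (-b * ‖ξ‖ ^ 2) * 𝓕 f ξ)‖ ≤
      (Real.pi / ‖b‖) * (∫ x, ‖g x‖) * ∫ x, ‖f x‖ := by
  have hcont : ∀ f : Plane → ℂ, Integrable f → Continuous (𝓕 f) := fun f hf =>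
    VectorFourier.fourierIntegral_continuous Real.continuous_fourierChar
      (by exact continuous_inner) hf
  have hconti : ∀ f : Plane → ℂ, Integrable f → Continuous (𝓕⁻ f) := fun f hf => by
    have : 𝓕⁻ f = fun x => 𝓕 f (-x) := by
      ext x; rw [Real.fourierInv_eq_fourier_neg]
    rw [this]
    exact (hcont f hf).comp continuous_neg
  have hbd : ∀ (f : Plane → ℂ) ξ, ‖𝓕 f ξ‖ ≤ ∫ x, ‖f x‖ := fun f ξ =>
    VectorFourier.norm_fourierIntegral_le_integral_norm _ _ _ _ _
  have hG : ∀ x : Plane, Integrable (fun ξ : Plane => Complex.exp (-b * ‖ξ‖ ^ 2 + 2 * Real.pi * Complex.I * inner ℝ x ξ)) := fun x => by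
    have := GaussianFourier.integrable_cexp_neg_mul_sq_norm_add hb (2 * Real.pi * Complex.I) x
    simpa using this
  let gs : Plane → ℂ := fun x => (starRingEnd ℂ) (g x)
  have hgs : Integrable gs := (hg.norm).mono' (Complex.continuous_conj.comp_aestronglyMeasurable hg.1)
    (ae_of_all _ fun x => by simp [gs])
  have hconj : ∀ ξ, (starRingEnd ℂ) (𝓕 g ξ) = 𝓕⁻ gs ξ := fun ξ => by
    rw [Real.fourier_eq, Real.fourierInv_eq, ← integral_conj]
    congr 1
    ext x
    simp only [gs, Circle.smul_def, smul_eq_mul, map_mul]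
    congr 1
    rw [Real.fourierChar_apply, Real.fourierChar_apply, ← Complex.exp_conj, map_mul,
      Complex.conj_ofReal, Complex.conj_I, mul_neg, neg_eq_neg_one_mul, ← neg_one_mul]
    congr 1
    push_cast
    ring
  -- the integrand multiplying `𝓕 f`
  let H : Plane → ℂ := fun ξ => 𝓕⁻ gs ξ * Complex.exp (-b * ‖ξ‖ ^ 2)
  have hG0 : Integrable (fun ξ : Plane => Complex.exp (-b * ‖ξ‖ ^ 2)) := by
    have := hG 0
    simpa using this
  have hH : Integrable H := by
    refine hG0.bdd_mul (c := ∫ x, ‖gs x‖) (hconti gs hgs).aestronglyMeasurable (ae_of_all _ fun ξ => ?_)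
    rw [Real.fourierInv_eq_fourier_neg]
    exact hbd _ _
  have h1 : ∫ ξ, (starRingEnd ℂ) (𝓕 g ξ) * (Complex.exp (-b * ‖ξ‖ ^ 2) * 𝓕 f ξ) =
      ∫ x, f x * 𝓕 H x := by
    have := VectorFourier.integral_bilin_fourierIntegral_eq_flip (μ := volume) (ν := volume)
      (L := innerₗ Plane) (ContinuousLinearMap.mul ℂ ℂ) Real.continuous_fourierChar
      (by exact continuous_inner) hf hH
    rw [flip_innerₗ] at this
    simp only [ContinuousLinearMap.mul_apply'] at this
    refine Eq.trans ?_ this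
    refine integral_congr_ae (ae_of_all _ fun ξ => ?_)
    simp only [hconj, H]
    change _ = 𝓕 f ξ * _
    ring
  have h2 : ∀ x, ‖𝓕 H x‖ ≤ Real.pi / ‖b‖ * ∫ x, ‖g x‖ := fun x => by
    let K : Plane → ℂ := fun ξ => Complex.exp (-b * ‖ξ‖ ^ 2 + 2 * Real.pi * Complex.I * inner ℝ (x) ξ)
    have e1 : 𝓕 H x = ∫ y, gs y * 𝓕 K y := by
      have := VectorFourier.integral_bilin_fourierIntegral_eq_flip (μ := volume) (ν := volume)
        (L := innerₗ Plane) (ContinuousLinearMap.mul ℂ ℂ) Real.continuous_fourierChar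
        (by exact continuous_inner) hgs (hG x)
      rw [flip_innerₗ] at this
      simp only [ContinuousLinearMap.mul_apply'] at this
      refine Eq.trans ?_ this
      rw [Real.fourier_eq, ← integral_neg_eq_self]
      refine integral_congr_ae (ae_of_all _ fun ξ => ?_)
      simp only [H]
      change _ = 𝓕 gs ξ * _
      rw [Real.fourierInv_eq_fourier_neg, neg_neg, Circle.smul_def, smul_eq_mul, norm_neg,
        Complex.exp_add, Real.fourierChar_apply, real_inner_comm]
      simp only [inner_neg_right, neg_neg]
      push_cast
      ring_nf
    have e2 : ∀ y, ‖𝓕 K y‖ ≤ Real.pi / ‖b‖ := fun y => by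
      have := fourier_gaussian_innerProductSpace' hb x y
      simp only [K]
      rw [this, norm_mul]
      have hd : (Module.finrank ℝ Plane : ℂ) / 2 = 1 := by simp
      rw [hd, Complex.cpow_one, norm_div, Complex.norm_real, Real.norm_of_nonneg Real.pi_pos.le]
      refine mul_le_of_le_one_right (by positivity) ?_
      rw [Complex.norm_exp]
      refine Real.exp_le_one_iff.2 ?_
      have : (-(Real.pi : ℂ) ^ 2 * (‖x - y‖ : ℂ) ^ 2 / b) = ((-(Real.pi ^ 2 * ‖x - y‖ ^ 2) : ℝ) : ℂ) / b := by
        push_cast; ring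
      have hb2 : 0 ≤ Complex.normSq b := Complex.normSq_nonneg b
      rw [this, Complex.div_re, Complex.ofReal_im, Complex.ofReal_re, zero_mul, zero_div, add_zero]
      refine div_nonpos_of_nonpos_of_nonneg (mul_nonpos_of_nonpos_of_nonneg ?_ hb.le) hb2
      nlinarith [sq_nonneg (Real.pi * ‖x - y‖)]
    rw [e1]
    refine (norm_integral_le_integral_norm _).trans ?_
    rw [← integral_const_mul]
    refine integral_mono_of_nonneg (ae_of_all _ fun y => norm_nonneg _) (hg.norm.const_mul _)
      (ae_of_all _ fun y => ?_)
    simp only [norm_mul, gs]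
    rw [RCLike.norm_conj, mul_comm]
    gcongr
    exact e2 y
  rw [h1]
  refine (norm_integral_le_integral_norm _).trans ?_
  rw [← integral_const_mul]
  refine integral_mono_of_nonneg (ae_of_all _ fun y => norm_nonneg _) (hf.norm.const_mul _)
    (ae_of_all _ fun y => ?_)
  simp only [norm_mul]
  rw [mul_comm]
  gcongr
  exact h2 y

theorem norm_inner_freeProp_le (t : ℝ) (ht : t ≠ 0) (g f : L2) (hg : Integrable g)
    (hf : Integrable f) :
    ‖inner ℂ g (freeProp t f)‖ ≤ |t|⁻¹ * (∫ x, ‖g x‖) * ∫ x, ‖f x‖ := by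
  let ε : ℕ → ℝ := fun n => 1 / ((n : ℝ) + 1)
  have hε0 : ∀ n, 0 < ε n := fun n => by positivity
  have hεt : Tendsto ε atTop (𝓝 0) := tendsto_one_div_add_atTop_nhds_zero_nat
  let b : ℕ → ℂ := fun n => (ε n : ℂ) + (4 * Real.pi ^ 2 * t : ℝ) * Complex.I
  have hb : ∀ n, 0 < (b n).re := fun n => by
    simp only [b, Complex.add_re, Complex.ofReal_re, Complex.re_ofReal_mul, Complex.I_re,
      mul_zero, add_zero]
    exact hε0 n
  have hbn : ∀ n, Real.pi / ‖b n‖ ≤ |t|⁻¹ := fun n => by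
    have h1 : |(b n).im| ≤ ‖b n‖ := Complex.abs_im_le_norm _
    have h2 : (b n).im = 4 * Real.pi ^ 2 * t := by simp [b, -Complex.ofReal_mul, -Complex.ofReal_pow]
    rw [h2, abs_mul, abs_of_pos (by positivity : (0:ℝ) < 4 * Real.pi ^ 2)] at h1
    have ht' := abs_pos.2 ht
    rw [div_le_iff₀ (lt_of_lt_of_le (by positivity) h1), inv_mul_eq_div, le_div_iff₀ ht']
    refine le_trans ?_ h1
    have := Real.pi_gt_three
    nlinarith [mul_pos Real.pi_pos ht']
  have hint : Integrable (fun ξ => (starRingEnd ℂ) ((𝓕 g : L2) ξ) * (𝓕 (freeProp t f) : L2) ξ) := by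
    have := L2.integrable_inner (𝕜 := ℂ) (𝓕 g : L2) (𝓕 (freeProp t f) : L2)
    refine this.congr (ae_of_all _ fun ξ => ?_)
    simp [mul_comm]
  have hlim : Tendsto (fun n => ∫ ξ, (starRingEnd ℂ) (𝓕 (g : Plane → ℂ) ξ) *
      (Complex.exp (-b n * ‖ξ‖ ^ 2) * 𝓕 (f : Plane → ℂ) ξ)) atTop
      (𝓝 (inner ℂ g (freeProp t f))) := by
    have e1 : ∀ n, ∫ ξ, (starRingEnd ℂ) (𝓕 (g : Plane → ℂ) ξ) *
      (Complex.exp (-b n * ‖ξ‖ ^ 2) * 𝓕 (f : Plane → ℂ) ξ) =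
      ∫ ξ, (Real.exp (-ε n * ‖ξ‖ ^ 2) : ℂ) * ((starRingEnd ℂ) ((𝓕 g : L2) ξ) * (𝓕 (freeProp t f) : L2) ξ) := by
      intro n
      refine integral_congr_ae ?_
      filter_upwards [ae_fourier_eq_of_integrable g hg, ae_fourier_eq_of_integrable f hf,
        fourier_freeProp t f] with ξ h1 h2 h3
      rw [h3, h2, h1]
      have : Complex.exp (-b n * ‖ξ‖ ^ 2) = (Real.exp (-ε n * ‖ξ‖ ^ 2) : ℂ) * freeSymbol t ξ := by
        rw [freeSymbol, Complex.ofReal_exp, ← Complex.exp_add]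
        congr 1
        simp only [b]
        push_cast
        ring
      rw [this]
      ring
    simp_rw [e1]
    rw [inner_eq_integral_fourier]
    refine tendsto_integral_of_dominated_convergence _ (fun n => ?_) hint.norm (fun n => ?_) ?_
    · refine AEStronglyMeasurable.mul (Continuous.aestronglyMeasurable ?_) hint.1
      fun_prop
    · refine ae_of_all _ fun ξ => ?_
      rw [norm_mul]
      refine mul_le_of_le_one_left (norm_nonneg _) ?_
      rw [Complex.norm_real, Real.norm_of_nonneg (Real.exp_nonneg _)]
      refine Real.exp_le_one_iff.2 ?_
      nlinarith [mul_nonneg (hε0 n).le (sq_nonneg ‖ξ‖)]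
    · refine ae_of_all _ fun ξ => ?_
      have : Tendsto (fun n => (Real.exp (-ε n * ‖ξ‖ ^ 2) : ℂ)) atTop (𝓝 ((Real.exp (-0 * ‖ξ‖ ^ 2) : ℝ) : ℂ)) := by
        refine (Complex.continuous_ofReal.tendsto _).comp ((Real.continuous_exp.tendsto _).comp ?_)
        exact (hεt.neg).mul_const _
      simpa using this.mul_const ((starRingEnd ℂ) ((𝓕 g : L2) ξ) * (𝓕 (freeProp t f) : L2) ξ)
  refine le_of_tendsto hlim.norm (Eventually.of_forall fun n => ?_)
  refine (norm_integral_gaussian_fourier_le (b n) (hb n) g f hg hf).trans ?_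
  have i1 : 0 ≤ ∫ x, ‖g x‖ := integral_nonneg fun _ => norm_nonneg _
  have i2 : 0 ≤ ∫ x, ‖f x‖ := integral_nonneg fun _ => norm_nonneg _
  gcongr
  exact hbn n

theorem norm_inner_fourier_le (g f : L2) (hg : Integrable g) (hf : Integrable f) :
    ‖inner ℂ g (𝓕 f : L2)‖ ≤ (∫ x, ‖g x‖) * ∫ x, ‖f x‖ := by
  rw [L2.inner_def]
  refine (norm_integral_le_integral_norm _).trans ?_
  rw [← integral_mul_const]
  refine integral_mono_of_nonneg (ae_of_all _ fun y => norm_nonneg _) (hg.norm.mul_const _) ?_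
  filter_upwards [ae_fourier_eq_of_integrable f hf] with x h
  rw [h]
  refine (norm_inner_le_norm _ _).trans ?_
  gcongr
  exact VectorFourier.norm_fourierIntegral_le_integral_norm _ _ _ _ _

theorem eLpNorm_ofReal_eq {X E : Type*} [MeasurableSpace X] (μ : Measure X) [ENorm E] {r : ℝ}
    (hr : 0 < r) (f : X → E) :
    eLpNorm f (ENNReal.ofReal r) μ = (∫⁻ x, ‖f x‖ₑ ^ r ∂μ) ^ (1 / r) := by
  rw [eLpNorm_eq_lintegral_rpow_enorm_toReal (by simpa using hr) ENNReal.ofReal_ne_top,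
    ENNReal.toReal_ofReal hr.le]

theorem eLpNorm_ofReal_rpow {X E : Type*} [MeasurableSpace X] (μ : Measure X) [ENorm E] {r : ℝ}
    (hr : 0 < r) (f : X → E) :
    eLpNorm f (ENNReal.ofReal r) μ ^ r = ∫⁻ x, ‖f x‖ₑ ^ r ∂μ := by
  rw [eLpNorm_ofReal_eq μ hr, ← ENNReal.rpow_mul, one_div_mul_cancel hr.ne', ENNReal.rpow_one]

theorem rpow_sub_rpow_mul_le {A B p : ℝ} (hB : 0 ≤ B) (hAB : B ≤ A) (hp : 0 ≤ p) :
    (A ^ p - B ^ p) * B ≤ (p + 1) * A ^ p * (A - B) := by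
  rcases (hB.trans hAB).eq_or_lt with hA | hA
  · have : B = 0 := le_antisymm (hAB.trans hA.symm.le) hB
    simp [this, ← hA]
  · have hx : -1 ≤ B / A - 1 := by
      have : 0 ≤ B / A := by positivity
      linarith
    have h1 := one_add_mul_self_le_rpow_one_add hx (by linarith : 1 ≤ p + 1)
    have h2 : (1 + (B / A - 1)) ^ (p + 1) = B ^ (p + 1) / A ^ (p + 1) := by
      rw [add_sub_cancel, Real.div_rpow hB hA.le]
    rw [h2, le_div_iff₀ (by positivity)] at h1
    have h3 : A ^ (p + 1) = A ^ p * A := by rw [Real.rpow_add hA, Real.rpow_one]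
    have h4 : B ^ (p + 1) = B ^ p * B := by
      rcases hB.eq_or_lt with h | h
      · subst h
        rw [Real.zero_rpow (by linarith), mul_zero]
      · rw [Real.rpow_add h, Real.rpow_one]
    rw [h3, h4] at h1
    have h5 : (1 + (p + 1) * (B / A - 1)) * (A ^ p * A) =
        A ^ p * A - (p + 1) * A ^ p * (A - B) := by
      field_simp
      ring
    rw [h5] at h1
    have h6 : A ^ p * B ≤ A ^ p * A := by gcongr
    nlinarith

/-- The map `z ↦ min(|z|, k)^p z`. -/
def truncPow (p k : ℝ) (z : ℂ) : ℂ := ((min ‖z‖ k ^ p : ℝ) : ℂ) * z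

@[simp] theorem truncPow_zero (p k : ℝ) : truncPow p k 0 = 0 := by simp [truncPow]

theorem norm_truncPow {p k : ℝ} (hk : 0 ≤ k) (z : ℂ) :
    ‖truncPow p k z‖ = min ‖z‖ k ^ p * ‖z‖ := by
  rw [truncPow, norm_mul, Complex.norm_real, Real.norm_of_nonneg (by positivity)]

theorem norm_truncPow_sub_le_of_le {p k : ℝ} (hp : 0 ≤ p) (hk : 0 ≤ k) {z w : ℂ}
    (hwz : ‖w‖ ≤ ‖z‖) :
    ‖truncPow p k z - truncPow p k w‖ ≤ (p + 2) * min ‖z‖ k ^ p * ‖z - w‖ := by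
  have hA : 0 ≤ min ‖z‖ k := by positivity
  have hB : 0 ≤ min ‖w‖ k := by positivity
  have hAB : min ‖w‖ k ≤ min ‖z‖ k := min_le_min_right _ hwz
  have e : truncPow p k z - truncPow p k w = ((min ‖z‖ k ^ p : ℝ) : ℂ) * (z - w) +
      ((min ‖z‖ k ^ p - min ‖w‖ k ^ p : ℝ) : ℂ) * w := by
    simp only [truncPow]; push_cast; ring
  have hmono : min ‖w‖ k ^ p ≤ min ‖z‖ k ^ p := Real.rpow_le_rpow hB hAB hp
  rw [e]
  refine (norm_add_le _ _).trans ?_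
  rw [norm_mul, norm_mul, Complex.norm_real, Complex.norm_real,
    Real.norm_of_nonneg (by positivity), Real.norm_of_nonneg (by linarith)]
  have hzw : 0 ≤ ‖z - w‖ := norm_nonneg _
  have h2 : (min ‖z‖ k ^ p - min ‖w‖ k ^ p) * ‖w‖ ≤ (p + 1) * min ‖z‖ k ^ p * ‖z - w‖ := by
    rcases le_total k ‖w‖ with h | h
    · rw [min_eq_right h, min_eq_right (h.trans hwz), sub_self, zero_mul]
      positivity
    · rw [min_eq_left h]
      refine (rpow_sub_rpow_mul_le (norm_nonneg w) (by rwa [min_eq_left h] at hAB) hp).trans ?_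
      gcongr
      refine (sub_le_sub_right (min_le_left _ _) _).trans ?_
      exact norm_sub_norm_le _ _
  nlinarith

theorem lipschitzWith_truncPow {p k : ℝ} (hp : 0 ≤ p) (hk : 0 ≤ k) :
    LipschitzWith (Real.toNNReal ((p + 2) * k ^ p)) (truncPow p k) := by
  have key : ∀ z w : ℂ, ‖w‖ ≤ ‖z‖ →
      ‖truncPow p k z - truncPow p k w‖ ≤ ((p + 2) * k ^ p) * ‖z - w‖ := fun z w h => by
    refine (norm_truncPow_sub_le_of_le hp hk h).trans ?_
    gcongr
    exact min_le_right _ _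
  refine LipschitzWith.of_dist_le_mul fun z w => ?_
  rw [dist_eq_norm, dist_eq_norm, Real.coe_toNNReal _ (by positivity)]
  rcases le_total ‖w‖ ‖z‖ with h | h
  · exact key z w h
  · rw [norm_sub_rev, norm_sub_rev z w]
    exact key w z h

/-- The map `f ↦ min(|f|, k)^p f` on `L²`. -/
def truncPowLp (p : ℝ) (hp : 0 ≤ p) (k : ℕ) (f : L2) : L2 :=
  (lipschitzWith_truncPow hp (Nat.cast_nonneg k)).compLp (truncPow_zero p k) f

theorem coeFn_truncPowLp (p : ℝ) (hp : 0 ≤ p) (k : ℕ) (f : L2) :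
    truncPowLp p hp k f =ᵐ[volume] fun x => truncPow p k (f x) :=
  (lipschitzWith_truncPow hp (Nat.cast_nonneg k)).coeFn_compLp (truncPow_zero p k) f

theorem continuous_truncPowLp (p : ℝ) (hp : 0 ≤ p) (k : ℕ) : Continuous (truncPowLp p hp k) :=
  (lipschitzWith_truncPow hp (Nat.cast_nonneg k)).continuous_compLp (truncPow_zero p k)

/-- The pairing of `f` with its truncated dual function. -/
def dualPairing (r : ℝ) (hr : 0 ≤ r - 2) (k : ℕ) (f : L2) : ℝ :=
  (inner ℂ (truncPowLp (r - 2) hr k f) f).re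

theorem continuous_dualPairing (r : ℝ) (hr : 0 ≤ r - 2) (k : ℕ) :
    Continuous (dualPairing r hr k) := by
  unfold dualPairing
  exact Complex.continuous_re.comp ((continuous_truncPowLp _ hr k).inner continuous_id)

theorem inner_truncPowLp_ae (r : ℝ) (hr : 0 ≤ r - 2) (k : ℕ) (f : L2) :
    (fun x => inner ℂ (truncPowLp (r - 2) hr k f x) (f x)) =ᵐ[volume]
      fun x => ((min ‖f x‖ k ^ (r - 2) * ‖f x‖ ^ 2 : ℝ) : ℂ) := by
  filter_upwards [coeFn_truncPowLp (r - 2) hr k f] with x h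
  rw [h, truncPow, RCLike.inner_apply, map_mul, Complex.conj_ofReal]
  rw [mul_left_comm, Complex.mul_conj, Complex.normSq_eq_norm_sq]
  push_cast
  rfl

theorem integrable_dualPairing (r : ℝ) (hr : 0 ≤ r - 2) (k : ℕ) (f : L2) :
    Integrable (fun x => min ‖f x‖ k ^ (r - 2) * ‖f x‖ ^ 2) := by
  have := ((L2.integrable_inner (𝕜 := ℂ) (truncPowLp (r - 2) hr k f) f).congr
    (inner_truncPowLp_ae r hr k f)).re
  exact this.congr (ae_of_all _ fun x => Complex.ofReal_re _)

theorem inner_truncPowLp (r : ℝ) (hr : 0 ≤ r - 2) (k : ℕ) (f : L2) :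
    inner ℂ (truncPowLp (r - 2) hr k f) f = (∫ x, min ‖f x‖ k ^ (r - 2) * ‖f x‖ ^ 2 : ℝ) := by
  rw [L2.inner_def, integral_congr_ae (inner_truncPowLp_ae r hr k f)]
  exact integral_ofReal

theorem dualPairing_eq (r : ℝ) (hr : 0 ≤ r - 2) (k : ℕ) (f : L2) :
    dualPairing r hr k f = ∫ x, min ‖f x‖ k ^ (r - 2) * ‖f x‖ ^ 2 := by
  rw [dualPairing, inner_truncPowLp, Complex.ofReal_re]

theorem inner_truncPowLp_eq (r : ℝ) (hr : 0 ≤ r - 2) (k : ℕ) (f : L2) :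
    inner ℂ (truncPowLp (r - 2) hr k f) f = (dualPairing r hr k f : ℂ) := by
  rw [dualPairing_eq, inner_truncPowLp]

theorem dualPairing_nonneg (r : ℝ) (hr : 0 ≤ r - 2) (k : ℕ) (f : L2) :
    0 ≤ dualPairing r hr k f := by
  rw [dualPairing_eq]
  exact integral_nonneg fun x => by positivity

theorem ofReal_dualPairing (r : ℝ) (hr : 0 ≤ r - 2) (k : ℕ) (f : L2) :
    ENNReal.ofReal (dualPairing r hr k f) =
      ∫⁻ x, ENNReal.ofReal (min ‖f x‖ k ^ (r - 2) * ‖f x‖ ^ 2) := by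
  rw [dualPairing_eq, ofReal_integral_eq_lintegral_ofReal (integrable_dualPairing r hr k f)
    (ae_of_all _ fun x => by positivity)]

theorem eLpNorm_truncPowLp_le {r ρ : ℝ} (h : r.HolderConjugate ρ) (hr : 0 ≤ r - 2) (k : ℕ)
    (f : L2) :
    eLpNorm (truncPowLp (r - 2) hr k f) (ENNReal.ofReal ρ) volume ≤
      ENNReal.ofReal (dualPairing r hr k f) ^ (1 / ρ) := by
  have hρ := h.symm.pos
  rw [eLpNorm_ofReal_eq _ hρ, ofReal_dualPairing]
  refine ENNReal.rpow_le_rpow ?_ (by positivity)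
  refine lintegral_mono_ae ?_
  filter_upwards [coeFn_truncPowLp (r - 2) hr k f] with x hx
  rw [hx, ← ofReal_norm, ENNReal.ofReal_rpow_of_nonneg (norm_nonneg _) hρ.le,
    norm_truncPow (Nat.cast_nonneg k)]
  refine ENNReal.ofReal_le_ofReal ?_
  have hA : 0 ≤ min ‖f x‖ (k : ℝ) := by positivity
  have hf : 0 ≤ ‖f x‖ := norm_nonneg _
  have hAf : min ‖f x‖ (k : ℝ) ≤ ‖f x‖ := min_le_left _ _
  set A := min ‖f x‖ (k : ℝ)
  rcases hA.eq_or_lt with h0 | h0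
  · rw [← h0]
    rcases hr.eq_or_lt with hr2 | hr2
    · have : ρ = 2 := by
        have h3 := h.inv_add_inv_eq_one
        have : r = 2 := by linarith
        rw [this] at h3
        have : ρ⁻¹ = 2⁻¹ := by linarith
        exact inv_injective this
      rw [← hr2, this]
      simp
    · rw [Real.zero_rpow hr2.ne', zero_mul, zero_mul, Real.zero_rpow hρ.ne']
  · have hF : 0 < ‖f x‖ := h0.trans_le hAf
    have e1 : (r - 2) * ρ = (r - 2) + (2 - ρ) := by
      have := h.mul_eq_add
      linarith
    have hρ2 : 0 ≤ 2 - ρ := by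
      have h4 := h.symm.sub_one_pos
      have h5 := h.mul_eq_add
      nlinarith
    calc (A ^ (r - 2) * ‖f x‖) ^ ρ = A ^ (r - 2) * A ^ (2 - ρ) * ‖f x‖ ^ ρ := by
          rw [Real.mul_rpow (by positivity) hf, ← Real.rpow_mul hA, e1, Real.rpow_add h0]
      _ ≤ A ^ (r - 2) * ‖f x‖ ^ (2 - ρ) * ‖f x‖ ^ ρ := by gcongr
      _ = A ^ (r - 2) * ‖f x‖ ^ 2 := by
          rw [mul_assoc, ← Real.rpow_add hF]
          norm_num

theorem tendsto_dualPairing {r : ℝ} (hr0 : 0 < r) (hr : 0 ≤ r - 2) (f : L2) :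
    Tendsto (fun k : ℕ => ENNReal.ofReal (dualPairing r hr k f)) atTop
      (𝓝 (eLpNorm f (ENNReal.ofReal r) volume ^ r)) := by
  rw [eLpNorm_ofReal_rpow _ hr0]
  simp_rw [ofReal_dualPairing]
  refine lintegral_tendsto_of_tendsto_of_monotone (fun k => ?_) (ae_of_all _ fun x => ?_)
    (ae_of_all _ fun x => ?_)
  · exact (integrable_dualPairing r hr k f).1.aemeasurable.ennreal_ofReal
  · intro k l hkl
    refine ENNReal.ofReal_le_ofReal ?_
    have : (k : ℝ) ≤ l := by exact_mod_cast hkl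
    gcongr
  · refine tendsto_const_nhds.congr' ?_
    obtain ⟨K, hK⟩ := exists_nat_ge ‖f x‖
    filter_upwards [eventually_ge_atTop K] with k hk
    have : ‖f x‖ ≤ k := hK.trans (by exact_mod_cast hk)
    rw [min_eq_left this, ← ofReal_norm, ENNReal.ofReal_rpow_of_nonneg (norm_nonneg _) hr0.le]
    congr 1
    rcases (norm_nonneg (f x)).eq_or_lt with h | h
    · rw [← h]
      rw [Real.zero_rpow hr0.ne']
      simp
    · rw [← Real.rpow_natCast, ← Real.rpow_add h]
      norm_num

theorem enorm_inner_le_eLpNorm {r ρ : ℝ} (h : r.HolderConjugate ρ) (g f : L2) :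
    ‖inner ℂ g f‖ₑ ≤
      eLpNorm g (ENNReal.ofReal ρ) volume * eLpNorm f (ENNReal.ofReal r) volume := by
  rw [L2.inner_def, eLpNorm_ofReal_eq _ h.pos, eLpNorm_ofReal_eq _ h.symm.pos]
  refine (enorm_integral_le_lintegral_enorm _).trans ?_
  refine le_trans (lintegral_mono fun x => ?_) (ENNReal.lintegral_mul_le_Lp_mul_Lq volume h.symm
    (Lp.aestronglyMeasurable g).enorm (Lp.aestronglyMeasurable f).enorm)
  rw [Pi.mul_apply, RCLike.inner_apply, enorm_mul, mul_comm]
  simp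

/-- The `L^r` norm of an `L²` function is determined by duality. -/
theorem eLpNorm_le_of_forall_inner {r ρ : ℝ} (h : r.HolderConjugate ρ) (hr : 0 ≤ r - 2) (f : L2)
    (K : ℝ≥0∞) (hK : ∀ g : L2, eLpNorm g (ENNReal.ofReal ρ) volume ≠ ⊤ →
      ‖inner ℂ g f‖ₑ ≤ eLpNorm g (ENNReal.ofReal ρ) volume * K) :
    eLpNorm f (ENNReal.ofReal r) volume ≤ K := by
  rw [← ENNReal.rpow_le_rpow_iff h.pos]
  refine le_of_tendsto' (tendsto_dualPairing h.pos hr f) fun k => ?_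
  have h1 := eLpNorm_truncPowLp_le h hr k f
  have h2 := hK (truncPowLp (r - 2) hr k f)
    (h1.trans_lt (ENNReal.rpow_lt_top_of_nonneg (one_div_nonneg.2 h.symm.nonneg) ENNReal.ofReal_ne_top)).ne
  rw [inner_truncPowLp_eq, ← ofReal_norm, Complex.norm_real,
    Real.norm_of_nonneg (dualPairing_nonneg r hr k f)] at h2
  have h3 := h2.trans (mul_le_mul_left h1 K)
  set A := ENNReal.ofReal (dualPairing r hr k f)
  have hAt : A ≠ ⊤ := ENNReal.ofReal_ne_top
  rcases eq_or_ne A 0 with h0 | h0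
  · rw [h0]; exact zero_le
  have h4 : A = A ^ (1 / ρ) * A ^ (1 / r) := by
    rw [← ENNReal.rpow_add _ _ h0 hAt]
    have := h.inv_add_inv_eq_one
    rw [one_div, one_div, add_comm, this, ENNReal.rpow_one]
  have h5 : A ^ (1 / r) ≤ K := by
    rw [h4] at h3
    have h6 : A ^ (1 / ρ) ≠ 0 := by
      simp [ENNReal.rpow_eq_zero_iff, h0, hAt]
    have h7 : A ^ (1 / ρ) ≠ ⊤ := (ENNReal.rpow_lt_top_of_nonneg (one_div_nonneg.2 h.symm.nonneg) hAt).ne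
    rw [← h4] at h3
    nth_rewrite 1 [h4] at h3
    exact (ENNReal.mul_le_mul_iff_right h6 h7).1 h3
  calc A = (A ^ (1 / r)) ^ r := by
        rw [← ENNReal.rpow_mul, one_div_mul_cancel h.pos.ne', ENNReal.rpow_one]
    _ ≤ K ^ r := ENNReal.rpow_le_rpow h5 h.nonneg

/-- Minkowski's inequality for the `L^r` norm of an `L²`-valued integral. -/
theorem eLpNorm_integral_le {r ρ : ℝ} (h : r.HolderConjugate ρ) (hr : 0 ≤ r - 2)
    {X : Type*} [MeasurableSpace X] (μ : Measure X) (F : X → L2) (hF : Integrable F μ) :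
    eLpNorm (∫ s, F s ∂μ : L2) (ENNReal.ofReal r) volume ≤
      ∫⁻ s, eLpNorm (F s) (ENNReal.ofReal r) volume ∂μ := by
  refine eLpNorm_le_of_forall_inner h hr _ _ fun g hg => ?_
  have : inner ℂ g (∫ s, F s ∂μ) = ∫ s, inner ℂ g (F s) ∂μ :=
    (integral_inner (𝕜 := ℂ) hF g).symm
  rw [this]
  refine (enorm_integral_le_lintegral_enorm _).trans ?_
  rw [← lintegral_const_mul' _ _ hg]
  exact lintegral_mono fun s => enorm_inner_le_eLpNorm h g (F s)

/-- Fatou's lemma for `L^e` norms of nonlinear expressions under `L²` convergence. -/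
theorem isClosed_setOf_eLpNorm_le {E : Type*} [NormedAddCommGroup E] (Φ : Plane → ℂ → E)
    (hΦ : ∀ x, Continuous (Φ x)) (hm : ∀ f : L2, AEStronglyMeasurable (fun x => Φ x (f x)) volume)
    (e c : ℝ≥0∞) : IsClosed {f : L2 | eLpNorm (fun x => Φ x (f x)) e volume ≤ c} := by
  refine IsSeqClosed.isClosed fun u f hu hf => ?_
  have h1 : TendstoInMeasure volume (fun n => (u n : Plane → ℂ)) atTop f :=
    tendstoInMeasure_of_tendsto_Lp hf
  obtain ⟨ns, -, hns⟩ := h1.exists_seq_tendsto_ae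
  refine (Lp.eLpNorm_lim_le_liminf_eLpNorm (f := fun n x => Φ x (u (ns n) x)) (fun n => hm _) _
    ?_).trans ?_
  · filter_upwards [hns] with x hx
    exact ((hΦ x).tendsto _).comp hx
  · refine Filter.liminf_le_of_le (by isBoundedDefault) fun b hb => ?_
    obtain ⟨k, hk⟩ := hb.exists
    exact hk.trans (hu _)

theorem measurable_eLpNorm_comp {E : Type*} [NormedAddCommGroup E] (Φ : Plane → ℂ → E)
    (hΦ : ∀ x, Continuous (Φ x)) (hm : ∀ f : L2, AEStronglyMeasurable (fun x => Φ x (f x)) volume)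
    (e : ℝ≥0∞) : @Measurable L2 ℝ≥0∞ (borel L2) _ fun f => eLpNorm (fun x => Φ x (f x)) e volume := by
  borelize L2
  exact measurable_of_Iic fun c => (isClosed_setOf_eLpNorm_le Φ hΦ hm e c).measurableSet

theorem memLp_map_simpleFunc (f : SimpleFunc Plane ℂ) (hf : f.FinMeasSupp volume) (φ : ℂ → ℂ)
    (hφ : φ 0 = 0) (e : ℝ≥0∞) : MemLp (fun x => φ (f x)) e (volume : Measure Plane) := by
  have h := hf.map hφ
  have : MemLp (f.map φ) e (volume : Measure Plane) :=
    SimpleFunc.memLp_of_finite_measure_preimage e fun y hy =>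
      (SimpleFunc.finMeasSupp_iff.1 h) y hy
  exact this

/-- The `L²` class of `φ ∘ f` for a simple function `f`. -/
def simpleLp (f : SimpleFunc Plane ℂ) (hf : f.FinMeasSupp volume) (φ : ℂ → ℂ) (hφ : φ 0 = 0) : L2 :=
  (memLp_map_simpleFunc f hf φ hφ 2).toLp

theorem coeFn_simpleLp (f : SimpleFunc Plane ℂ) (hf : f.FinMeasSupp volume) (φ : ℂ → ℂ)
    (hφ : φ 0 = 0) : simpleLp f hf φ hφ =ᵐ[volume] fun x => φ (f x) :=
  (memLp_map_simpleFunc f hf φ hφ 2).coeFn_toLp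

/-- The indicator of `{c}`, set to zero at the origin. -/
def atomFun (c z : ℂ) : ℂ := if z = c ∧ c ≠ 0 then 1 else 0

theorem atomFun_zero (c : ℂ) : atomFun c 0 = 0 := by
  unfold atomFun
  rw [if_neg]
  rintro ⟨h1, h2⟩
  exact h2 h1.symm

theorem coeFn_finsetSum {ι : Type*} (s : Finset ι) (F : ι → L2) :
    (∑ i ∈ s, F i : L2) =ᵐ[volume] fun x => ∑ i ∈ s, F i x := by
  classical
  induction s using Finset.induction_on with
  | empty =>
    simp only [Finset.sum_empty]
    exact Lp.coeFn_zero ℂ 2 (volume : Measure Plane)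
  | insert i s hi ih =>
    rw [Finset.sum_insert hi]
    filter_upwards [ih, Lp.coeFn_add (F i) (∑ i ∈ s, F i)] with x h1 h2
    rw [h2, Pi.add_apply, h1, Finset.sum_insert hi]

theorem simpleLp_eq_sum (f : SimpleFunc Plane ℂ) (hf : f.FinMeasSupp volume) (φ : ℂ → ℂ)
    (hφ : φ 0 = 0) :
    simpleLp f hf φ hφ = ∑ c ∈ f.range, φ c • simpleLp f hf (atomFun c) (atomFun_zero c) := by
  apply Lp.ext
  have h1 := coeFn_finsetSum f.range
    (fun c => φ c • simpleLp f hf (atomFun c) (atomFun_zero c))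
  have h2 : ∀ᵐ x : Plane, ∀ c ∈ f.range,
      (φ c • simpleLp f hf (atomFun c) (atomFun_zero c) : L2) x = φ c * atomFun c (f x) := by
    rw [Filter.eventually_all_finset]
    intro c _
    filter_upwards [Lp.coeFn_smul (φ c) (simpleLp f hf (atomFun c) (atomFun_zero c)),
      coeFn_simpleLp f hf (atomFun c) (atomFun_zero c)] with x h3 h4
    rw [h3, Pi.smul_apply, h4, smul_eq_mul]
  filter_upwards [h1, h2, coeFn_simpleLp f hf φ hφ] with x h3 h4 h5
  rw [h5, h3, Finset.sum_congr rfl h4, Finset.sum_eq_single (f x)]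
  · by_cases h0 : f x = 0
    · rw [h0, hφ, zero_mul]
    · simp [atomFun, h0]
  · intro c _ hc
    simp [atomFun, hc.symm]
  · intro h
    exact absurd (SimpleFunc.mem_range_self f x) h

/-- The analytic family `sgn(c) |c|^w`. -/
def signPow (w c : ℂ) : ℂ := if c = 0 then 0 else c / ‖c‖ * (‖c‖ : ℂ) ^ w

theorem signPow_zero (w : ℂ) : signPow w 0 = 0 := by simp [signPow]

theorem signPow_one (c : ℂ) : signPow 1 c = c := by
  unfold signPow
  split_ifs with h
  · exact h.symm
  · have : (‖c‖ : ℂ) ≠ 0 := by simpa using h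
    rw [Complex.cpow_one]
    field_simp

theorem norm_signPow {w : ℂ} (hw : 0 < w.re) (c : ℂ) : ‖signPow w c‖ = ‖c‖ ^ w.re := by
  unfold signPow
  split_ifs with h
  · rw [h, norm_zero, Real.zero_rpow hw.ne']
  · have h0 : 0 < ‖c‖ := norm_pos_iff.2 h
    rw [norm_mul, norm_div, Complex.norm_real, norm_norm, div_self h0.ne', one_mul,
      Complex.norm_cpow_eq_rpow_re_of_pos h0]

theorem conj_signPow (w c : ℂ) :
    (starRingEnd ℂ) (signPow ((starRingEnd ℂ) w) c) = signPow w ((starRingEnd ℂ) c) := by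
  unfold signPow
  by_cases h : c = 0
  · simp [h]
  · have h0 : 0 < ‖c‖ := norm_pos_iff.2 h
    have h1 : ¬ (starRingEnd ℂ) c = 0 := by simpa using h
    have h2 : (‖c‖ : ℂ).arg ≠ Real.pi := by
      rw [Complex.arg_ofReal_of_nonneg h0.le]
      exact Real.pi_pos.ne
    rw [if_neg h, if_neg h1, map_mul, map_div₀, Complex.conj_ofReal, RCLike.norm_conj,
      Complex.cpow_conj _ _ h2, Complex.conj_conj, Complex.conj_ofReal]

theorem differentiable_signPow (c : ℂ) : Differentiable ℂ (fun w => signPow w c) := by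
  unfold signPow
  split_ifs with h
  · exact differentiable_const _
  · have h0 : (‖c‖ : ℂ) ≠ 0 := by simpa using h
    intro w
    exact (DifferentiableAt.const_cpow differentiableAt_id (Or.inl h0)).const_mul _

theorem norm_inner_simpleLp_le (T : L2 →L[ℂ] L2) (hT : ∀ f, ‖T f‖ ≤ ‖f‖) {M : ℝ} (hM : 0 ≤ M)
    (hT1 : ∀ g f : L2, Integrable g → Integrable f →
      ‖inner ℂ g (T f)‖ ≤ M * (∫ x, ‖g x‖) * ∫ x, ‖f x‖)
    {r ρ : ℝ} (h : r.HolderConjugate ρ) (hr : 0 ≤ r - 2)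
    (g f : SimpleFunc Plane ℂ) (hg : g.FinMeasSupp volume) (hf : f.FinMeasSupp volume) :
    ‖inner ℂ (simpleLp g hg id rfl) (T (simpleLp f hf id rfl))‖ ≤
      M ^ (1 - 2 / r) * ((∫ x, ‖g x‖ ^ ρ) ^ (1 / ρ) * (∫ x, ‖f x‖ ^ ρ) ^ (1 / ρ)) := by
  have hρ := h.symm.pos
  let P : ℂ → ℂ := fun z => ρ * (1 + z) / 2
  have hP : Differentiable ℂ P := by fun_prop
  have hPre : ∀ z, (P z).re = ρ * (1 + z.re) / 2 := fun z => by
    simp only [P]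
    rw [show (ρ : ℂ) * (1 + z) / 2 = ((ρ / 2 : ℝ) : ℂ) * (1 + z) by push_cast; ring,
      Complex.re_ofReal_mul]
    simp
    ring
  have hPconj : ∀ z, P ((starRingEnd ℂ) z) = (starRingEnd ℂ) (P z) := fun z => by
    simp [P, map_ofNat]
  let Fz : ℂ → L2 := fun z => simpleLp f hf (signPow (P z)) (signPow_zero _)
  let Gz : ℂ → L2 := fun z => simpleLp g hg (signPow (P z)) (signPow_zero _)
  let Φ : ℂ → ℂ := fun z => ∑ c ∈ f.range, ∑ d ∈ g.range,
    signPow (P z) c * (signPow (P z) ((starRingEnd ℂ) d) *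
      inner ℂ (simpleLp g hg (atomFun d) (atomFun_zero d))
        (T (simpleLp f hf (atomFun c) (atomFun_zero c))))
  have hΦ : ∀ z, Φ z = inner ℂ (Gz ((starRingEnd ℂ) z)) (T (Fz z)) := fun z => by
    simp only [Φ, Fz, Gz]
    rw [simpleLp_eq_sum f, simpleLp_eq_sum g, map_sum, inner_sum]
    refine Finset.sum_congr rfl fun c _ => ?_
    rw [sum_inner]
    refine Finset.sum_congr rfl fun d _ => ?_
    rw [map_smul, inner_smul_right, inner_smul_left, hPconj, conj_signPow]
  let A : ℝ := ∫ x, ‖f x‖ ^ ρ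
  let B : ℝ := ∫ x, ‖g x‖ ^ ρ
  have hA : 0 ≤ A := integral_nonneg fun x => by positivity
  have hB : 0 ≤ B := integral_nonneg fun x => by positivity
  have norm2 : ∀ (u : SimpleFunc Plane ℂ) (hu : u.FinMeasSupp volume) (z : ℂ), z.re = 0 →
      ‖simpleLp u hu (signPow (P z)) (signPow_zero _)‖ = (∫ x, ‖u x‖ ^ ρ) ^ (1 / 2 : ℝ) := by
    intro u hu z hz
    have h1 : (P z).re = ρ / 2 := by rw [hPre, hz]; ring
    have h2 := L2.inner_def (𝕜 := ℂ) (simpleLp u hu (signPow (P z)) (signPow_zero _))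
      (simpleLp u hu (signPow (P z)) (signPow_zero _))
    have h3 : ‖simpleLp u hu (signPow (P z)) (signPow_zero _)‖ ^ 2 = ∫ x, ‖u x‖ ^ ρ := by
      have h4 := inner_self_eq_norm_sq_to_K (𝕜 := ℂ) (simpleLp u hu (signPow (P z)) (signPow_zero _))
      rw [h4] at h2
      have h5 : ∫ x, inner ℂ (simpleLp u hu (signPow (P z)) (signPow_zero _) x)
          (simpleLp u hu (signPow (P z)) (signPow_zero _) x) = ∫ x, ((‖u x‖ ^ ρ : ℝ) : ℂ) := by
        refine integral_congr_ae ?_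
        filter_upwards [coeFn_simpleLp u hu (signPow (P z)) (signPow_zero _)] with x hx
        rw [hx, inner_self_eq_norm_sq_to_K, norm_signPow (by rw [h1]; positivity), h1,
          ← RCLike.ofReal_pow, ← Real.rpow_natCast, ← Real.rpow_mul (norm_nonneg _)]
        norm_num
      have h6 : ∫ x, ((‖u x‖ ^ ρ : ℝ) : ℂ) = ((∫ x, ‖u x‖ ^ ρ : ℝ) : ℂ) := integral_ofReal
      rw [h5, h6] at h2
      refine Complex.ofReal_injective ?_
      rw [Complex.ofReal_pow]
      exact h2
    rw [← h3, ← Real.sqrt_eq_rpow, Real.sqrt_sq (norm_nonneg _)]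
  have norm1 : ∀ (u : SimpleFunc Plane ℂ) (hu : u.FinMeasSupp volume) (z : ℂ), z.re = 1 →
      Integrable (simpleLp u hu (signPow (P z)) (signPow_zero _)) ∧
      ∫ x, ‖simpleLp u hu (signPow (P z)) (signPow_zero _) x‖ = ∫ x, ‖u x‖ ^ ρ := by
    intro u hu z hz
    have h1 : (P z).re = ρ := by rw [hPre, hz]; ring
    constructor
    · rw [integrable_congr (coeFn_simpleLp u hu (signPow (P z)) (signPow_zero _))]
      exact memLp_one_iff_integrable.1 (memLp_map_simpleFunc u hu _ (signPow_zero _) 1)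
    · refine integral_congr_ae ?_
      filter_upwards [coeFn_simpleLp u hu (signPow (P z)) (signPow_zero _)] with x hx
      rw [hx, norm_signPow (by rw [h1]; exact hρ), h1]
  have hdiff : Differentiable ℂ Φ := by
    refine Differentiable.fun_sum fun c _ => Differentiable.fun_sum fun d _ => ?_
    exact ((differentiable_signPow c).comp hP).mul
      (((differentiable_signPow _).comp hP).mul_const _)
  have hbdd : BddAbove ((norm ∘ Φ) '' Complex.HadamardThreeLines.verticalClosedStrip 0 1) := by
    refine ⟨∑ c ∈ f.range, ∑ d ∈ g.range, (max 1 ‖c‖ ^ ρ * (max 1 ‖d‖ ^ ρ *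
      ‖inner ℂ (simpleLp g hg (atomFun d) (atomFun_zero d))
        (T (simpleLp f hf (atomFun c) (atomFun_zero c)))‖)), ?_⟩
    rintro _ ⟨z, hz, rfl⟩
    have hz' : 0 ≤ z.re ∧ z.re ≤ 1 := hz
    have hsp : ∀ c : ℂ, ‖signPow (P z) c‖ ≤ max 1 ‖c‖ ^ ρ := fun c => by
      have h1 : 0 < (P z).re := by rw [hPre]; nlinarith
      have h2 : (P z).re ≤ ρ := by rw [hPre]; nlinarith
      rw [norm_signPow h1]
      exact (Real.rpow_le_rpow (norm_nonneg _) (le_max_right 1 _) h1.le).trans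
        (Real.rpow_le_rpow_of_exponent_le (le_max_left _ _) h2)
    refine (norm_sum_le _ _).trans (Finset.sum_le_sum fun c _ => ?_)
    refine (norm_sum_le _ _).trans (Finset.sum_le_sum fun d _ => ?_)
    rw [norm_mul, norm_mul]
    gcongr
    · exact hsp c
    · exact (hsp _).trans (by rw [RCLike.norm_conj])
  have hθ0 : 0 ≤ 1 - 2 / r := by
    rw [sub_nonneg, div_le_one h.pos]; linarith
  have hθ1 : 1 - 2 / r ≤ 1 := by
    have : 0 ≤ 2 / r := div_nonneg (by norm_num) h.nonneg
    linarith
  have hinv := h.inv_add_inv_eq_one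
  have key := Complex.HadamardThreeLines.norm_le_interp_of_mem_verticalClosedStrip' (f := Φ)
    (z := ((1 - 2 / r : ℝ) : ℂ)) (a := B ^ (1 / 2 : ℝ) * A ^ (1 / 2 : ℝ)) (b := M * B * A)
    (l := 0) (u := 1) one_pos (by
      constructor
      · simpa only [Complex.ofReal_re] using hθ0
      · simpa only [Complex.ofReal_re] using hθ1) hdiff.diffContOnCl hbdd (fun z hz => by
      have hz' : z.re = 0 := hz
      rw [hΦ]
      refine (norm_inner_le_norm _ _).trans ?_
      refine mul_le_mul (le_of_eq (norm2 g hg _ (by simpa using hz'))) ((hT _).trans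
        (le_of_eq (norm2 f hf z hz'))) (norm_nonneg _) (by positivity)) (fun z hz => by
      have hz' : z.re = 1 := hz
      rw [hΦ]
      have k1 := norm1 g hg ((starRingEnd ℂ) z) (by simpa using hz')
      have k2 := norm1 f hf z hz'
      refine (hT1 _ _ k1.1 k2.1).trans (le_of_eq ?_)
      rw [k1.2, k2.2])
  have hPθ : P ((1 - 2 / r : ℝ) : ℂ) = 1 := by
    simp only [P]
    have : ρ * (1 + (1 - 2 / r)) / 2 = 1 := by
      have h6 : 1 / r = 1 - 1 / ρ := by rw [one_div, one_div]; linarith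
      have h7 : 2 / r = 2 * (1 - 1 / ρ) := by rw [← h6]; ring
      rw [h7]
      field_simp
      ring
    exact_mod_cast congrArg (fun x : ℝ => (x : ℂ)) this
  have hid : ∀ (u : SimpleFunc Plane ℂ) (hu : u.FinMeasSupp volume),
      simpleLp u hu (signPow 1) (signPow_zero _) = simpleLp u hu id rfl := fun u hu => by
    congr 1
    ext c
    exact signPow_one c
  have hΦθ : Φ ((1 - 2 / r : ℝ) : ℂ) =
      inner ℂ (simpleLp g hg id rfl) (T (simpleLp f hf id rfl)) := by
    rw [hΦ, Complex.conj_ofReal]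
    simp only [Fz, Gz, hPθ, hid]
  rw [hΦθ, Complex.ofReal_re, sub_zero, sub_zero, div_one] at key
  refine key.trans (le_of_eq ?_)
  set θ := 1 - 2 / r with hθ
  have e1 : 1 / ρ = (1 / 2) * (1 - θ) + θ := by
    rw [hθ, one_div ρ, show ρ⁻¹ = 1 - r⁻¹ by linarith]
    ring
  change _ = M ^ θ * (B ^ (1 / ρ) * A ^ (1 / ρ))
  have e2 : ∀ x : ℝ, 0 ≤ x → x ^ (1 / ρ) = (x ^ (1 / 2 : ℝ)) ^ (1 - θ) * x ^ θ := fun x hx => by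
    rw [e1, Real.rpow_add_of_nonneg hx (by nlinarith) hθ0, Real.rpow_mul hx]
  rw [e2 A hA, e2 B hB, Real.mul_rpow (by positivity) (by positivity),
    Real.mul_rpow (by positivity) hA, Real.mul_rpow hM hB]
  ring

/-- The `L^e` norm of a nonnegative function. -/
def lpn {X : Type*} [MeasurableSpace X] (e : ℝ) (μ : Measure X) (f : X → ℝ≥0∞) : ℝ≥0∞ :=
  (∫⁻ x, f x ^ e ∂μ) ^ (1 / e)

section Lpn

variable {X : Type*} [MeasurableSpace X] {μ : Measure X}

theorem eLpNorm_ofReal_eq_lpn {E : Type*} [ENorm E] {e : ℝ} (he : 0 < e) (f : X → E) :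
    eLpNorm f (ENNReal.ofReal e) μ = lpn e μ fun x => ‖f x‖ₑ :=
  eLpNorm_ofReal_eq μ he f

theorem eLpNorm_two_eq_lpn {E : Type*} [ENorm E] (f : X → E) :
    eLpNorm f 2 μ = lpn 2 μ fun x => ‖f x‖ₑ := by
  have := eLpNorm_ofReal_eq_lpn (μ := μ) (e := 2) (by norm_num) f
  rwa [ENNReal.ofReal_ofNat] at this

theorem lpn_rpow {e : ℝ} (he : 0 < e) (f : X → ℝ≥0∞) : lpn e μ f ^ e = ∫⁻ x, f x ^ e ∂μ := by
  rw [lpn, ← ENNReal.rpow_mul, one_div_mul_cancel he.ne', ENNReal.rpow_one]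

theorem lpn_mono_ae {e : ℝ} (he : 0 ≤ e) {f g : X → ℝ≥0∞} (h : ∀ᵐ x ∂μ, f x ≤ g x) :
    lpn e μ f ≤ lpn e μ g := by
  refine ENNReal.rpow_le_rpow (lintegral_mono_ae ?_) (one_div_nonneg.2 he)
  filter_upwards [h] with x hx
  exact ENNReal.rpow_le_rpow hx he

theorem lpn_mono {e : ℝ} (he : 0 ≤ e) {f g : X → ℝ≥0∞} (h : ∀ x, f x ≤ g x) :
    lpn e μ f ≤ lpn e μ g :=
  lpn_mono_ae he (ae_of_all _ h)

theorem lpn_mono_measure {e : ℝ} (he : 0 ≤ e) {ν : Measure X} (h : ν ≤ μ) (f : X → ℝ≥0∞) :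
    lpn e ν f ≤ lpn e μ f :=
  ENNReal.rpow_le_rpow (lintegral_mono' h le_rfl) (one_div_nonneg.2 he)

theorem lpn_const_mul {e : ℝ} (he : 0 < e) (c : ℝ≥0∞) (f : X → ℝ≥0∞) (hf : AEMeasurable f μ) :
    lpn e μ (fun x => c * f x) = c * lpn e μ f := by
  unfold lpn
  simp_rw [ENNReal.mul_rpow_of_nonneg _ _ he.le]
  rw [lintegral_const_mul'' _ (hf.pow_const _), ENNReal.mul_rpow_of_nonneg _ _ (by positivity),
    ← ENNReal.rpow_mul, mul_one_div_cancel he.ne', ENNReal.rpow_one]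

theorem lpn_add_le {e : ℝ} (he : 1 ≤ e) {f g : X → ℝ≥0∞} (hf : AEMeasurable f μ)
    (hg : AEMeasurable g μ) : lpn e μ (fun x => f x + g x) ≤ lpn e μ f + lpn e μ g :=
  ENNReal.lintegral_Lp_add_le hf hg he

theorem lpn_mul_le {a b c : ℝ} (ha : 0 < a) (hb : 0 < b) (hc : 0 < c) (h : 1 / c = 1 / a + 1 / b)
    {f g : X → ℝ≥0∞} (hf : AEMeasurable f μ) (hg : AEMeasurable g μ) :
    lpn c μ (fun x => f x * g x) ≤ lpn a μ f * lpn b μ g := by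
  have hca : c < a := by
    have : 1 / a < 1 / c := by rw [h]; linarith [one_div_pos.2 hb]
    exact (one_div_lt_one_div ha hc).1 this
  exact ENNReal.lintegral_Lp_mul_le_Lq_mul_Lr hc hca h μ hf hg

theorem lpn_rpow_fun {p q : ℝ} (hp : 0 < p) (f : X → ℝ≥0∞) :
    lpn (q / p) μ (fun x => f x ^ p) = lpn q μ f ^ p := by
  unfold lpn
  simp_rw [← ENNReal.rpow_mul]
  rw [mul_div_cancel₀ _ hp.ne']
  congr 1
  rw [one_div_div]
  ring

end Lpn

theorem eLpNorm_simpleFunc_eq {ρ : ℝ} (hρ : 0 < ρ) (f : SimpleFunc Plane ℂ)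
    (hf : f.FinMeasSupp volume) :
    eLpNorm f (ENNReal.ofReal ρ) volume = ENNReal.ofReal ((∫ x, ‖f x‖ ^ ρ) ^ (1 / ρ)) := by
  have h1 : MemLp f (ENNReal.ofReal ρ) (volume : Measure Plane) :=
    memLp_map_simpleFunc f hf id rfl _
  have h2 : Integrable (fun x => ‖f x‖ ^ ρ) := by
    have := h1.integrable_norm_rpow (by simpa using hρ) ENNReal.ofReal_ne_top
    rwa [ENNReal.toReal_ofReal hρ.le] at this
  rw [eLpNorm_ofReal_eq _ hρ, ← ENNReal.ofReal_rpow_of_nonneg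
    (integral_nonneg fun x => by positivity) (by positivity),
    ofReal_integral_eq_lintegral_ofReal h2 (ae_of_all _ fun x => by positivity)]
  congr 1
  refine lintegral_congr fun x => ?_
  rw [← ofReal_norm, ENNReal.ofReal_rpow_of_nonneg (norm_nonneg _) hρ.le]

/-- Simultaneous approximation by simple functions in `L²` and `L^ρ`. -/
theorem exists_simpleFunc_tendsto {ρ : ℝ} (hρ : 1 ≤ ρ) (f : L2)
    (hf : eLpNorm f (ENNReal.ofReal ρ) volume ≠ ⊤) :
    ∃ (s : ℕ → SimpleFunc Plane ℂ) (hs : ∀ n, (s n).FinMeasSupp volume),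
      Tendsto (fun n => simpleLp (s n) (hs n) id rfl) atTop (𝓝 f) ∧
      Tendsto (fun n => eLpNorm (s n) (ENNReal.ofReal ρ) volume) atTop
        (𝓝 (eLpNorm f (ENNReal.ofReal ρ) volume)) := by
  have hfm : Measurable (f : Plane → ℂ) := (Lp.stronglyMeasurable f).measurable
  let s := SimpleFunc.approxOn f hfm (Set.range f ∪ {0}) 0 (by simp)
  have hs2 : ∀ n, MemLp (s n) 2 volume := SimpleFunc.memLp_approxOn_range hfm (Lp.memLp f)
  have hs : ∀ n, (s n).FinMeasSupp volume := fun n =>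
    (SimpleFunc.memLp_iff_finMeasSupp (by norm_num) (by norm_num)).1 (hs2 n)
  refine ⟨s, hs, ?_, ?_⟩
  · have h1 := SimpleFunc.tendsto_approxOn_range_Lp (p := 2) (by norm_num) hfm (Lp.memLp f)
    rw [Lp.toLp_coeFn] at h1
    exact h1
  · have h1 := SimpleFunc.tendsto_approxOn_range_Lp_eLpNorm (p := ENNReal.ofReal ρ)
      (μ := volume) ENNReal.ofReal_ne_top hfm (lt_top_iff_ne_top.2 hf)
    have hρ1 : 1 ≤ ENNReal.ofReal ρ := by simpa using hρ
    have hfa := Lp.aestronglyMeasurable f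
    have hsa : ∀ n, AEStronglyMeasurable (s n) (volume : Measure Plane) := fun n => (hs2 n).1
    have up : ∀ n, eLpNorm (s n) (ENNReal.ofReal ρ) volume ≤
        eLpNorm f (ENNReal.ofReal ρ) volume +
          eLpNorm (⇑(s n) - (f : Plane → ℂ)) (ENNReal.ofReal ρ) volume := fun n => by
      have : (s n : Plane → ℂ) = (f : Plane → ℂ) + (⇑(s n) - (f : Plane → ℂ)) := by abel
      nth_rewrite 1 [this]
      exact eLpNorm_add_le hfa ((hsa n).sub hfa) hρ1
    have lo : ∀ n, eLpNorm f (ENNReal.ofReal ρ) volume -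
        eLpNorm (⇑(s n) - (f : Plane → ℂ)) (ENNReal.ofReal ρ) volume ≤
        eLpNorm (s n) (ENNReal.ofReal ρ) volume := fun n => by
      rw [tsub_le_iff_right]
      have : (f : Plane → ℂ) = ⇑(s n) - (⇑(s n) - (f : Plane → ℂ)) := by abel
      nth_rewrite 1 [this]
      exact eLpNorm_sub_le (hsa n) ((hsa n).sub hfa) hρ1
    refine tendsto_of_tendsto_of_tendsto_of_le_of_le ?_ ?_ lo up
    · have := ENNReal.Tendsto.sub (tendsto_const_nhds (x := eLpNorm f (ENNReal.ofReal ρ) volume)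
        (f := atTop)) h1 (Or.inl hf)
      rwa [tsub_zero] at this
    · have := (tendsto_const_nhds (x := eLpNorm f (ENNReal.ofReal ρ) volume)
        (f := atTop)).add h1
      rwa [add_zero] at this

/-- Interpolation between an `L¹ → L^∞` bound and an `L²` contraction. -/
theorem eLpNorm_apply_le_interpolation (T : L2 →L[ℂ] L2) (hT : ∀ f, ‖T f‖ ≤ ‖f‖) {M : ℝ}
    (hM : 0 < M) (hT1 : ∀ g f : L2, Integrable g → Integrable f →
      ‖inner ℂ g (T f)‖ ≤ M * (∫ x, ‖g x‖) * ∫ x, ‖f x‖)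
    {r ρ : ℝ} (h : r.HolderConjugate ρ) (hr : 0 ≤ r - 2) (f : L2) :
    eLpNorm (T f) (ENNReal.ofReal r) volume ≤
      ENNReal.ofReal (M ^ (1 - 2 / r)) * eLpNorm f (ENNReal.ofReal ρ) volume := by
  have hMp : 0 < M ^ (1 - 2 / r) := by positivity
  by_cases hf : eLpNorm f (ENNReal.ofReal ρ) volume = ⊤
  · rw [hf, ENNReal.mul_top (by simpa using hMp)]
    exact le_top
  refine eLpNorm_le_of_forall_inner h hr _ _ fun g hg => ?_
  obtain ⟨s, hs, hs2, hsρ⟩ := exists_simpleFunc_tendsto h.symm.lt.le f hf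
  obtain ⟨u, hu, hu2, huρ⟩ := exists_simpleFunc_tendsto h.symm.lt.le g hg
  have h1 : Tendsto (fun n => ‖inner ℂ (simpleLp (u n) (hu n) id rfl)
      (T (simpleLp (s n) (hs n) id rfl))‖ₑ) atTop (𝓝 ‖inner ℂ g (T f)‖ₑ) :=
    (hu2.inner ((T.continuous.tendsto f).comp hs2)).enorm
  have h2 : Tendsto (fun n => eLpNorm (u n) (ENNReal.ofReal ρ) volume *
      (ENNReal.ofReal (M ^ (1 - 2 / r)) * eLpNorm (s n) (ENNReal.ofReal ρ) volume)) atTop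
      (𝓝 (eLpNorm g (ENNReal.ofReal ρ) volume *
      (ENNReal.ofReal (M ^ (1 - 2 / r)) * eLpNorm f (ENNReal.ofReal ρ) volume))) := by
    have h3 := ENNReal.Tendsto.const_mul (a := ENNReal.ofReal (M ^ (1 - 2 / r))) hsρ
      (Or.inr ENNReal.ofReal_ne_top)
    exact ENNReal.Tendsto.mul huρ (Or.inr (ENNReal.mul_ne_top ENNReal.ofReal_ne_top hf)) h3
      (Or.inr hg)
  refine le_of_tendsto_of_tendsto' h1 h2 fun n => ?_
  rw [eLpNorm_simpleFunc_eq h.symm.pos _ (hs n), eLpNorm_simpleFunc_eq h.symm.pos _ (hu n),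
    ← ENNReal.ofReal_mul hMp.le, ← ENNReal.ofReal_mul (by positivity), ← ofReal_norm]
  refine ENNReal.ofReal_le_ofReal ?_
  refine (norm_inner_simpleLp_le T hT hM.le hT1 h hr (u n) (s n) (hu n) (hs n)).trans (le_of_eq ?_)
  ring

/-- The dispersive estimate for the free Schrödinger propagator. -/
theorem eLpNorm_freeProp_le {r ρ : ℝ} (h : r.HolderConjugate ρ) (hr : 0 ≤ r - 2) {t : ℝ}
    (ht : t ≠ 0) (f : L2) :
    eLpNorm (freeProp t f) (ENNReal.ofReal r) volume ≤
      ENNReal.ofReal (|t| ^ (-(1 - 2 / r))) * eLpNorm f (ENNReal.ofReal ρ) volume := by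
  have ht' : 0 < |t| := abs_pos.2 ht
  have := eLpNorm_apply_le_interpolation (freePropₗᵢ t).toContinuousLinearMap
    (fun f => (norm_freeProp t f).le) (inv_pos.2 ht')
    (fun g f hg hf => norm_inner_freeProp_le t ht g f hg hf) h hr f
  rwa [Real.inv_rpow ht'.le, ← Real.rpow_neg ht'.le] at this

/-- The Hausdorff–Young inequality for functions in `L²`. -/
theorem eLpNorm_le_eLpNorm_fourier {r ρ : ℝ} (h : r.HolderConjugate ρ) (hr : 0 ≤ r - 2) (f : L2) :
    eLpNorm f (ENNReal.ofReal r) volume ≤ eLpNorm (𝓕 f : L2) (ENNReal.ofReal ρ) volume := by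
  have := eLpNorm_apply_le_interpolation
    ((Lp.fourierTransformₗᵢ Plane ℂ).symm.toLinearIsometry.toContinuousLinearMap)
    (fun f => ((Lp.fourierTransformₗᵢ Plane ℂ).symm.norm_map f).le) one_pos
    (fun g f hg hf => by
      have h1 : inner ℂ g ((Lp.fourierTransformₗᵢ Plane ℂ).symm f) = inner ℂ (𝓕 g : L2) f := by
        rw [← Lp.inner_fourier_eq g]
        congr 1
        exact (Lp.fourierTransformₗᵢ Plane ℂ).apply_symm_apply f
      change ‖inner ℂ g ((Lp.fourierTransformₗᵢ Plane ℂ).symm f)‖ ≤ _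
      rw [h1, norm_inner_symm]
      refine (norm_inner_fourier_le f g hf hg).trans (le_of_eq ?_)
      ring) h hr (𝓕 f)
  rw [Real.one_rpow, ENNReal.ofReal_one, one_mul] at this
  refine le_trans (le_of_eq ?_) this
  exact congrArg (fun u : L2 => eLpNorm u (ENNReal.ofReal r) volume)
    ((Lp.fourierTransformₗᵢ Plane ℂ).symm_apply_apply f).symm

theorem exists_eLpNorm_le_h1Norm {r ρ : ℝ} (h : r.HolderConjugate ρ) (hr : 0 < r - 2) :
    ∃ C : ℝ≥0, ∀ f : L2, eLpNorm f (ENNReal.ofReal r) volume ≤ C * h1Norm f := by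
  have hr0 := h.pos
  have hρ0 := h.symm.pos
  set e := 2 * r / (r - 2) with he
  have he0 : 0 < e := by positivity
  have he2 : 2 < e := by
    rw [he, lt_div_iff₀ hr]; linarith
  have hsplit : 1 / ρ = 1 / e + 1 / 2 := by
    have h1 := h.inv_add_inv_eq_one
    rw [one_div, show ρ⁻¹ = 1 - r⁻¹ by linarith, he]
    field_simp
    ring
  have hint := integrable_one_add_norm (E := Plane) (μ := volume) (r := e) (by simpa using he2)
  set K := lpn e volume fun ξ : Plane => ‖(h1Symbol ξ)⁻¹‖ₑ with hK
  have hKt : K ≠ ⊤ := by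
    have h1 : K ≤ lpn e volume fun ξ : Plane => ENNReal.ofReal (2 * (1 + ‖ξ‖)⁻¹) := by
      refine lpn_mono he0.le fun ξ => ?_
      rw [← ofReal_norm, norm_inv, norm_h1Symbol]
      refine ENNReal.ofReal_le_ofReal ?_
      rw [← div_eq_mul_inv, ← inv_div]
      refine inv_anti₀ (by positivity) ?_
      refine Real.le_sqrt_of_sq_le ?_
      have := Real.pi_gt_three
      have h2 : 0 ≤ ‖ξ‖ := norm_nonneg ξ
      have h3 : ‖ξ‖ ≤ 2 * Real.pi * ‖ξ‖ := by nlinarith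
      nlinarith [sq_nonneg (‖ξ‖ - 1)]
    have h2 : (lpn e volume fun ξ : Plane => ENNReal.ofReal (2 * (1 + ‖ξ‖)⁻¹)) < ⊤ := by
      unfold lpn
      refine ENNReal.rpow_lt_top_of_nonneg (by positivity) ?_
      have h3 : ∀ ξ : Plane, ENNReal.ofReal (2 * (1 + ‖ξ‖)⁻¹) ^ e =
          ENNReal.ofReal (2 ^ e * (1 + ‖ξ‖) ^ (-e)) := fun ξ => by
        rw [ENNReal.ofReal_rpow_of_nonneg (by positivity) he0.le,
          Real.mul_rpow (by norm_num) (by positivity), Real.inv_rpow (by positivity),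
          ← Real.rpow_neg (by positivity)]
      simp_rw [h3]
      have h4 := (hint.const_mul (2 ^ e)).lintegral_lt_top
      exact h4.ne
    exact (h1.trans_lt h2).ne
  refine ⟨K.toNNReal, fun f => ?_⟩
  rw [ENNReal.coe_toNNReal hKt]
  refine (eLpNorm_le_eLpNorm_fourier h hr.le f).trans ?_
  rw [h1Norm_eq, eLpNorm_two_eq_lpn, eLpNorm_ofReal_eq_lpn hρ0]
  refine le_trans (lpn_mono hρ0.le fun ξ => ?_) (lpn_mul_le he0 (by norm_num) hρ0 hsplit ?_ ?_)
  · have h0 : h1Symbol ξ ≠ 0 := by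
      rw [← norm_ne_zero_iff, norm_h1Symbol]
      positivity
    rw [← enorm_mul, inv_mul_cancel_left₀ h0]
  · exact (continuous_h1Symbol.measurable.inv).enorm.aemeasurable
  · exact (aestronglyMeasurable_h1 f).enorm

theorem lintegral_comp_abs (φ : ℝ → ℝ≥0∞) :
    ∫⁻ x : ℝ, φ |x| = 2 * ∫⁻ x in Set.Ioi (0 : ℝ), φ x := by
  have h1 : ∫⁻ x in Set.Ioi (0 : ℝ), φ |x| = ∫⁻ x in Set.Ioi (0 : ℝ), φ x :=
    setLIntegral_congr_fun measurableSet_Ioi fun x hx => by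
      rw [abs_of_pos hx]
  have h2 : ∫⁻ x in Set.Iio (0 : ℝ), φ |x| = ∫⁻ x in Set.Ioi (0 : ℝ), φ x := by
    have h3 := (Measure.measurePreserving_neg (volume : Measure ℝ)).setLIntegral_comp_preimage_emb
      (MeasurableEquiv.neg ℝ).measurableEmbedding (fun x => φ |x|) (Set.Ioi 0)
    simp only [abs_neg] at h3
    rw [← h1, ← h3]
    congr 2
    ext x
    simp
  rw [← lintegral_add_compl _ (measurableSet_Ioi (a := (0 : ℝ))), h1, Set.compl_Ioi,
    setLIntegral_congr Iio_ae_eq_Iic.symm, h2, two_mul]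

theorem lintegral_near_zero {α R : ℝ} (hα : α < 1) (hR : 0 < R) :
    ∫⁻ x : ℝ, (if |x| ≤ R then ENNReal.ofReal (|x| ^ (-α)) else 0) =
      ENNReal.ofReal (2 / (1 - α) * R ^ (1 - α)) := by
  rw [lintegral_comp_abs (fun x => if x ≤ R then ENNReal.ofReal (x ^ (-α)) else 0)]
  have hint : IntervalIntegrable (fun x : ℝ => x ^ (-α)) volume 0 R :=
    intervalIntegral.intervalIntegrable_rpow' (by linarith)
  have h1 : ∫⁻ x in Set.Ioi (0 : ℝ), (if x ≤ R then ENNReal.ofReal (x ^ (-α)) else 0) =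
      ∫⁻ x in Set.Ioc (0 : ℝ) R, ENNReal.ofReal (x ^ (-α)) := by
    rw [← lintegral_indicator measurableSet_Ioi, ← lintegral_indicator measurableSet_Ioc]
    refine lintegral_congr fun x => ?_
    by_cases h0 : 0 < x <;> by_cases hx : x ≤ R <;> simp [Set.indicator, h0, hx]
  have h2 : ∫⁻ x in Set.Ioc (0 : ℝ) R, ENNReal.ofReal (x ^ (-α)) =
      ENNReal.ofReal (R ^ (1 - α) / (1 - α)) := by
    rw [← ofReal_integral_eq_lintegral_ofReal hint.1 ?_, ← intervalIntegral.integral_of_le hR.le,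
      integral_rpow (Or.inl (by linarith))]
    · congr 1
      rw [Real.zero_rpow (by linarith)]
      rw [sub_zero]
      congr 1 <;> [congr 1; skip] <;> ring
    · exact (ae_restrict_iff' measurableSet_Ioc).2 (ae_of_all _ fun x hx =>
        Real.rpow_nonneg hx.1.le _)
  rw [h1, h2, show (2 : ℝ≥0∞) = ENNReal.ofReal 2 by norm_num, ← ENNReal.ofReal_mul (by norm_num)]
  congr 1
  ring

theorem lintegral_away_zero {R : ℝ} (hR : 0 < R) :
    ∫⁻ x : ℝ, (if R < |x| then ENNReal.ofReal (|x| ^ (-2 : ℝ)) else 0) =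
      ENNReal.ofReal (2 * R⁻¹) := by
  rw [lintegral_comp_abs (fun x => if R < x then ENNReal.ofReal (x ^ (-2 : ℝ)) else 0)]
  have hint := integrableOn_Ioi_rpow_of_lt (by norm_num : (-2 : ℝ) < -1) hR
  have h1 : ∫⁻ x in Set.Ioi (0 : ℝ), (if R < x then ENNReal.ofReal (x ^ (-2 : ℝ)) else 0) =
      ∫⁻ x in Set.Ioi R, ENNReal.ofReal (x ^ (-2 : ℝ)) := by
    rw [← lintegral_indicator measurableSet_Ioi, ← lintegral_indicator measurableSet_Ioi]
    refine lintegral_congr fun x => ?_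
    by_cases hx : R < x
    · simp [Set.indicator, hx, hR.trans hx]
    · simp [Set.indicator, hx]
  have h2 : ∫⁻ x in Set.Ioi R, ENNReal.ofReal (x ^ (-2 : ℝ)) = ENNReal.ofReal R⁻¹ := by
    rw [← ofReal_integral_eq_lintegral_ofReal hint ?_,
      integral_Ioi_rpow_of_lt (by norm_num) hR]
    · congr 1
      norm_num
      rw [Real.rpow_neg_one]
    · exact (ae_restrict_iff' measurableSet_Ioi).2 (ae_of_all _ fun x hx =>
        Real.rpow_nonneg (hR.trans hx).le _)
  rw [h1, h2, show (2 : ℝ≥0∞) = ENNReal.ofReal 2 by norm_num, ← ENNReal.ofReal_mul (by norm_num)]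

/-- The kernel `|t|^{-α}`. -/
def riesz (α t : ℝ) : ℝ≥0∞ := ENNReal.ofReal (|t| ^ (-α))

theorem measurable_riesz (α : ℝ) : Measurable (riesz α) := by
  unfold riesz
  fun_prop

theorem riesz_neg (α t : ℝ) : riesz α (-t) = riesz α t := by simp [riesz]

theorem lintegral_min_mul_riesz_le {α : ℝ} (hα0 : 0 < α) (hα1 : α < 1) {f : ℝ → ℝ≥0∞}
    (hf : Measurable f) (hf1 : ∫⁻ s, f s ^ (2 / (2 - α)) ≤ 1) (t : ℝ) {b : ℝ} (hb : 0 < b) :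
    ∫⁻ s, min (f s) (ENNReal.ofReal b) * riesz α (t - s) ≤
      ENNReal.ofReal (2 / (1 - α) + 2) * ENNReal.ofReal b ^ (2 / (2 - α) - 1) := by
  set c := 2 / (2 - α) with hc
  have h2α : 0 < 2 - α := by linarith
  have hc0 : 0 < c := by positivity
  set R := b ^ (-c) with hR
  have hR0 : 0 < R := by positivity
  have k1 : b * R ^ (1 - α) = b ^ (c - 1) := by
    rw [hR, ← Real.rpow_mul hb.le]
    nth_rewrite 1 [← Real.rpow_one b]
    rw [← Real.rpow_add hb]
    congr 1
    rw [hc]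
    field_simp
    ring
  have k2 : (2 * R⁻¹) ^ (α / 2) ≤ 2 * b ^ (c - 1) := by
    rw [hR, ← Real.rpow_neg hb.le, neg_neg, Real.mul_rpow (by norm_num) (by positivity),
      ← Real.rpow_mul hb.le]
    have : c * (α / 2) = c - 1 := by
      rw [hc]; field_simp; ring
    rw [this]
    gcongr
    calc (2 : ℝ) ^ (α / 2) ≤ 2 ^ (1 : ℝ) :=
          Real.rpow_le_rpow_of_exponent_le (by norm_num) (by linarith)
      _ = 2 := Real.rpow_one 2
  have hpt : ∀ s, min (f s) (ENNReal.ofReal b) * riesz α (t - s) ≤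
      ENNReal.ofReal b * (if |t - s| ≤ R then riesz α (t - s) else 0) +
      (f s * (if R < |t - s| then riesz α (t - s) else 0)) := fun s => by
    by_cases hs : |t - s| ≤ R
    · rw [if_pos hs]
      refine le_add_right ?_
      gcongr
      exact min_le_right _ _
    · rw [if_neg hs, if_pos (not_le.1 hs), mul_zero, zero_add]
      gcongr
      exact min_le_left _ _
  have hm1 : Measurable fun s => if |t - s| ≤ R then riesz α (t - s) else 0 :=
    Measurable.ite (measurableSet_le (by fun_prop) measurable_const)
      ((measurable_riesz α).comp (by fun_prop)) measurable_const
  have hm2 : Measurable fun s => if R < |t - s| then riesz α (t - s) else 0 :=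
    Measurable.ite (measurableSet_lt measurable_const (by fun_prop))
      ((measurable_riesz α).comp (by fun_prop)) measurable_const
  have n1 : ∫⁻ s, ENNReal.ofReal b * (if |t - s| ≤ R then riesz α (t - s) else 0) ≤
      ENNReal.ofReal (2 / (1 - α)) * ENNReal.ofReal b ^ (c - 1) := by
    rw [lintegral_const_mul _ hm1,
      lintegral_sub_left_eq_self (fun x => if |x| ≤ R then riesz α x else 0) t]
    unfold riesz
    rw [lintegral_near_zero hα1 hR0, ENNReal.ofReal_rpow_of_pos hb, ← ENNReal.ofReal_mul hb.le,
      ← ENNReal.ofReal_mul (div_nonneg (by norm_num) (by linarith)), ← k1]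
    refine ENNReal.ofReal_le_ofReal (le_of_eq ?_)
    ring
  have n2 : ∫⁻ s, f s * (if R < |t - s| then riesz α (t - s) else 0) ≤
      ENNReal.ofReal 2 * ENNReal.ofReal b ^ (c - 1) := by
    have hconj : c.HolderConjugate (2 / α) := by
      rw [Real.holderConjugate_iff]
      constructor
      · rw [hc, lt_div_iff₀ h2α]; linarith
      · rw [hc]; field_simp; ring
    refine (ENNReal.lintegral_mul_le_Lp_mul_Lq volume hconj hf.aemeasurable
      hm2.aemeasurable).trans ?_
    have h3 : (∫⁻ s, f s ^ c) ^ (1 / c) ≤ 1 :=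
      (ENNReal.rpow_le_rpow hf1 (by positivity)).trans (le_of_eq (ENNReal.one_rpow _))
    have h4 : ∫⁻ s, (if R < |t - s| then riesz α (t - s) else 0) ^ (2 / α) =
        ENNReal.ofReal (2 * R⁻¹) := by
      rw [← lintegral_away_zero hR0,
        lintegral_sub_left_eq_self (fun x => (if R < |x| then riesz α x else 0) ^ (2 / α)) t]
      refine lintegral_congr fun x => ?_
      split_ifs with hx
      · have hx0 : 0 < |x| := hR0.trans hx
        rw [riesz, ENNReal.ofReal_rpow_of_pos (by positivity), ← Real.rpow_mul hx0.le]
        congr 2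
        field_simp
      · rw [ENNReal.zero_rpow_of_pos (by positivity)]
    rw [h4, show 1 / (2 / α) = α / 2 from one_div_div _ _,
      ENNReal.ofReal_rpow_of_pos (by positivity), ENNReal.ofReal_rpow_of_pos hb,
      ← ENNReal.ofReal_mul (by norm_num)]
    refine (mul_le_mul_left h3 _).trans ?_
    rw [one_mul]
    exact ENNReal.ofReal_le_ofReal k2
  calc _ ≤ ∫⁻ s, (ENNReal.ofReal b * (if |t - s| ≤ R then riesz α (t - s) else 0) +
      (f s * (if R < |t - s| then riesz α (t - s) else 0))) := lintegral_mono hpt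
    _ ≤ _ := by
      rw [lintegral_add_left (hm1.const_mul _),
        ENNReal.ofReal_add (div_nonneg (by norm_num) (by linarith)) (by norm_num), add_mul]
      exact add_le_add n1 n2

theorem lintegral_mul_min_mul_riesz_le {α : ℝ} (hα0 : 0 < α) (hα1 : α < 1) {f g : ℝ → ℝ≥0∞}
    (hf : Measurable f) (hf1 : ∫⁻ s, f s ^ (2 / (2 - α)) ≤ 1)
    (hg1 : ∫⁻ s, g s ^ (2 / (2 - α)) ≤ 1) :
    ∫⁻ t, g t * ∫⁻ s, min (f s) (g t) * riesz α (t - s) ≤ ENNReal.ofReal (2 / (1 - α) + 2) := by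
  have h2α : 0 < 2 - α := by linarith
  have hC : 0 < 2 / (1 - α) + 2 := by
    have : 0 < 1 - α := by linarith
    positivity
  have hc0 : 0 < 2 / (2 - α) := by positivity
  calc _ ≤ ∫⁻ t, ENNReal.ofReal (2 / (1 - α) + 2) * g t ^ (2 / (2 - α)) := by
        refine lintegral_mono fun t => ?_
        rcases eq_or_ne (g t) ⊤ with h | h
        · rw [h, ENNReal.top_rpow_of_pos hc0, ENNReal.mul_top (by simpa using hC)]
          exact le_top
        rcases eq_or_ne (g t) 0 with h0 | h0
        · rw [h0, zero_mul]
          exact zero_le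
        have hb : 0 < (g t).toReal := ENNReal.toReal_pos h0 h
        have := lintegral_min_mul_riesz_le hα0 hα1 hf hf1 t hb
        rw [ENNReal.ofReal_toReal h] at this
        calc _ ≤ g t * (ENNReal.ofReal (2 / (1 - α) + 2) * g t ^ (2 / (2 - α) - 1)) := by gcongr
          _ = _ := by
            rw [mul_left_comm]
            congr 1
            nth_rewrite 1 [← ENNReal.rpow_one (g t)]
            rw [← ENNReal.rpow_add _ _ h0 h]
            congr 1
            ring
    _ ≤ ENNReal.ofReal (2 / (1 - α) + 2) * 1 := by
        rw [lintegral_const_mul' _ _ ENNReal.ofReal_ne_top]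
        gcongr
    _ = _ := mul_one _

theorem lintegral_riesz_le_of_normalized {α : ℝ} (hα0 : 0 < α) (hα1 : α < 1) {f g : ℝ → ℝ≥0∞}
    (hf : Measurable f) (hg : Measurable g) (hf1 : ∫⁻ s, f s ^ (2 / (2 - α)) ≤ 1)
    (hg1 : ∫⁻ s, g s ^ (2 / (2 - α)) ≤ 1) :
    ∫⁻ t, ∫⁻ s, f s * g t * riesz α (t - s) ≤ 2 * ENNReal.ofReal (2 / (1 - α) + 2) := by
  have hm : Measurable fun x : ℝ × ℝ => min (f x.2) (g x.1) * riesz α (x.1 - x.2) :=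
    ((hf.comp measurable_snd).min (hg.comp measurable_fst)).mul
      ((measurable_riesz α).comp (measurable_fst.sub measurable_snd))
  have hm1 : Measurable fun x : ℝ × ℝ => g x.1 * (min (f x.2) (g x.1) * riesz α (x.1 - x.2)) :=
    (hg.comp measurable_fst).mul hm
  have hm2 : Measurable fun x : ℝ × ℝ => f x.2 * (min (f x.2) (g x.1) * riesz α (x.1 - x.2)) :=
    (hf.comp measurable_snd).mul hm
  have h1 : ∫⁻ t, ∫⁻ s, g t * (min (f s) (g t) * riesz α (t - s)) ≤
      ENNReal.ofReal (2 / (1 - α) + 2) := by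
    refine le_trans (le_of_eq (lintegral_congr fun t => ?_))
      (lintegral_mul_min_mul_riesz_le hα0 hα1 hf hf1 hg1)
    exact lintegral_const_mul _ (hm.comp measurable_prodMk_left)
  have h2 : ∫⁻ t, ∫⁻ s, f s * (min (f s) (g t) * riesz α (t - s)) ≤
      ENNReal.ofReal (2 / (1 - α) + 2) := by
    rw [lintegral_lintegral_swap hm2.aemeasurable]
    refine le_trans (le_of_eq (lintegral_congr fun t => ?_))
      (lintegral_mul_min_mul_riesz_le hα0 hα1 hg hg1 hf1)
    refine (lintegral_const_mul _ (hm.comp measurable_prodMk_right)).trans ?_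
    congr 1
    refine lintegral_congr fun s => ?_
    rw [min_comm, ← riesz_neg, neg_sub]
    rfl
  calc _ ≤ ∫⁻ t, ∫⁻ s, (g t * (min (f s) (g t) * riesz α (t - s)) +
        f s * (min (f s) (g t) * riesz α (t - s))) := by
        refine lintegral_mono fun t => lintegral_mono fun s => ?_
        rw [← add_mul, ← mul_assoc, ← min_mul_max (f s) (g t), mul_comm (min (f s) (g t))]
        gcongr
        exact max_le le_add_self le_self_add
    _ = (∫⁻ t, ∫⁻ s, g t * (min (f s) (g t) * riesz α (t - s))) +
        ∫⁻ t, ∫⁻ s, f s * (min (f s) (g t) * riesz α (t - s)) := by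
        rw [← lintegral_add_left hm1.lintegral_prod_right']
        refine lintegral_congr fun t => ?_
        exact lintegral_add_left (hm1.comp measurable_prodMk_left) _
    _ ≤ _ := by rw [two_mul]; exact add_le_add h1 h2

/-- The constant in the one-dimensional Hardy–Littlewood–Sobolev inequality below. -/
def hlsConst (α : ℝ) : ℝ≥0∞ := 2 * ENNReal.ofReal (2 / (1 - α) + 2)

theorem hlsConst_ne_top (α : ℝ) : hlsConst α ≠ ⊤ :=
  ENNReal.mul_ne_top (by norm_num) ENNReal.ofReal_ne_top

theorem hlsConst_pos {α : ℝ} (hα1 : α < 1) : hlsConst α ≠ 0 := by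
  have : 0 < 1 - α := by linarith
  have : 0 < 2 / (1 - α) + 2 := by positivity
  simpa [hlsConst] using this

/-- The Hardy–Littlewood–Sobolev inequality on the line, bilinear form. -/
theorem lintegral_riesz_le {α : ℝ} (hα0 : 0 < α) (hα1 : α < 1) {f g : ℝ → ℝ≥0∞}
    (hf : AEMeasurable f) (hg : AEMeasurable g) :
    ∫⁻ t, ∫⁻ s, f s * g t * riesz α (t - s) ≤
      hlsConst α * (lpn (2 / (2 - α)) volume f * lpn (2 / (2 - α)) volume g) := by
  have h2α : 0 < 2 - α := by linarith
  set c := 2 / (2 - α) with hc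
  have hc0 : 0 < c := by positivity
  wlog hM : Measurable f ∧ Measurable g generalizing f g
  · have := this hf.measurable_mk.aemeasurable hg.measurable_mk.aemeasurable
      ⟨hf.measurable_mk, hg.measurable_mk⟩
    have e1 : ∀ {f : ℝ → ℝ≥0∞} (hf : AEMeasurable f), lpn c volume (hf.mk f) = lpn c volume f := by
      intro f hf
      unfold lpn
      congr 1
      refine lintegral_congr_ae ?_
      filter_upwards [hf.ae_eq_mk] with x hx
      rw [hx]
    rw [e1, e1] at this
    refine le_trans (le_of_eq ?_) this
    refine lintegral_congr_ae ?_
    filter_upwards [hg.ae_eq_mk] with t ht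
    refine lintegral_congr_ae ?_
    filter_upwards [hf.ae_eq_mk] with s hs
    rw [ht, hs]
  obtain ⟨hf, hg⟩ := hM
  have zero : ∀ f : ℝ → ℝ≥0∞, Measurable f → lpn c volume f = 0 → f =ᵐ[volume] 0 := by
    intro f hf h0
    have h1 : ∫⁻ x, f x ^ c = 0 := by
      rw [← lpn_rpow hc0, h0, ENNReal.zero_rpow_of_pos hc0]
    rw [lintegral_eq_zero_iff (hf.pow_const c)] at h1
    filter_upwards [h1] with x hx
    have : f x ^ c = 0 := hx
    rw [ENNReal.rpow_eq_zero_iff] at this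
    rcases this with h | h
    · exact h.1
    · exact absurd h.2 (not_lt.2 hc0.le)
  rcases eq_or_ne (lpn c volume f) 0 with hf0 | hf0
  · rw [hf0, zero_mul, mul_zero, nonpos_iff_eq_zero]
    have : ∀ t, ∫⁻ s, f s * g t * riesz α (t - s) = 0 := fun t => by
      rw [← lintegral_zero (μ := (volume : Measure ℝ))]
      refine lintegral_congr_ae ?_
      filter_upwards [zero f hf hf0] with s hs
      rw [hs]; simp
    simp [this]
  rcases eq_or_ne (lpn c volume g) 0 with hg0 | hg0
  · rw [hg0, mul_zero, mul_zero, nonpos_iff_eq_zero]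
    rw [← lintegral_zero (μ := (volume : Measure ℝ))]
    refine lintegral_congr_ae ?_
    filter_upwards [zero g hg hg0] with t ht
    rw [ht]; simp
  rcases eq_or_ne (lpn c volume f) ⊤ with hft | hft
  · rw [hft, ENNReal.top_mul hg0, ENNReal.mul_top (hlsConst_pos hα1)]
    exact le_top
  rcases eq_or_ne (lpn c volume g) ⊤ with hgt | hgt
  · rw [hgt, ENNReal.mul_top hf0, ENNReal.mul_top (hlsConst_pos hα1)]
    exact le_top
  have norm1 : ∀ f : ℝ → ℝ≥0∞, Measurable f → lpn c volume f ≠ 0 → lpn c volume f ≠ ⊤ →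
      ∫⁻ s, ((lpn c volume f)⁻¹ * f s) ^ c ≤ 1 := by
    intro f hf h0 ht
    rw [← lpn_rpow hc0, lpn_const_mul hc0 _ _ hf.aemeasurable, ENNReal.inv_mul_cancel h0 ht,
      ENNReal.one_rpow]
  have := lintegral_riesz_le_of_normalized hα0 hα1 (hf.const_mul (lpn c volume f)⁻¹)
    (hg.const_mul (lpn c volume g)⁻¹) (norm1 f hf hf0 hft) (norm1 g hg hg0 hgt)
  have e : ∀ t, ∫⁻ s, f s * g t * riesz α (t - s) = (lpn c volume f * lpn c volume g) *
      ∫⁻ s, (lpn c volume f)⁻¹ * f s * ((lpn c volume g)⁻¹ * g t) * riesz α (t - s) := fun t => by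
    rw [← lintegral_const_mul' _ _ (ENNReal.mul_ne_top hft hgt)]
    refine lintegral_congr fun s => ?_
    calc _ = (lpn c volume f * (lpn c volume f)⁻¹) * (lpn c volume g * (lpn c volume g)⁻¹) *
        (f s * g t * riesz α (t - s)) := by
          rw [ENNReal.mul_inv_cancel hf0 hft, ENNReal.mul_inv_cancel hg0 hgt, one_mul, one_mul]
      _ = _ := by ring
  simp_rw [e]
  rw [lintegral_const_mul' _ _ (ENNReal.mul_ne_top hft hgt), mul_comm]
  gcongr
  exact this

/-- Duality for `L^e` norms of nonnegative functions on the line. -/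
theorem lpn_le_of_forall_lintegral_mul_le {a c : ℝ} (h : a.HolderConjugate c) {H : ℝ → ℝ≥0∞}
    (hH : AEMeasurable H) (K : ℝ≥0∞)
    (hK : ∀ (g : ℝ → ℝ≥0∞), AEMeasurable g → (∀ t, g t ≠ ⊤) → (∃ k : ℝ, ∀ t, k < |t| → g t = 0) →
      (∃ k : ℝ≥0, ∀ t, g t ≤ k) →
      ∫⁻ t, H t * g t ≤ K * lpn c volume g) : lpn a volume H ≤ K := by
  have ha0 := h.pos
  have hc0 := h.symm.pos
  let S : ℕ → Set ℝ := fun k => Set.Icc (-(k : ℝ)) k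
  let A : ℕ → ℝ → ℝ≥0∞ := fun k => (S k).indicator fun t => min (H t) k
  have hAm : ∀ k, AEMeasurable (A k) := fun k =>
    (hH.min aemeasurable_const).indicator measurableSet_Icc
  have hAk : ∀ k t, A k t ≤ k := fun k t => by
    simp only [A, Set.indicator]
    split_ifs
    · exact min_le_right _ _
    · exact zero_le
  have hAH : ∀ k t, A k t ≤ H t := fun k t => by
    simp only [A, Set.indicator]
    split_ifs
    · exact min_le_left _ _
    · exact zero_le
  have ha1 : 0 < a - 1 := h.sub_one_pos
  have hbound : ∀ k, ∫⁻ t, A k t ^ a ≤ K ^ a := fun k => by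
    have hfin : ∫⁻ t, A k t ^ a ≠ ⊤ := by
      have h1 : ∫⁻ t, A k t ^ a ≤ ∫⁻ t in S k, (k : ℝ≥0∞) ^ a := by
        rw [← lintegral_indicator measurableSet_Icc]
        refine lintegral_mono fun t => ?_
        by_cases ht : t ∈ S k
        · rw [Set.indicator_of_mem ht]
          exact ENNReal.rpow_le_rpow (hAk k t) ha0.le
        · simp only [A]
          rw [Set.indicator_of_notMem ht, Set.indicator_of_notMem ht,
            ENNReal.zero_rpow_of_pos ha0]
      refine (h1.trans_lt ?_).ne
      rw [setLIntegral_const, Real.volume_Icc]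
      exact ENNReal.mul_lt_top (ENNReal.rpow_lt_top_of_nonneg ha0.le (ENNReal.natCast_ne_top k))
        ENNReal.ofReal_lt_top
    have h2 := hK (fun t => A k t ^ (a - 1)) ((hAm k).pow_const _)
      (fun t => (ENNReal.rpow_lt_top_of_nonneg ha1.le
        ((hAk k t).trans_lt (ENNReal.natCast_lt_top k)).ne).ne) ⟨k, fun t ht => by
          have : t ∉ S k := fun h => by
            have := abs_le.2 h
            linarith
          simp only [A]
          rw [Set.indicator_of_notMem this, ENNReal.zero_rpow_of_pos ha1]⟩
        ⟨(k : ℝ≥0) ^ (a - 1), fun t => by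
          refine (ENNReal.rpow_le_rpow (hAk k t) ha1.le).trans (le_of_eq ?_)
          rw [ENNReal.coe_rpow_of_nonneg _ ha1.le]
          simp⟩
    have h3 : lpn c volume (fun t => A k t ^ (a - 1)) = (∫⁻ t, A k t ^ a) ^ (1 / c) := by
      unfold lpn
      simp_rw [← ENNReal.rpow_mul]
      rw [h.sub_one_mul_conj]
    have h4 : ∫⁻ t, A k t ^ a ≤ ∫⁻ t, H t * A k t ^ (a - 1) := by
      refine lintegral_mono fun t => ?_
      calc A k t ^ a = A k t ^ (1 + (a - 1)) := by congr 1; ring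
        _ = A k t * A k t ^ (a - 1) := by
          rw [ENNReal.rpow_add_of_nonneg _ _ zero_le_one ha1.le, ENNReal.rpow_one]
        _ ≤ _ := by gcongr; exact hAH k t
    rw [h3] at h2
    have h5 := h4.trans h2
    set I := ∫⁻ t, A k t ^ a
    rcases eq_or_ne I 0 with h0 | h0
    · rw [h0]; exact zero_le
    have h6 : I = I ^ (1 / a) * I ^ (1 / c) := by
      rw [← ENNReal.rpow_add _ _ h0 hfin, one_div, one_div, h.inv_add_inv_eq_one, ENNReal.rpow_one]
    have h7 : I ^ (1 / a) ≤ K := by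
      nth_rewrite 1 [h6] at h5
      refine (ENNReal.mul_le_mul_iff_left ?_ ?_).1 h5
      · simp [ENNReal.rpow_eq_zero_iff, h0, hfin]
      · exact (ENNReal.rpow_lt_top_of_nonneg (by positivity) hfin).ne
    calc I = (I ^ (1 / a)) ^ a := by
          rw [← ENNReal.rpow_mul, one_div_mul_cancel ha0.ne', ENNReal.rpow_one]
      _ ≤ K ^ a := ENNReal.rpow_le_rpow h7 ha0.le
  rw [← ENNReal.rpow_le_rpow_iff ha0, lpn_rpow ha0]
  have hF := lintegral_liminf_le' (μ := (volume : Measure ℝ)) (u := atTop)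
    (f := fun k t => A k t ^ a) (fun k => (hAm k).pow_const _)
  refine le_trans (le_of_eq ?_) (hF.trans (Filter.liminf_le_of_le (by isBoundedDefault) ?_))
  · refine lintegral_congr fun t => ?_
    symm
    refine Tendsto.liminf_eq (Tendsto.ennrpow_const _ ?_)
    have h1 : Tendsto (fun k : ℕ => min (H t) (k : ℝ≥0∞)) atTop (𝓝 (min (H t) ⊤)) :=
      tendsto_const_nhds.min ENNReal.tendsto_nat_nhds_top
    rw [min_eq_left le_top] at h1
    refine h1.congr' ?_
    obtain ⟨K, hK⟩ := exists_nat_ge |t|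
    filter_upwards [eventually_ge_atTop K] with k hk
    have : t ∈ S k := by
      have h2 : |t| ≤ k := hK.trans (by exact_mod_cast hk)
      exact abs_le.1 h2
    simp only [A]
    rw [Set.indicator_of_mem this]
  · intro b hb
    obtain ⟨n, hn⟩ := hb.exists
    exact hn.trans (hbound n)

/-- The Hardy–Littlewood–Sobolev inequality on the line. -/
theorem lpn_riesz_conv_le {α : ℝ} (hα0 : 0 < α) (hα1 : α < 1) {f : ℝ → ℝ≥0∞}
    (hf : AEMeasurable f) :
    lpn (2 / α) volume (fun t => ∫⁻ s, f s * riesz α (t - s)) ≤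
      hlsConst α * lpn (2 / (2 - α)) volume f := by
  have h2α : 0 < 2 - α := by linarith
  have hconj : (2 / α).HolderConjugate (2 / (2 - α)) := by
    rw [Real.holderConjugate_iff]
    constructor
    · rw [lt_div_iff₀ hα0]; linarith
    · field_simp; ring
  have hm : AEMeasurable fun x : ℝ × ℝ => f x.2 * riesz α (x.1 - x.2) :=
    (hf.comp_quasiMeasurePreserving Measure.quasiMeasurePreserving_snd).mul
      ((measurable_riesz α).comp (measurable_fst.sub measurable_snd)).aemeasurable
  refine lpn_le_of_forall_lintegral_mul_le hconj hm.lintegral_prod_right' _ fun g hg hgt _ _ => ?_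
  rw [mul_assoc]
  refine le_trans (le_of_eq (lintegral_congr fun t => ?_)) (lintegral_riesz_le hα0 hα1 hf hg)
  rw [← lintegral_mul_const' _ _ (hgt t)]
  refine lintegral_congr fun s => ?_
  ring

/-- The `L^r` norm of a function in `L²`. -/
def nr (r : ℝ) (f : L2) : ℝ≥0∞ := eLpNorm f (ENNReal.ofReal r) volume

section Nr

variable {r : ℝ}

theorem nr_add_le (hr : 1 ≤ r) (f g : L2) : nr r (f + g) ≤ nr r f + nr r g := by
  unfold nr
  rw [eLpNorm_congr_ae (Lp.coeFn_add f g)]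
  exact eLpNorm_add_le (Lp.aestronglyMeasurable f) (Lp.aestronglyMeasurable g) (by simpa using hr)

theorem nr_smul (c : ℂ) (f : L2) : nr r (c • f) = ‖c‖ₑ * nr r f := by
  unfold nr
  rw [eLpNorm_congr_ae (Lp.coeFn_smul c f), eLpNorm_const_smul]

theorem nr_neg (f : L2) : nr r (-f) = nr r f := by
  have : -f = (-1 : ℂ) • f := by simp
  rw [this, nr_smul]
  simp

@[simp] theorem nr_zero : nr r 0 = 0 := by
  unfold nr
  rw [eLpNorm_congr_ae (Lp.coeFn_zero ℂ 2 _)]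
  exact eLpNorm_zero

theorem isClosed_setOf_nr_le (r : ℝ) (c : ℝ≥0∞) : IsClosed {f : L2 | nr r f ≤ c} :=
  isClosed_setOf_eLpNorm_le (fun _ z => z) (fun _ => continuous_id)
    (fun f => Lp.aestronglyMeasurable f) _ c

theorem aemeasurable_nr {X : Type*} [MeasurableSpace X] {μ : Measure X} {u : X → L2}
    (hu : AEStronglyMeasurable u μ) : AEMeasurable (fun t => nr r (u t)) μ := by
  borelize L2
  exact (measurable_eLpNorm_comp (fun _ z => z) (fun _ => continuous_id)
    (fun f => Lp.aestronglyMeasurable f) (ENNReal.ofReal r)).comp_aemeasurable hu.aemeasurable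

end Nr

theorem _root_.Continuous.comp_aestronglyMeasurable_prodMk {X Y E F : Type*} [MeasurableSpace X]
    [TopologicalSpace Y] [TopologicalSpace E] [TopologicalSpace F] {μ : Measure X} {Φ : Y → E → F}
    (hΦ : Continuous fun x : Y × E => Φ x.1 x.2) {g : X → Y} {f : X → E}
    (hg : AEStronglyMeasurable g μ) (hf : AEStronglyMeasurable f μ) :
    AEStronglyMeasurable (fun s => Φ (g s) (f s)) μ :=
  hΦ.comp_aestronglyMeasurable (hg.prodMk hf)

theorem aestronglyMeasurable_freeProp {μ : Measure ℝ} {F : ℝ → L2}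
    (hF : AEStronglyMeasurable F μ) {g : ℝ → ℝ} (hg : Continuous g) :
    AEStronglyMeasurable (fun s => freeProp (g s) (F s)) μ :=
  Continuous.comp_aestronglyMeasurable_prodMk (Φ := freeProp) continuous_freeProp
    hg.aestronglyMeasurable hF

theorem integrable_freeProp {μ : Measure ℝ} {F : ℝ → L2} (hF : Integrable F μ) {g : ℝ → ℝ}
    (hg : Continuous g) : Integrable (fun s => freeProp (g s) (F s)) μ :=
  hF.norm.mono' (aestronglyMeasurable_freeProp hF.1 hg)
    (ae_of_all _ fun _ => (norm_freeProp _ _).le)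

section Strichartz

variable {r ρ : ℝ}

theorem enorm_inner_freeProp_le (h : r.HolderConjugate ρ) (hr : 0 ≤ r - 2) {s t : ℝ} (hst : s ≠ t)
    (f g : L2) :
    ‖inner ℂ (freeProp (-t) g) (freeProp (-s) f)‖ₑ ≤
      nr ρ f * nr ρ g * riesz (1 - 2 / r) (t - s) := by
  have e : inner ℂ (freeProp (-t) g) (freeProp (-s) f) = inner ℂ g (freeProp (t - s) f) := by
    rw [inner_freeProp_left, neg_neg, ← freeProp_add_left, sub_eq_add_neg]
  rw [e]
  refine (enorm_inner_le_eLpNorm h g _).trans ?_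
  refine (mul_le_mul_right (eLpNorm_freeProp_le h hr (sub_ne_zero.2 hst.symm) f) _).trans
    (le_of_eq ?_)
  unfold nr riesz
  ring

/-- The dual homogeneous Strichartz estimate. -/
theorem enorm_integral_freeProp_le (h : r.HolderConjugate ρ) (hr : 0 < r - 2) {F : ℝ → L2}
    (hF : Integrable F) :
    ‖∫ s, freeProp (-s) (F s)‖ₑ ≤ hlsConst (1 - 2 / r) ^ (1 / 2 : ℝ) *
      lpn (2 / (2 - (1 - 2 / r))) volume (fun s => nr ρ (F s)) := by
  have hα0 : 0 < 1 - 2 / r := by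
    rw [sub_pos, div_lt_one h.pos]; linarith
  have hα1 : 1 - 2 / r < 1 := by
    have : 0 < 2 / r := div_pos (by norm_num) h.pos
    linarith
  set α := 1 - 2 / r
  set X := ∫ s, freeProp (-s) (F s) with hX
  have hint : Integrable (fun s => freeProp (-s) (F s)) := integrable_freeProp hF continuous_neg
  have hFm := aemeasurable_nr (r := ρ) hF.1
  have h1 : ‖X‖ₑ ^ (2 : ℝ) ≤ ∫⁻ t, ∫⁻ s, nr ρ (F s) * nr ρ (F t) * riesz α (t - s) := by
    have h2 : ‖X‖ₑ ^ (2 : ℝ) = ‖inner ℂ X X‖ₑ := by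
      rw [inner_self_eq_norm_sq_to_K, ← ofReal_norm, ← ofReal_norm,
        ENNReal.ofReal_rpow_of_nonneg (norm_nonneg _) (by norm_num)]
      simp
    have h3 : inner ℂ X X = ∫ t, inner ℂ X (freeProp (-t) (F t)) := by
      nth_rewrite 2 [hX]
      exact (integral_inner (𝕜 := ℂ) hint X).symm
    rw [h2, h3]
    refine (enorm_integral_le_lintegral_enorm _).trans (lintegral_mono fun t => ?_)
    have h4 : inner ℂ (freeProp (-t) (F t)) X =
        ∫ s, inner ℂ (freeProp (-t) (F t)) (freeProp (-s) (F s)) := by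
      rw [hX]
      exact (integral_inner (𝕜 := ℂ) hint _).symm
    have h5 : ‖inner ℂ X (freeProp (-t) (F t))‖ₑ = ‖inner ℂ (freeProp (-t) (F t)) X‖ₑ := by
      rw [← ofReal_norm, ← ofReal_norm, norm_inner_symm]
    rw [h5, h4]
    refine (enorm_integral_le_lintegral_enorm _).trans (lintegral_mono_ae ?_)
    have h6 : ∀ᵐ s : ℝ, s ≠ t := by simp [ae_iff]
    filter_upwards [h6] with s hs
    exact enorm_inner_freeProp_le h hr.le hs _ _
  have h2 := h1.trans (lintegral_riesz_le hα0 hα1 hFm hFm)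
  rw [← ENNReal.rpow_le_rpow_iff (by norm_num : (0:ℝ) < 2),
    ENNReal.mul_rpow_of_nonneg _ _ (by norm_num), ← ENNReal.rpow_mul]
  refine h2.trans (le_of_eq ?_)
  rw [show (1 / 2 : ℝ) * 2 = 1 by norm_num, ENNReal.rpow_one, ENNReal.rpow_two, sq]

/-- The dual homogeneous Strichartz estimate on a set of times. -/
theorem enorm_setIntegral_freeProp_le (h : r.HolderConjugate ρ) (hr : 0 < r - 2) {F : ℝ → L2}
    {I : Set ℝ} (hI : MeasurableSet I) (hF : IntegrableOn F I) :
    ‖∫ s in I, freeProp (-s) (F s)‖ₑ ≤ hlsConst (1 - 2 / r) ^ (1 / 2 : ℝ) *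
      lpn (2 / (2 - (1 - 2 / r))) (volume.restrict I) (fun s => nr ρ (F s)) := by
  have hr0 := h.pos
  have hc : 0 < 2 / (2 - (1 - 2 / r)) := by
    have : 0 < 2 / r := by positivity
    have : 0 < 2 - (1 - 2 / r) := by linarith
    positivity
  have h1 := enorm_integral_freeProp_le h hr ((integrable_indicator_iff hI).2 hF)
  have e1 : ∫ s, freeProp (-s) (I.indicator F s) = ∫ s in I, freeProp (-s) (F s) := by
    rw [← integral_indicator hI]
    congr 1
    ext1 s
    by_cases hs : s ∈ I
    · rw [Set.indicator_of_mem hs, Set.indicator_of_mem hs]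
    · rw [Set.indicator_of_notMem hs, Set.indicator_of_notMem hs]
      exact (freePropₗᵢ (-s)).map_zero
  have e2 : lpn (2 / (2 - (1 - 2 / r))) volume (fun s => nr ρ (I.indicator F s)) =
      lpn (2 / (2 - (1 - 2 / r))) (volume.restrict I) (fun s => nr ρ (F s)) := by
    unfold lpn
    congr 1
    rw [← lintegral_indicator hI]
    refine lintegral_congr fun s => ?_
    beta_reduce
    by_cases hs : s ∈ I
    · rw [Set.indicator_of_mem hs, Set.indicator_of_mem hs]
    · rw [Set.indicator_of_notMem hs, Set.indicator_of_notMem hs, nr_zero,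
        ENNReal.zero_rpow_of_pos hc]
  rwa [e1, e2] at h1

/-- The retarded Duhamel integral. -/
def duhamel (F : ℝ → L2) (t : ℝ) : L2 := ∫ s in (0 : ℝ)..t, freeProp (t - s) (F s)

/-- The retarded Strichartz estimate. -/
theorem lpn_duhamel_le (h : r.HolderConjugate ρ) (hr : 0 < r - 2) {F : ℝ → L2}
    (hF : LocallyIntegrable F) :
    lpn (2 / (1 - 2 / r)) volume (fun t => nr r (duhamel F t)) ≤ hlsConst (1 - 2 / r) *
      lpn (2 / (2 - (1 - 2 / r))) volume (fun s => nr ρ (F s)) := by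
  have hα0 : 0 < 1 - 2 / r := by
    rw [sub_pos, div_lt_one h.pos]; linarith
  have hα1 : 1 - 2 / r < 1 := by
    have : 0 < 2 / r := div_pos (by norm_num) h.pos
    linarith
  refine le_trans (lpn_mono (by positivity) fun t => ?_) (lpn_riesz_conv_le hα0 hα1
    (aemeasurable_nr hF.aestronglyMeasurable))
  have hint : IntegrableOn (fun s => freeProp (t - s) (F s)) (Set.uIoc 0 t) := by
    refine integrable_freeProp ?_ (by fun_prop)
    exact (hF.integrableOn_isCompact isCompact_uIcc).mono_set Set.uIoc_subset_uIcc
  have e : nr r (duhamel F t) = nr r (∫ s in Set.uIoc 0 t, freeProp (t - s) (F s)) := by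
    unfold duhamel
    rw [intervalIntegral.intervalIntegral_eq_integral_uIoc]
    split_ifs
    · rw [one_smul]
    · rw [neg_one_smul, nr_neg]
  rw [e]
  refine (eLpNorm_integral_le h hr.le _ _ hint).trans ?_
  refine (setLIntegral_le_lintegral _ _).trans (lintegral_mono_ae ?_)
  have h6 : ∀ᵐ s : ℝ, s ≠ t := by simp [ae_iff]
  filter_upwards [h6] with s hs
  refine (eLpNorm_freeProp_le h hr.le (sub_ne_zero.2 hs.symm) (F s)).trans (le_of_eq ?_)
  unfold nr riesz
  ring

theorem dualPairing_pos (hr : 0 ≤ r - 2) {k : ℕ} (hk : k ≠ 0) {f : L2} (hf : f ≠ 0) :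
    0 < dualPairing r hr k f := by
  refine lt_of_le_of_ne (dualPairing_nonneg r hr k f) fun h0 => hf ?_
  rw [dualPairing_eq, eq_comm, integral_eq_zero_iff_of_nonneg (fun x => by positivity)
    (integrable_dualPairing r hr k f)] at h0
  rw [Lp.eq_zero_iff_ae_eq_zero]
  filter_upwards [h0] with x hx
  by_contra hne
  have h1 : 0 < ‖f x‖ := norm_pos_iff.2 hne
  have h2 : 0 < min ‖f x‖ (k : ℝ) := lt_min h1 (by exact_mod_cast Nat.pos_of_ne_zero hk)
  have h3 : 0 < min ‖f x‖ (k : ℝ) ^ (r - 2) * ‖f x‖ ^ 2 := by positivity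
  exact h3.ne' hx

/-- The homogeneous Strichartz estimate. -/
theorem lpn_freeProp_le (h : r.HolderConjugate ρ) (hr : 0 < r - 2) (f : L2) :
    lpn (2 / (1 - 2 / r)) volume (fun t => nr r (freeProp t f)) ≤
      hlsConst (1 - 2 / r) ^ (1 / 2 : ℝ) * ‖f‖ₑ := by
  have hα0 : 0 < 1 - 2 / r := by
    rw [sub_pos, div_lt_one h.pos]; linarith
  have hα1 : 1 - 2 / r < 1 := by
    have : 0 < 2 / r := div_pos (by norm_num) h.pos
    linarith
  have hr0 := h.pos
  have hρ0 := h.symm.pos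
  have hconj : (2 / (1 - 2 / r)).HolderConjugate (2 / (2 - (1 - 2 / r))) := by
    have h2α : 0 < 2 - (1 - 2 / r) := by linarith
    generalize 1 - 2 / r = α at *
    rw [Real.holderConjugate_iff]
    constructor
    · rw [lt_div_iff₀ hα0]; linarith
    · field_simp; ring
  rcases eq_or_ne f 0 with rfl | hf
  · have : ∀ t, freeProp t (0 : L2) = 0 := fun t => (freePropₗᵢ t).map_zero
    simp only [this, nr_zero, lpn]
    rw [ENNReal.zero_rpow_of_pos (by positivity), lintegral_zero,
      ENNReal.zero_rpow_of_pos (by positivity)]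
    exact zero_le
  have hUf : ∀ t, freeProp t f ≠ 0 := fun t h0 => by
    apply hf
    rw [← norm_eq_zero, ← norm_freeProp t, h0, norm_zero]
  have hcont : Continuous fun t => freeProp t f := continuous_freeProp_left f
  -- the truncated bound
  have key : ∀ k : ℕ, k ≠ 0 → lpn (2 / (1 - 2 / r)) volume
      (fun t => ENNReal.ofReal (dualPairing r hr.le k (freeProp t f)) ^ (1 / r)) ≤
      hlsConst (1 - 2 / r) ^ (1 / 2 : ℝ) * ‖f‖ₑ := by
    intro k hk
    let A : ℝ → ℝ := fun t => dualPairing r hr.le k (freeProp t f)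
    have hA : ∀ t, 0 < A t := fun t => dualPairing_pos hr.le hk (hUf t)
    have hAc : Continuous A := (continuous_dualPairing r hr.le k).comp hcont
    let G : ℝ → L2 := fun t => ((A t ^ (-(1 / ρ)) : ℝ) : ℂ) • truncPowLp (r - 2) hr.le k (freeProp t f)
    have hGc : Continuous G := by
      have h1 : Continuous fun t => ((A t ^ (-(1 / ρ)) : ℝ) : ℂ) :=
        Complex.continuous_ofReal.comp (hAc.rpow_const fun t => Or.inl (hA t).ne')
      exact h1.smul ((continuous_truncPowLp _ hr.le k).comp hcont)
    have hGn : ∀ t, nr ρ (G t) ≤ 1 := fun t => by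
      simp only [G]
      rw [nr_smul, ← ofReal_norm, Complex.norm_real, Real.norm_of_nonneg (by have := hA t; positivity)]
      refine (mul_le_mul_right (eLpNorm_truncPowLp_le h hr.le k _) _).trans ?_
      change _ * ENNReal.ofReal (A t) ^ (1 / ρ) ≤ 1
      rw [ENNReal.ofReal_rpow_of_pos (hA t), ← ENNReal.ofReal_mul (by have := hA t; positivity),
        ← Real.rpow_add (hA t)]
      simp
    have hGi : ∀ t, inner ℂ (G t) (freeProp t f) = ((A t ^ (1 / r) : ℝ) : ℂ) := fun t => by
      simp only [G]
      rw [inner_smul_left, inner_truncPowLp_eq, Complex.conj_ofReal]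
      change ((A t ^ (-(1 / ρ)) : ℝ) : ℂ) * (A t : ℂ) = _
      rw [← Complex.ofReal_mul]
      congr 1
      nth_rewrite 2 [← Real.rpow_one (A t)]
      rw [← Real.rpow_add (hA t)]
      congr 1
      have := h.inv_add_inv_eq_one
      rw [one_div, one_div]
      linarith
    have hHm : AEMeasurable (fun t => ENNReal.ofReal (A t) ^ (1 / r)) (volume : Measure ℝ) :=
      (hAc.measurable.ennreal_ofReal.pow_const _).aemeasurable
    refine lpn_le_of_forall_lintegral_mul_le hconj hHm _ fun g hg hgt hgs hgb => ?_
    obtain ⟨R, hR⟩ := hgs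
    obtain ⟨B, hB⟩ := hgb
    have hgr : AEStronglyMeasurable (fun t => ((g t).toReal : ℂ)) (volume : Measure ℝ) :=
      (Complex.measurable_ofReal.comp_aemeasurable hg.ennreal_toReal).aestronglyMeasurable
    have hgle : ∀ t, ‖((g t).toReal : ℂ)‖ ≤ B := fun t => by
      rw [Complex.norm_real, Real.norm_of_nonneg ENNReal.toReal_nonneg]
      exact ENNReal.toReal_le_coe_of_le_coe (hB t)
    let F : ℝ → L2 := fun t => ((g t).toReal : ℂ) • G t
    have hF0 : ∀ t, t ∉ Set.Icc (-R) R → F t = 0 := fun t ht => by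
      have : R < |t| := by
        by_contra hle
        exact ht (abs_le.1 (not_lt.1 hle))
      simp only [F]
      rw [hR t this]
      simp
    have hF : Integrable F := by
      rw [← integrableOn_iff_integrable_of_support_subset (s := Set.Icc (-R) R)
        (fun t ht => by by_contra hn; exact ht (hF0 t hn))]
      have h1 : IntegrableOn G (Set.Icc (-R) R) := hGc.continuousOn.integrableOn_compact isCompact_Icc
      exact Integrable.bdd_smul h1 (B : ℝ) hgr.restrict (ae_of_all _ hgle)
    have hFn : ∀ t, nr ρ (F t) ≤ g t := fun t => by
      simp only [F]
      rw [nr_smul, ← ofReal_norm, Complex.norm_real, Real.norm_of_nonneg ENNReal.toReal_nonneg,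
        ENNReal.ofReal_toReal (hgt t)]
      exact mul_le_of_le_one_right' (hGn t)
    have h1 := enorm_integral_freeProp_le h hr hF
    have hint : Integrable (fun s => freeProp (-s) (F s)) := integrable_freeProp hF continuous_neg
    have hFi : ∀ t, inner ℂ f (freeProp (-t) (F t)) = (((g t).toReal * A t ^ (1 / r) : ℝ) : ℂ) := by
      intro t
      rw [← inner_conj_symm, inner_freeProp_left, neg_neg]
      simp only [F]
      rw [inner_smul_left, hGi, Complex.conj_ofReal, ← Complex.ofReal_mul, Complex.conj_ofReal]
    have h2 : inner ℂ f (∫ s, freeProp (-s) (F s)) =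
        ((∫ t, (g t).toReal * A t ^ (1 / r) : ℝ) : ℂ) := by
      rw [← integral_inner (𝕜 := ℂ) hint f]
      simp_rw [hFi]
      exact integral_ofReal
    have h3 : Integrable (fun t => (g t).toReal * A t ^ (1 / r)) := by
      have h4 : Integrable (fun t => inner ℂ f (freeProp (-t) (F t))) := hint.const_inner f
      simp_rw [hFi] at h4
      exact h4.re
    have h4 : ∫⁻ t, ENNReal.ofReal (A t) ^ (1 / r) * g t =
        ‖inner ℂ f (∫ s, freeProp (-s) (F s))‖ₑ := by
      have hnn : ∀ t, 0 ≤ (g t).toReal * A t ^ (1 / r) := fun t => by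
        have := hA t
        positivity
      rw [h2, ← ofReal_norm, Complex.norm_real, Real.norm_of_nonneg (integral_nonneg hnn),
        ofReal_integral_eq_lintegral_ofReal h3 (ae_of_all _ hnn)]
      refine lintegral_congr fun t => ?_
      rw [ENNReal.ofReal_mul ENNReal.toReal_nonneg, ENNReal.ofReal_toReal (hgt t),
        ENNReal.ofReal_rpow_of_pos (hA t), mul_comm]
    have h5 : ‖inner ℂ f (∫ s, freeProp (-s) (F s))‖ₑ ≤ ‖f‖ₑ * ‖∫ s, freeProp (-s) (F s)‖ₑ := by
      rw [← ofReal_norm, ← ofReal_norm, ← ofReal_norm, ← ENNReal.ofReal_mul (norm_nonneg _)]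
      exact ENNReal.ofReal_le_ofReal (norm_inner_le_norm _ _)
    calc _ = _ := h4
      _ ≤ _ := h5
      _ ≤ ‖f‖ₑ * (hlsConst (1 - 2 / r) ^ (1 / 2 : ℝ) *
          lpn (2 / (2 - (1 - 2 / r))) volume (fun s => nr ρ (F s))) := by gcongr
      _ ≤ ‖f‖ₑ * (hlsConst (1 - 2 / r) ^ (1 / 2 : ℝ) * lpn (2 / (2 - (1 - 2 / r))) volume g) := by
          gcongr
          exact lpn_mono hconj.symm.nonneg hFn
      _ = _ := by ring
  have hγ := hconj.pos
  rw [← ENNReal.rpow_le_rpow_iff hγ, lpn_rpow hγ]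
  have hF := lintegral_liminf_le' (μ := (volume : Measure ℝ)) (u := atTop)
    (f := fun (k : ℕ) t => (ENNReal.ofReal (dualPairing r hr.le k (freeProp t f)) ^ (1 / r)) ^
      (2 / (1 - 2 / r))) (fun k => by
        have := (continuous_dualPairing r hr.le k).comp hcont
        exact ((this.measurable.ennreal_ofReal.pow_const _).pow_const _).aemeasurable)
  refine le_trans (le_of_eq ?_) (hF.trans (Filter.liminf_le_of_le (by isBoundedDefault) ?_))
  · refine lintegral_congr fun t => ?_
    symm
    refine Tendsto.liminf_eq (Tendsto.ennrpow_const _ ?_)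
    have := (tendsto_dualPairing hr0 hr.le (freeProp t f)).ennrpow_const (1 / r)
    rwa [← ENNReal.rpow_mul, mul_one_div_cancel hr0.ne', ENNReal.rpow_one] at this
  · intro b hb
    obtain ⟨k, hk, hk0⟩ := (hb.and (eventually_ne_atTop 0)).exists
    refine hk.trans ?_
    rw [← lpn_rpow hγ (μ := volume)]
    exact ENNReal.rpow_le_rpow (key k hk0) hγ.le

end Strichartz

section Exponents

/-- The space exponent `r` of the scattering norm. -/
def rE (p : ℝ) : ℝ := (4 * p + 8) / p

/-- The exponent conjugate to `rE p`. -/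
def ρE (p : ℝ) : ℝ := rE p / (rE p - 1)

/-- The time exponent `q` of the scattering norm. -/
def qE (p : ℝ) : ℝ := 2 * p + 4

/-- The time exponent for which `(γE p, rE p)` is a Strichartz-admissible pair. -/
def γE (p : ℝ) : ℝ := 2 / (1 - 2 / rE p)

/-- The exponent conjugate to `γE p`. -/
def δE (p : ℝ) : ℝ := 2 / (2 - (1 - 2 / rE p))

/-- The space exponent in which the potential `b |u|^p` is measured. -/
def σE (p : ℝ) : ℝ := rE p / (rE p - 2)

/-- The space exponent in which the weight is measured. -/
def mE (p : ℝ) : ℝ := 4 / (4 - p)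

variable {p : ℝ}

theorem eight_le_rE (hp : p ∈ Set.Ioc (0 : ℝ) 2) : 8 ≤ rE p := by
  rw [rE, le_div_iff₀ hp.1]; linarith [hp.2]

theorem holderConjugate_rE (hp : p ∈ Set.Ioc (0 : ℝ) 2) : (rE p).HolderConjugate (ρE p) :=
  Real.HolderConjugate.conjExponent (by linarith [eight_le_rE hp])

theorem one_le_ρE (hp : p ∈ Set.Ioc (0 : ℝ) 2) : 1 ≤ ρE p := (holderConjugate_rE hp).symm.lt.le

theorem one_le_σE (hp : p ∈ Set.Ioc (0 : ℝ) 2) : 1 ≤ σE p := by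
  have := eight_le_rE hp
  rw [σE, le_div_iff₀ (by linarith)]; linarith

theorem one_le_mE (hp : p ∈ Set.Ioc (0 : ℝ) 2) : 1 ≤ mE p := by
  rw [mE, le_div_iff₀ (by linarith [hp.2])]; linarith [hp.1]

theorem one_le_qE (hp : p ∈ Set.Ioc (0 : ℝ) 2) : 1 ≤ qE p := by
  rw [qE]; linarith [hp.1]

theorem one_le_qE_div (hp : p ∈ Set.Ioc (0 : ℝ) 2) : 1 ≤ qE p / p := by
  rw [qE, le_div_iff₀ hp.1]; linarith [hp.1]

theorem αE_eq (hp : p ∈ Set.Ioc (0 : ℝ) 2) : 1 - 2 / rE p = (p + 4) / (2 * p + 4) := by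
  have := hp.1
  rw [rE]; field_simp; ring

theorem γE_eq (hp : p ∈ Set.Ioc (0 : ℝ) 2) : γE p = (4 * p + 8) / (p + 4) := by
  have := hp.1
  rw [γE, αE_eq hp]; field_simp; ring

theorem one_le_γE (hp : p ∈ Set.Ioc (0 : ℝ) 2) : 1 ≤ γE p := by
  have := hp.1
  rw [γE_eq hp, le_div_iff₀ (by linarith)]; linarith

theorem γE_lt_qE (hp : p ∈ Set.Ioc (0 : ℝ) 2) : γE p < qE p := by
  have := hp.1
  rw [γE_eq hp, qE, div_lt_iff₀ (by linarith)]; nlinarith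

theorem δE_eq (hp : p ∈ Set.Ioc (0 : ℝ) 2) : δE p = (4 * p + 8) / (3 * p + 4) := by
  have := hp.1
  have h1 : 2 - (p + 4) / (2 * p + 4) = (3 * p + 4) / (2 * p + 4) := by field_simp; ring
  rw [δE, αE_eq hp, h1]; field_simp; ring

theorem one_le_δE (hp : p ∈ Set.Ioc (0 : ℝ) 2) : 1 ≤ δE p := by
  have := hp.1
  rw [δE_eq hp, le_div_iff₀ (by linarith)]; linarith

theorem one_div_ρE (hp : p ∈ Set.Ioc (0 : ℝ) 2) : 1 / ρE p = 1 / σE p + 1 / rE p := by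
  have := eight_le_rE hp
  rw [ρE, σE]
  have h1 : rE p - 1 ≠ 0 := by linarith
  have h2 : rE p - 2 ≠ 0 := by linarith
  have h3 : rE p ≠ 0 := by linarith
  field_simp; ring

theorem one_div_σE (hp : p ∈ Set.Ioc (0 : ℝ) 2) : 1 / σE p = 1 / mE p + 1 / (rE p / p) := by
  have h := hp.1
  have h1 : 1 / σE p = 1 - 2 / rE p := by
    have := eight_le_rE hp
    rw [σE, one_div_div, sub_div, div_self (by linarith)]
  have h4 : 4 - p ≠ 0 := by linarith [hp.2]
  rw [h1, αE_eq hp, mE, rE]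
  field_simp; ring

theorem one_div_δE (hp : p ∈ Set.Ioc (0 : ℝ) 2) : 1 / δE p = 1 / (qE p / p) + 1 / γE p := by
  have h := hp.1
  rw [δE_eq hp, γE_eq hp, qE]
  field_simp; ring

end Exponents

section Weighted

variable {p : ℝ}

/-- The norm `‖b |f|^p‖` in `L^σ`. -/
def wt (p : ℝ) (b : Plane → ℝ) (f : L2) : ℝ≥0∞ :=
  lpn (σE p) volume fun x => ‖b x‖ₑ * ‖f x‖ₑ ^ p

theorem aemeasurable_enorm_L2 (f : L2) : AEMeasurable (fun x => ‖f x‖ₑ) volume :=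
  (Lp.aestronglyMeasurable f).enorm

theorem aemeasurable_wt_integrand {b : Plane → ℝ} (hb : Measurable b) (f : L2) :
    AEMeasurable (fun x => ‖b x‖ₑ * ‖f x‖ₑ ^ p) volume :=
  hb.enorm.aemeasurable.mul ((aemeasurable_enorm_L2 f).pow_const _)

theorem nr_eq_lpn {r : ℝ} (hr : 0 < r) (f : L2) : nr r f = lpn r volume fun x => ‖f x‖ₑ :=
  eLpNorm_ofReal_eq_lpn hr _

theorem aemeasurable_wt {X : Type*} [MeasurableSpace X] {μ : Measure X}
    (hp : p ∈ Set.Ioc (0 : ℝ) 2) {b : Plane → ℝ} (hb : Measurable b) {u : X → L2}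
    (hu : AEStronglyMeasurable u μ) : AEMeasurable (fun t => wt p b (u t)) μ := by
  borelize L2
  have h := measurable_eLpNorm_comp (fun x z => b x * ‖z‖ ^ p)
    (fun x => continuous_const.mul (continuous_norm.rpow_const fun _ => Or.inr hp.1.le))
    (fun f => hb.aestronglyMeasurable.mul
      (((Real.continuous_rpow_const hp.1.le).comp continuous_norm).comp_aestronglyMeasurable
        (Lp.aestronglyMeasurable f)))
    (ENNReal.ofReal (σE p))
  have h2 : (fun t => wt p b (u t)) =
      (fun f : L2 => eLpNorm (fun x => b x * ‖f x‖ ^ p) (ENNReal.ofReal (σE p)) volume) ∘ u := by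
    funext t
    simp only [wt, Function.comp]
    rw [eLpNorm_ofReal_eq_lpn (by linarith [one_le_σE hp])]
    congr 1
    funext x
    rw [enorm_mul, Real.enorm_rpow_of_nonneg (norm_nonneg _) hp.1.le, enorm_norm]
  rw [h2]
  exact h.comp_aemeasurable hu.aemeasurable

theorem lpn_wt_mul_le (hp : p ∈ Set.Ioc (0 : ℝ) 2) {b : Plane → ℝ} (hb : Measurable b) (f v : L2) :
    lpn (ρE p) volume (fun x => ‖b x‖ₑ * ‖f x‖ₑ ^ p * ‖v x‖ₑ) ≤ wt p b f * nr (rE p) v := by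
  have h8 := eight_le_rE hp
  rw [nr_eq_lpn (by linarith)]
  exact lpn_mul_le (by linarith [one_le_σE hp]) (by linarith) (by linarith [one_le_ρE hp])
    (one_div_ρE hp) (aemeasurable_wt_integrand hb f) (aemeasurable_enorm_L2 v)

theorem wt_le (hp : p ∈ Set.Ioc (0 : ℝ) 2) {b : Plane → ℝ} (hb : Measurable b) (f : L2) :
    wt p b f ≤ lpn (mE p) volume (fun x => ‖b x‖ₑ) * nr (rE p) f ^ p := by
  have h8 := eight_le_rE hp
  have := hp.1
  rw [nr_eq_lpn (by linarith), ← lpn_rpow_fun hp.1]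
  exact lpn_mul_le (by linarith [one_le_mE hp]) (by positivity) (by linarith [one_le_σE hp])
    (one_div_σE hp) hb.enorm.aemeasurable ((aemeasurable_enorm_L2 f).pow_const _)

theorem add_rpow_le_two_rpow_mul (hp : 0 ≤ p) (x y : ℝ≥0∞) :
    (x + y) ^ p ≤ 2 ^ p * (x ^ p + y ^ p) := by
  have h1 : x + y ≤ 2 * max x y := by
    rw [two_mul]; exact add_le_add (le_max_left _ _) (le_max_right _ _)
  refine (ENNReal.rpow_le_rpow h1 hp).trans ?_
  rw [ENNReal.mul_rpow_of_nonneg _ _ hp]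
  gcongr
  rcases max_cases x y with h | h <;> rw [h.1]
  · exact le_self_add
  · exact le_add_self

theorem wt_add_le (hp : p ∈ Set.Ioc (0 : ℝ) 2) {b : Plane → ℝ} (hb : Measurable b) (f g : L2) :
    wt p b (f + g) ≤ 2 ^ p * (wt p b f + wt p b g) := by
  have hσ := one_le_σE hp
  have mf := aemeasurable_wt_integrand (p := p) hb f
  have mg := aemeasurable_wt_integrand (p := p) hb g
  calc wt p b (f + g) ≤ lpn (σE p) volume (fun x => 2 ^ p * (‖b x‖ₑ * ‖f x‖ₑ ^ p +
        ‖b x‖ₑ * ‖g x‖ₑ ^ p)) := by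
        refine lpn_mono_ae (by linarith) ?_
        filter_upwards [Lp.coeFn_add f g] with x hx
        rw [hx, Pi.add_apply, ← mul_add, mul_left_comm]
        gcongr
        exact (ENNReal.rpow_le_rpow (enorm_add_le _ _) hp.1.le).trans
          (add_rpow_le_two_rpow_mul hp.1.le _ _)
    _ = 2 ^ p * lpn (σE p) volume (fun x => ‖b x‖ₑ * ‖f x‖ₑ ^ p + ‖b x‖ₑ * ‖g x‖ₑ ^ p) :=
        lpn_const_mul (by linarith) _ _ (mf.add mg)
    _ ≤ _ := by
        gcongr
        exact lpn_add_le hσ mf mg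

theorem wt_add_weight_le (hp : p ∈ Set.Ioc (0 : ℝ) 2) {b c d : Plane → ℝ} (hb : Measurable b)
    (hc : Measurable c) (h : ∀ x, ‖d x‖ₑ ≤ ‖b x‖ₑ + ‖c x‖ₑ) (f : L2) :
    wt p d f ≤ wt p b f + wt p c f := by
  refine le_trans (lpn_mono (by linarith [one_le_σE hp]) fun x => ?_)
    (lpn_add_le (one_le_σE hp) (aemeasurable_wt_integrand hb f) (aemeasurable_wt_integrand hc f))
  rw [← add_mul]
  gcongr
  exact h x

theorem lpn_comp_add_right (e : ℝ) (g : Plane → ℝ≥0∞) (h : Plane) :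
    lpn e volume (fun x => g (x + h)) = lpn e volume g := by
  unfold lpn
  rw [lintegral_add_right_eq_self (fun x => g x ^ e)]

theorem wt_translate (b : Plane → ℝ) (h : Plane) (f : L2) :
    wt p (fun x => b (x + h)) (translate h f) = wt p b f := by
  rw [wt, wt, ← lpn_comp_add_right _ (fun x => ‖b x‖ₑ * ‖f x‖ₑ ^ p) h]
  unfold lpn
  congr 1
  refine lintegral_congr_ae ?_
  filter_upwards [coeFn_translate h f] with x hx
  rw [hx]

end Weighted
section Nonlinearity

variable {p : ℝ}

theorem norm_pow_mul_sub_le (hp : 0 ≤ p) (z w : ℂ) :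
    ‖((‖z‖ ^ p : ℝ) : ℂ) * z - ((‖w‖ ^ p : ℝ) : ℂ) * w‖ ≤
      (p + 2) * (‖z‖ ^ p + ‖w‖ ^ p) * ‖z - w‖ := by
  have key : ∀ z w : ℂ, ‖w‖ ≤ ‖z‖ → ‖((‖z‖ ^ p : ℝ) : ℂ) * z - ((‖w‖ ^ p : ℝ) : ℂ) * w‖ ≤
      (p + 2) * (‖z‖ ^ p + ‖w‖ ^ p) * ‖z - w‖ := fun z w h => by
    have h1 := norm_truncPow_sub_le_of_le hp (norm_nonneg z) h
    simp only [truncPow, min_self, min_eq_left h] at h1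
    refine h1.trans ?_
    gcongr
    exact le_add_of_nonneg_right (by positivity)
  rcases le_total ‖w‖ ‖z‖ with h | h
  · exact key z w h
  · rw [norm_sub_rev, norm_sub_rev z w, add_comm (‖z‖ ^ p)]
    exact key w z h

theorem enorm_pow_mul_sub_le (hp : 0 ≤ p) (z w : ℂ) :
    ‖((‖z‖ ^ p : ℝ) : ℂ) * z - ((‖w‖ ^ p : ℝ) : ℂ) * w‖ₑ ≤
      ENNReal.ofReal (p + 2) * (‖z‖ₑ ^ p + ‖w‖ₑ ^ p) * ‖z - w‖ₑ := by
  have h := ENNReal.ofReal_le_ofReal (norm_pow_mul_sub_le hp z w)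
  rw [ofReal_norm, ENNReal.ofReal_mul (by positivity), ENNReal.ofReal_mul (by positivity),
    ENNReal.ofReal_add (p := ‖z‖ ^ p) (by positivity) (by positivity), ofReal_norm,
    ← ENNReal.ofReal_rpow_of_nonneg (norm_nonneg _) hp,
    ← ENNReal.ofReal_rpow_of_nonneg (norm_nonneg _) hp, ofReal_norm, ofReal_norm] at h
  exact h

theorem enorm_complex_ofReal (x : ℝ) : ‖(x : ℂ)‖ₑ = ‖x‖ₑ := by
  rw [← ofReal_norm, Complex.norm_real, ofReal_norm]

theorem enorm_pow_mul (hp : 0 ≤ p) (z : ℂ) :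
    ‖((‖z‖ ^ p : ℝ) : ℂ) * z‖ₑ = ‖z‖ₑ ^ p * ‖z‖ₑ := by
  rw [enorm_mul, enorm_complex_ofReal,
    Real.enorm_rpow_of_nonneg (norm_nonneg _) hp, enorm_norm]

theorem aestronglyMeasurable_pow_mul (hp : 0 ≤ p) (f : L2) :
    AEStronglyMeasurable (fun x => ((‖f x‖ ^ p : ℝ) : ℂ) * f x) volume := by
  have : Continuous fun z : ℂ => ((‖z‖ ^ p : ℝ) : ℂ) * z :=
    (Complex.continuous_ofReal.comp
      (continuous_norm.rpow_const fun _ => Or.inr hp)).mul continuous_id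
  exact this.comp_aestronglyMeasurable (Lp.aestronglyMeasurable f)

theorem lintegral_pow_mul_sq_le (hp : p ∈ Set.Ioc (0 : ℝ) 2) (f : L2) :
    ∫⁻ x, (‖f x‖ₑ ^ p * ‖f x‖ₑ) ^ (2 : ℝ) ≤ ‖f‖ₑ ^ (2 : ℝ) + nr (rE p) f ^ rE p := by
  have h8 := eight_le_rE hp
  have hp0 := hp.1
  rw [Lp.enorm_def, eLpNorm_two_sq, nr_eq_lpn (by linarith), lpn_rpow (by linarith),
    ← lintegral_add_left' ((aemeasurable_enorm_L2 f).pow_const _)]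
  refine lintegral_mono fun x => ?_
  have e : (‖f x‖ₑ ^ p * ‖f x‖ₑ) ^ (2 : ℝ) = ‖f x‖ₑ ^ (2 * p + 2) := by
    nth_rewrite 2 [← ENNReal.rpow_one ‖f x‖ₑ]
    rw [← ENNReal.rpow_add_of_nonneg _ _ hp0.le zero_le_one, ← ENNReal.rpow_mul]
    congr 1; ring
  rw [e]
  rcases le_total ‖f x‖ₑ 1 with h | h
  · exact (ENNReal.rpow_le_rpow_of_exponent_ge h (by linarith)).trans le_self_add
  · exact (ENNReal.rpow_le_rpow_of_exponent_le h (by linarith [hp.2])).trans le_add_self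

theorem memLp_pow_mul (hp : p ∈ Set.Ioc (0 : ℝ) 2) {f : L2} (hf : nr (rE p) f ≠ ⊤) :
    MemLp (fun x => ((‖f x‖ ^ p : ℝ) : ℂ) * f x) 2 volume := by
  refine ⟨aestronglyMeasurable_pow_mul hp.1.le f, ?_⟩
  have h8 := eight_le_rE hp
  have h : eLpNorm (fun x => ((‖f x‖ ^ p : ℝ) : ℂ) * f x) 2 volume ^ (2 : ℝ) < ⊤ := by
    rw [eLpNorm_two_sq]
    simp_rw [enorm_pow_mul hp.1.le]
    refine (lintegral_pow_mul_sq_le hp f).trans_lt (ENNReal.add_lt_top.2 ⟨?_, ?_⟩)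
    · exact ENNReal.rpow_lt_top_of_nonneg (by norm_num) enorm_ne_top
    · exact ENNReal.rpow_lt_top_of_nonneg (by linarith) hf
  by_contra hc
  rw [not_lt_top_iff.1 hc] at h
  simp at h

open Classical in
/-- The function `|f|^p f` as an element of `L²`; it is `0` if that function is not in `L²`. -/
def powLp (p : ℝ) (f : L2) : L2 :=
  if h : MemLp (fun x => ((‖f x‖ ^ p : ℝ) : ℂ) * f x) 2 volume then h.toLp _ else 0

theorem coeFn_powLp (hp : p ∈ Set.Ioc (0 : ℝ) 2) {f : L2} (hf : nr (rE p) f ≠ ⊤) :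
    powLp p f =ᵐ[volume] fun x => ((‖f x‖ ^ p : ℝ) : ℂ) * f x := by
  rw [powLp, dif_pos (memLp_pow_mul hp hf)]
  exact MemLp.coeFn_toLp _

theorem enorm_powLp_sq_le (hp : p ∈ Set.Ioc (0 : ℝ) 2) {f : L2} (hf : nr (rE p) f ≠ ⊤) :
    ‖powLp p f‖ₑ ^ (2 : ℝ) ≤ ‖f‖ₑ ^ (2 : ℝ) + nr (rE p) f ^ rE p := by
  refine le_of_eq_of_le ?_ (lintegral_pow_mul_sq_le hp f)
  rw [Lp.enorm_def, eLpNorm_two_sq]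
  refine lintegral_congr_ae ?_
  filter_upwards [coeFn_powLp hp hf] with x hx
  rw [hx, enorm_pow_mul hp.1.le]

theorem truncPow_eq_of_le {k : ℝ} {z : ℂ} (h : ‖z‖ ≤ k) :
    truncPow p k z = ((‖z‖ ^ p : ℝ) : ℂ) * z := by
  rw [truncPow, min_eq_left h]

theorem norm_truncPow_sub_pow_le (hp : 0 ≤ p) {k : ℝ} (hk : 0 ≤ k) (z : ℂ) :
    ‖truncPow p k z - ((‖z‖ ^ p : ℝ) : ℂ) * z‖ ≤ ‖((‖z‖ ^ p : ℝ) : ℂ) * z‖ := by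
  rw [truncPow, ← sub_mul, ← Complex.ofReal_sub, norm_mul, norm_mul]
  gcongr
  rw [Complex.norm_real, Complex.norm_real, Real.norm_eq_abs, Real.norm_eq_abs, abs_sub_comm,
    abs_of_nonneg, abs_of_nonneg]
  · have : (0 : ℝ) ≤ min ‖z‖ k ^ p := by positivity
    linarith
  · positivity
  · exact sub_nonneg.2 (Real.rpow_le_rpow (by positivity) (min_le_left _ _) hp)

theorem tendsto_truncPowLp (hp : p ∈ Set.Ioc (0 : ℝ) 2) {f : L2} (hf : nr (rE p) f ≠ ⊤) :
    Tendsto (fun k : ℕ => truncPowLp p hp.1.le k f) atTop (𝓝 (powLp p f)) := by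
  rw [Lp.tendsto_Lp_iff_tendsto_eLpNorm']
  have e : ∀ k : ℕ, eLpNorm (⇑(truncPowLp p hp.1.le k f) - ⇑(powLp p f)) 2 volume =
      (∫⁻ x, ‖truncPow p k (f x) - ((‖f x‖ ^ p : ℝ) : ℂ) * f x‖ₑ ^ (2 : ℝ)) ^ (1 / 2 : ℝ) := by
    intro k
    rw [eLpNorm_two_eq_lpn, lpn]
    congr 1
    refine lintegral_congr_ae ?_
    filter_upwards [coeFn_powLp hp hf, coeFn_truncPowLp p hp.1.le k f] with x h1 h2
    rw [Pi.sub_apply, h1, h2]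
  simp_rw [e]
  have hz : (0 : ℝ≥0∞) = (∫⁻ _ : Plane, (0 : ℝ≥0∞)) ^ (1 / 2 : ℝ) := by simp
  rw [hz]
  refine ((ENNReal.continuous_rpow_const).tendsto _).comp ?_
  refine tendsto_lintegral_of_dominated_convergence'
    (fun x => ‖((‖f x‖ ^ p : ℝ) : ℂ) * f x‖ₑ ^ (2 : ℝ)) (fun k => ?_) (fun k => ?_) ?_ ?_
  · exact ((((lipschitzWith_truncPow hp.1.le (Nat.cast_nonneg k)).continuous).comp_aestronglyMeasurable
      (Lp.aestronglyMeasurable f)).sub (aestronglyMeasurable_pow_mul hp.1.le f)).enorm.pow_const _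
  · refine ae_of_all _ fun x => ENNReal.rpow_le_rpow ?_ (by norm_num)
    exact enorm_le_iff_norm_le.2 (norm_truncPow_sub_pow_le hp.1.le (Nat.cast_nonneg k) _)
  · rw [← eLpNorm_two_sq]
    exact (ENNReal.rpow_lt_top_of_nonneg (by norm_num) (memLp_pow_mul hp hf).2.ne).ne
  · refine ae_of_all _ fun x => tendsto_const_nhds.congr' ?_
    filter_upwards [eventually_ge_atTop ⌈‖f x‖⌉₊] with k hk
    rw [truncPow_eq_of_le (Nat.ceil_le.1 hk)]
    simp

/-- A bounded measurable real function, with a bound. -/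
structure BoundedWeight (a : Plane → ℝ) : Prop where
  measurable : Measurable a
  bounded : ∃ M : ℝ, ∀ x, ‖a x‖ ≤ M

theorem BoundedWeight.memLp_mul {a : Plane → ℝ} (ha : BoundedWeight a) (f : L2) :
    MemLp (fun x => (a x : ℂ) * f x) 2 volume := by
  obtain ⟨M, hM⟩ := ha.bounded
  refine (Lp.memLp f).of_le_mul (c := M)
    ((Complex.measurable_ofReal.comp ha.measurable).aestronglyMeasurable.mul
      (Lp.aestronglyMeasurable f)) (ae_of_all _ fun x => ?_)
  rw [norm_mul, Complex.norm_real]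
  gcongr
  exact hM x

/-- Multiplication by a bounded weight on `L²`. -/
def mulLp (a : Plane → ℝ) (ha : BoundedWeight a) : L2 →L[ℂ] L2 :=
  LinearMap.mkContinuousOfExistsBound
    { toFun := fun f => (ha.memLp_mul f).toLp _
      map_add' := fun f g => by
        rw [← MemLp.toLp_add]
        refine MemLp.toLp_congr _ _ ?_
        filter_upwards [Lp.coeFn_add f g] with x hx
        rw [hx, Pi.add_apply, Pi.add_apply, mul_add]
      map_smul' := fun c f => by
        rw [RingHom.id_apply, ← MemLp.toLp_const_smul]
        refine MemLp.toLp_congr _ _ ?_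
        filter_upwards [Lp.coeFn_smul c f] with x hx
        rw [hx, Pi.smul_apply, Pi.smul_apply, smul_eq_mul, smul_eq_mul, mul_left_comm] }
    (by
      obtain ⟨M, hM⟩ := ha.bounded
      refine ⟨M, fun f => ?_⟩
      have hM0 : 0 ≤ M := (norm_nonneg _).trans (hM 0)
      refine Lp.norm_le_mul_norm_of_ae_le_mul (f := (ha.memLp_mul f).toLp _) ?_
      filter_upwards [MemLp.coeFn_toLp (ha.memLp_mul f)] with x hx
      rw [hx, norm_mul, Complex.norm_real]
      gcongr
      exact hM x)

theorem coeFn_mulLp {a : Plane → ℝ} (ha : BoundedWeight a) (f : L2) :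
    mulLp a ha f =ᵐ[volume] fun x => (a x : ℂ) * f x :=
  MemLp.coeFn_toLp (ha.memLp_mul f)

/-- The nonlinearity `a |f|^p f`. -/
def nl (p : ℝ) (a : Plane → ℝ) (ha : BoundedWeight a) (f : L2) : L2 := mulLp a ha (powLp p f)

variable {a : Plane → ℝ} (ha : BoundedWeight a)

theorem coeFn_nl (hp : p ∈ Set.Ioc (0 : ℝ) 2) {f : L2} (hf : nr (rE p) f ≠ ⊤) :
    nl p a ha f =ᵐ[volume] fun x => (a x : ℂ) * (((‖f x‖ ^ p : ℝ) : ℂ) * f x) := by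
  filter_upwards [coeFn_mulLp ha (powLp p f), coeFn_powLp hp hf] with x h1 h2
  rw [nl, h1, h2]

theorem enorm_nl_le (hp : p ∈ Set.Ioc (0 : ℝ) 2) {f : L2} (hf : nr (rE p) f ≠ ⊤) :
    ‖nl p a ha f‖ₑ ≤ ‖mulLp a ha‖ₑ * (‖f‖ₑ ^ (2 : ℝ) + nr (rE p) f ^ rE p) ^ (1 / 2 : ℝ) := by
  have h1 : ‖nl p a ha f‖ₑ ≤ ‖mulLp a ha‖ₑ * ‖powLp p f‖ₑ := ContinuousLinearMap.le_opENorm _ _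
  refine h1.trans ?_
  gcongr
  rw [one_div, ENNReal.le_rpow_inv_iff (by norm_num)]
  exact enorm_powLp_sq_le hp hf

theorem aestronglyMeasurable_nl (hp : p ∈ Set.Ioc (0 : ℝ) 2) {X : Type*} [MeasurableSpace X]
    {μ : Measure X} {u : X → L2} (hu : AEStronglyMeasurable u μ) (hf : ∀ t, nr (rE p) (u t) ≠ ⊤) :
    AEStronglyMeasurable (fun t => nl p a ha (u t)) μ := by
  have h1 : AEStronglyMeasurable (fun t => powLp p (u t)) μ :=
    aestronglyMeasurable_of_tendsto_ae atTop
      (fun k => (continuous_truncPowLp p hp.1.le k).comp_aestronglyMeasurable hu)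
      (ae_of_all _ fun t => tendsto_truncPowLp hp (hf t))
  exact (mulLp a ha).continuous.comp_aestronglyMeasurable h1

theorem locallyIntegrable_nl (hp : p ∈ Set.Ioc (0 : ℝ) 2) {u : ℝ → L2} (hu : Continuous u)
    {K : ℝ≥0∞} (hK : K ≠ ⊤) (hu2 : ∀ t, ‖u t‖ₑ ≤ K) (h : ∀ t, nr (rE p) (u t) ≤ K) :
    LocallyIntegrable (fun t => nl p a ha (u t)) := by
  have hf : ∀ t, nr (rE p) (u t) ≠ ⊤ := fun t => ((h t).trans_lt hK.lt_top).ne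
  have h8 := eight_le_rE hp
  have hm := aestronglyMeasurable_nl ha hp (μ := volume) hu.aestronglyMeasurable hf
  set B : ℝ≥0∞ := ‖mulLp a ha‖ₑ * (K ^ (2 : ℝ) + K ^ rE p) ^ (1 / 2 : ℝ)
  have hB : B ≠ ⊤ := by
    refine ENNReal.mul_ne_top enorm_ne_top (ENNReal.rpow_ne_top_of_nonneg (by norm_num) ?_)
    exact ENNReal.add_ne_top.2 ⟨ENNReal.rpow_ne_top_of_nonneg (by norm_num) hK,
      ENNReal.rpow_ne_top_of_nonneg (by linarith) hK⟩
  refine (locallyIntegrable_const B.toReal).mono hm (ae_of_all _ fun t => ?_)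
  rw [Real.norm_of_nonneg ENNReal.toReal_nonneg, ← toReal_enorm]
  refine ENNReal.toReal_mono hB ((enorm_nl_le ha hp (hf t)).trans ?_)
  have h1 := ENNReal.rpow_le_rpow (hu2 t) (by norm_num : (0 : ℝ) ≤ 2)
  have h2 := ENNReal.rpow_le_rpow (h t) (by linarith : 0 ≤ rE p)
  exact mul_le_mul_right (ENNReal.rpow_le_rpow (add_le_add h1 h2) (by norm_num)) _

theorem nr_nl_le (hp : p ∈ Set.Ioc (0 : ℝ) 2) {f : L2} (hf : nr (rE p) f ≠ ⊤) :
    nr (ρE p) (nl p a ha f) ≤ wt p a f * nr (rE p) f := by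
  have hρ := one_le_ρE hp
  rw [nr_eq_lpn (by linarith)]
  refine le_trans (lpn_mono_ae (by linarith) ?_) (lpn_wt_mul_le hp ha.measurable f f)
  filter_upwards [coeFn_nl ha hp hf] with x hx
  rw [hx, enorm_mul, enorm_pow_mul hp.1.le, ← mul_assoc, enorm_complex_ofReal]

theorem nr_nl_sub_le (hp : p ∈ Set.Ioc (0 : ℝ) 2) {f g : L2} (hf : nr (rE p) f ≠ ⊤)
    (hg : nr (rE p) g ≠ ⊤) :
    nr (ρE p) (nl p a ha f - nl p a ha g) ≤
      ENNReal.ofReal (p + 2) * ((wt p a f + wt p a g) * nr (rE p) (f - g)) := by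
  have hρ := one_le_ρE hp
  have m1 := aemeasurable_wt_integrand (p := p) ha.measurable f
  have m2 := aemeasurable_wt_integrand (p := p) ha.measurable g
  have m3 := aemeasurable_enorm_L2 (f - g)
  have n1 : AEMeasurable (fun x => ‖a x‖ₑ * ‖f x‖ₑ ^ p * ‖(f - g : L2) x‖ₑ) volume := m1.mul m3
  have n2 : AEMeasurable (fun x => ‖a x‖ₑ * ‖g x‖ₑ ^ p * ‖(f - g : L2) x‖ₑ) volume := m2.mul m3
  rw [nr_eq_lpn (by linarith), add_mul]
  refine le_trans ?_ (mul_le_mul_right (add_le_add (lpn_wt_mul_le hp ha.measurable f (f - g))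
    (lpn_wt_mul_le hp ha.measurable g (f - g))) _)
  refine le_trans ?_ (mul_le_mul_right (lpn_add_le hρ n1 n2) _)
  refine le_trans ?_ (lpn_const_mul (by linarith) _ _ (n1.add n2)).le
  refine lpn_mono_ae (by linarith) ?_
  filter_upwards [coeFn_nl ha hp hf, coeFn_nl ha hp hg, Lp.coeFn_sub (nl p a ha f) (nl p a ha g),
    Lp.coeFn_sub f g] with x h1 h2 h3 h4
  rw [Pi.add_apply]
  rw [h3, Pi.sub_apply, h1, h2, h4, ← mul_sub, enorm_mul, enorm_complex_ofReal, Pi.sub_apply]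
  refine (mul_le_mul_right (enorm_pow_mul_sub_le hp.1.le _ _) _).trans (le_of_eq ?_)
  ring

theorem nr_translate_nl_sub_le (hp : p ∈ Set.Ioc (0 : ℝ) 2) {f : L2} (hf : nr (rE p) f ≠ ⊤)
    (h : Plane) :
    nr (ρE p) (translate h (nl p a ha f) - nl p a ha f) ≤
      ENNReal.ofReal (p + 2) * ((2 * wt p a f + wt p (fun x => a (x + h) - a x) f) *
        nr (rE p) (translate h f - f)) + wt p (fun x => a (x + h) - a x) f * nr (rE p) f := by
  have hρ := one_le_ρE hp
  set b : Plane → ℝ := fun x => a (x + h) - a x with hb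
  set c : Plane → ℝ := fun x => a (x + h) with hc
  have mc : Measurable c := ha.measurable.comp (measurable_add_const h)
  have mb : Measurable b := mc.sub ha.measurable
  set g := translate h f with hg
  set v := g - f with hv
  have e1 : wt p c g = wt p a f := wt_translate a h f
  have e2 : wt p c f ≤ wt p a f + wt p b f := by
    refine wt_add_weight_le hp ha.measurable mb (fun x => ?_) f
    have : c x = a x + b x := by simp [hb, hc]
    rw [this]
    exact enorm_add_le _ _
  have n1 := aemeasurable_wt_integrand (p := p) mc g
  have n2 := aemeasurable_wt_integrand (p := p) mc f
  have n3 := aemeasurable_enorm_L2 v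
  have n4 := (aemeasurable_wt_integrand (p := p) mb f).mul (aemeasurable_enorm_L2 f)
  have key : lpn (ρE p) volume (fun x => ‖(translate h (nl p a ha f) - nl p a ha f : L2) x‖ₑ) ≤
      lpn (ρE p) volume (fun x => ENNReal.ofReal (p + 2) * (‖c x‖ₑ * ‖g x‖ₑ ^ p * ‖v x‖ₑ +
        ‖c x‖ₑ * ‖f x‖ₑ ^ p * ‖v x‖ₑ) + ‖b x‖ₑ * ‖f x‖ₑ ^ p * ‖f x‖ₑ) := by
    refine lpn_mono_ae (by linarith) ?_
    have hq := (measurePreserving_add_right volume h).quasiMeasurePreserving.ae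
      (coeFn_nl ha hp hf)
    filter_upwards [coeFn_nl ha hp hf, hq, coeFn_translate h (nl p a ha f),
      Lp.coeFn_sub (translate h (nl p a ha f)) (nl p a ha f), Lp.coeFn_sub g f,
      coeFn_translate h f] with x h1 h2 h3 h4 h5 h6
    rw [h4, Pi.sub_apply, h3, h2, h1, h5, Pi.sub_apply, ← h6]
    have e3 : (a (x + h) : ℂ) * (((‖g x‖ ^ p : ℝ) : ℂ) * g x) -
        (a x : ℂ) * (((‖f x‖ ^ p : ℝ) : ℂ) * f x) =
        (c x : ℂ) * (((‖g x‖ ^ p : ℝ) : ℂ) * g x - ((‖f x‖ ^ p : ℝ) : ℂ) * f x) +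
        (b x : ℂ) * (((‖f x‖ ^ p : ℝ) : ℂ) * f x) := by
      simp only [hb, hc]; push_cast; ring
    rw [e3]
    refine (enorm_add_le _ _).trans (add_le_add ?_ ?_)
    · rw [enorm_mul, enorm_complex_ofReal]
      refine (mul_le_mul_right (enorm_pow_mul_sub_le hp.1.le _ _) _).trans (le_of_eq ?_)
      ring
    · rw [enorm_mul, enorm_pow_mul hp.1.le, enorm_complex_ofReal, mul_assoc]
  rw [nr_eq_lpn (by linarith)]
  refine key.trans ((lpn_add_le hρ (((n1.mul n3).add (n2.mul n3)).const_mul _) n4).trans ?_)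
  refine add_le_add ?_ (lpn_wt_mul_le hp mb f f)
  refine (lpn_const_mul (by linarith) _ _ ((n1.mul n3).add (n2.mul n3))).le.trans ?_
  refine mul_le_mul_right ((lpn_add_le hρ (n1.mul n3) (n2.mul n3)).trans ?_) _
  refine (add_le_add (lpn_wt_mul_le hp mc g v) (lpn_wt_mul_le hp mc f v)).trans ?_
  rw [← add_mul, e1, two_mul, add_assoc]
  gcongr

end Nonlinearity
section TimeNorms

variable {p : ℝ}

/-- The time norm of the potentials `b |u(t)|^p`. -/
def lam (p : ℝ) (μ : Measure ℝ) (b : Plane → ℝ) (u : ℝ → L2) : ℝ≥0∞ :=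
  lpn (qE p / p) μ fun t => wt p b (u t)

/-- The Strichartz norm. -/
def sN (p : ℝ) (μ : Measure ℝ) (u : ℝ → L2) : ℝ≥0∞ := lpn (γE p) μ fun t => nr (rE p) (u t)

/-- The scattering norm. -/
def xN (p : ℝ) (μ : Measure ℝ) (u : ℝ → L2) : ℝ≥0∞ := lpn (qE p) μ fun t => nr (rE p) (u t)

/-- The dual Strichartz norm. -/
def dN (p : ℝ) (μ : Measure ℝ) (F : ℝ → L2) : ℝ≥0∞ := lpn (δE p) μ fun t => nr (ρE p) (F t)

variable {μ : Measure ℝ} {a b : Plane → ℝ} {u v : ℝ → L2}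

theorem one_le_rE (hp : p ∈ Set.Ioc (0 : ℝ) 2) : 1 ≤ rE p := by linarith [eight_le_rE hp]

theorem lpn_nr_add_le {e : ℝ} (he : 1 ≤ e) (hp : p ∈ Set.Ioc (0 : ℝ) 2) (hu : Continuous u)
    (hv : Continuous v) :
    lpn e μ (fun t => nr (rE p) (u t + v t)) ≤
      lpn e μ (fun t => nr (rE p) (u t)) + lpn e μ (fun t => nr (rE p) (v t)) :=
  (lpn_mono (by linarith) fun _ => nr_add_le (one_le_rE hp) _ _).trans
    (lpn_add_le he (aemeasurable_nr hu.aestronglyMeasurable)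
      (aemeasurable_nr hv.aestronglyMeasurable))

theorem sN_add_le (hp : p ∈ Set.Ioc (0 : ℝ) 2) (hu : Continuous u) (hv : Continuous v) :
    sN p μ (fun t => u t + v t) ≤ sN p μ u + sN p μ v :=
  lpn_nr_add_le (one_le_γE hp) hp hu hv

theorem xN_add_le (hp : p ∈ Set.Ioc (0 : ℝ) 2) (hu : Continuous u) (hv : Continuous v) :
    xN p μ (fun t => u t + v t) ≤ xN p μ u + xN p μ v :=
  lpn_nr_add_le (one_le_qE hp) hp hu hv

theorem lam_le (hp : p ∈ Set.Ioc (0 : ℝ) 2) (hb : Measurable b) (hu : Continuous u) :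
    lam p μ b u ≤ lpn (mE p) volume (fun x => ‖b x‖ₑ) * xN p μ u ^ p := by
  have h1 := one_le_qE_div hp
  rw [xN, ← lpn_rpow_fun hp.1, ← lpn_const_mul (by linarith) _ _
    ((aemeasurable_nr hu.aestronglyMeasurable).pow_const _)]
  exact lpn_mono (by linarith) fun t => wt_le hp hb _

theorem lam_add_le (hp : p ∈ Set.Ioc (0 : ℝ) 2) (hb : Measurable b) (hu : Continuous u)
    (hv : Continuous v) :
    lam p μ b (fun t => u t + v t) ≤ 2 ^ p * (lam p μ b u + lam p μ b v) := by
  have h1 := one_le_qE_div hp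
  have m1 := aemeasurable_wt hp hb (hu.aestronglyMeasurable (μ := μ))
  have m2 := aemeasurable_wt hp hb (hv.aestronglyMeasurable (μ := μ))
  refine le_trans ?_ (mul_le_mul_right (lpn_add_le h1 m1 m2) _)
  refine le_trans ?_ (lpn_const_mul (by linarith) _ _ (m1.add m2)).le
  exact lpn_mono (by linarith) fun t => wt_add_le hp hb _ _

theorem lpn_wt_mul_nr_le (hp : p ∈ Set.Ioc (0 : ℝ) 2) (hb : Measurable b) (hu : Continuous u)
    (hv : Continuous v) :
    lpn (δE p) μ (fun t => wt p b (u t) * nr (rE p) (v t)) ≤ lam p μ b u * sN p μ v :=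
  lpn_mul_le (by linarith [one_le_qE_div hp]) (by linarith [one_le_γE hp])
    (by linarith [one_le_δE hp]) (one_div_δE hp) (aemeasurable_wt hp hb hu.aestronglyMeasurable)
    (aemeasurable_nr hv.aestronglyMeasurable)

theorem xN_le (hp : p ∈ Set.Ioc (0 : ℝ) 2) (hu : Continuous u) {K : ℝ≥0∞}
    (hK : ∀ t, nr (rE p) (u t) ≤ K) :
    xN p μ u ≤ K ^ (1 - γE p / qE p) * sN p μ u ^ (γE p / qE p) := by
  have h1 := one_le_γE hp
  have h2 := γE_lt_qE hp
  have hq : 0 < qE p := by linarith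
  have e1 : K ^ (1 - γE p / qE p) = (K ^ (qE p - γE p)) ^ (1 / qE p) := by
    rw [← ENNReal.rpow_mul]; congr 1; field_simp
  have e2 : sN p μ u ^ (γE p / qE p) = (∫⁻ t, nr (rE p) (u t) ^ γE p ∂μ) ^ (1 / qE p) := by
    rw [← lpn_rpow (by linarith), ← ENNReal.rpow_mul, sN]; congr 1; field_simp
  rw [e1, e2, ← ENNReal.mul_rpow_of_nonneg _ _ (by positivity), xN, lpn]
  refine ENNReal.rpow_le_rpow ?_ (by positivity)
  rw [← lintegral_const_mul'' _ ((aemeasurable_nr hu.aestronglyMeasurable).pow_const _)]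
  refine lintegral_mono fun t => ?_
  calc nr (rE p) (u t) ^ qE p = nr (rE p) (u t) ^ (qE p - γE p) * nr (rE p) (u t) ^ γE p := by
        rw [← ENNReal.rpow_add_of_nonneg _ _ (by linarith) (by linarith), sub_add_cancel]
    _ ≤ _ := by
        gcongr
        exact hK t

variable (ha : BoundedWeight a)

theorem dN_nl_le (hp : p ∈ Set.Ioc (0 : ℝ) 2) (hu : Continuous u)
    (hf : ∀ t, nr (rE p) (u t) ≠ ⊤) :
    dN p μ (fun t => nl p a ha (u t)) ≤ lam p μ a u * sN p μ u :=
  (lpn_mono (by linarith [one_le_δE hp]) fun t => nr_nl_le ha hp (hf t)).trans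
    (lpn_wt_mul_nr_le hp ha.measurable hu hu)

theorem dN_nl_sub_le (hp : p ∈ Set.Ioc (0 : ℝ) 2) (hu : Continuous u) (hv : Continuous v)
    (hf : ∀ t, nr (rE p) (u t) ≠ ⊤) (hg : ∀ t, nr (rE p) (v t) ≠ ⊤) :
    dN p μ (fun t => nl p a ha (u t) - nl p a ha (v t)) ≤
      ENNReal.ofReal (p + 2) * ((lam p μ a u + lam p μ a v) * sN p μ (fun t => u t - v t)) := by
  have hδ := one_le_δE hp
  have m1 := aemeasurable_wt hp ha.measurable (hu.aestronglyMeasurable (μ := μ))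
  have m2 := aemeasurable_wt hp ha.measurable (hv.aestronglyMeasurable (μ := μ))
  have m3 := aemeasurable_nr (r := rE p) ((hu.sub hv).aestronglyMeasurable (μ := μ))
  rw [add_mul]
  refine le_trans ?_ (mul_le_mul_right (add_le_add
    (lpn_wt_mul_nr_le hp ha.measurable hu (hu.sub hv))
    (lpn_wt_mul_nr_le hp ha.measurable hv (hu.sub hv))) _)
  refine le_trans ?_ (mul_le_mul_right (lpn_add_le hδ (m1.mul m3) (m2.mul m3)) _)
  refine le_trans ?_ (lpn_const_mul (by linarith) _ _ ((m1.mul m3).add (m2.mul m3))).le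
  refine lpn_mono (by linarith) fun t => (nr_nl_sub_le ha hp (hf t) (hg t)).trans (le_of_eq ?_)
  rw [add_mul]
  rfl

theorem dN_translate_nl_sub_le (hp : p ∈ Set.Ioc (0 : ℝ) 2) (hu : Continuous u)
    (hf : ∀ t, nr (rE p) (u t) ≠ ⊤) (h : Plane) :
    dN p μ (fun t => translate h (nl p a ha (u t)) - nl p a ha (u t)) ≤
      ENNReal.ofReal (p + 2) * ((2 * lam p μ a u + lam p μ (fun x => a (x + h) - a x) u) *
        sN p μ (fun t => translate h (u t) - u t)) +
      lam p μ (fun x => a (x + h) - a x) u * sN p μ u := by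
  have hδ := one_le_δE hp
  set b : Plane → ℝ := fun x => a (x + h) - a x with hb
  have mb : Measurable b := (ha.measurable.comp (measurable_add_const h)).sub ha.measurable
  have hv : Continuous fun t => translate h (u t) - u t :=
    ((translate h).continuous.comp hu).sub hu
  have m1 := aemeasurable_wt hp ha.measurable (hu.aestronglyMeasurable (μ := μ))
  have m2 := aemeasurable_wt hp mb (hu.aestronglyMeasurable (μ := μ))
  have m3 := aemeasurable_nr (r := rE p) (hv.aestronglyMeasurable (μ := μ))
  have m4 := aemeasurable_nr (r := rE p) (hu.aestronglyMeasurable (μ := μ))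
  have n1 := m1.mul m3
  have n2 := m2.mul m3
  refine (lpn_mono (by linarith) fun t => nr_translate_nl_sub_le ha hp (hf t) h).trans ?_
  refine (lpn_add_le hδ ((((m1.const_mul 2).add m2).mul m3).const_mul _) (m2.mul m4)).trans ?_
  refine add_le_add ?_ (lpn_wt_mul_nr_le hp mb hu hu)
  refine (lpn_const_mul (by linarith) _ _ (((m1.const_mul 2).add m2).mul m3)).le.trans ?_
  refine mul_le_mul_right ?_ _
  have e : (fun t => 2 * wt p a (u t)) * (fun t => nr (rE p) (translate h (u t) - u t)) =
      fun t => 2 * (wt p a (u t) * nr (rE p) (translate h (u t) - u t)) := by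
    funext t; simp [mul_assoc]
  rw [add_mul, e]
  refine (lpn_add_le hδ (n1.const_mul 2) n2).trans ?_
  rw [add_mul, mul_assoc]
  refine add_le_add ?_ (lpn_wt_mul_nr_le hp mb hu hv)
  refine (lpn_const_mul (by linarith) _ _ n1).le.trans ?_
  exact mul_le_mul_right (lpn_wt_mul_nr_le hp ha.measurable hu hv) _

end TimeNorms
section StrichartzSpecialised

variable {p : ℝ}

/-- A common constant in all the Strichartz estimates. -/
def cS (p : ℝ) : ℝ≥0∞ := max (hlsConst (1 - 2 / rE p) ^ (1 / 2 : ℝ)) (hlsConst (1 - 2 / rE p))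

theorem cS_ne_top (p : ℝ) : cS p ≠ ⊤ :=
  (max_lt (ENNReal.rpow_lt_top_of_nonneg (by norm_num) (hlsConst_ne_top _))
    (hlsConst_ne_top _).lt_top).ne

variable {F G : ℝ → L2}

theorem intervalIntegrable_freeProp (hF : LocallyIntegrable F) {g : ℝ → ℝ} (hg : Continuous g)
    (t₁ t₂ : ℝ) : IntervalIntegrable (fun s => freeProp (g s) (F s)) volume t₁ t₂ := by
  rw [intervalIntegrable_iff]
  exact integrable_freeProp ((hF.integrableOn_isCompact isCompact_uIcc).mono_set
    Set.uIoc_subset_uIcc) hg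

theorem enorm_intervalIntegral_freeProp_le (hp : p ∈ Set.Ioc (0 : ℝ) 2) (hF : LocallyIntegrable F)
    (t₁ t₂ : ℝ) :
    ‖∫ s in t₁..t₂, freeProp (-s) (F s)‖ₑ ≤ cS p * dN p (volume.restrict (Set.uIoc t₁ t₂)) F := by
  have h8 := eight_le_rE hp
  have e : ‖∫ s in t₁..t₂, freeProp (-s) (F s)‖ₑ =
      ‖∫ s in Set.uIoc t₁ t₂, freeProp (-s) (F s)‖ₑ := by
    rw [← ofReal_norm, ← ofReal_norm, intervalIntegral.norm_intervalIntegral_eq]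
  rw [e]
  refine (enorm_setIntegral_freeProp_le (holderConjugate_rE hp) (by linarith) measurableSet_uIoc
    ((hF.integrableOn_isCompact isCompact_uIcc).mono_set Set.uIoc_subset_uIcc)).trans ?_
  exact mul_le_mul_left (le_max_left _ _) _

theorem duhamel_eq (hF : LocallyIntegrable F) (t : ℝ) :
    duhamel F t = freeProp t (∫ s in (0 : ℝ)..t, freeProp (-s) (F s)) := by
  have h : ∀ s, freeProp (t - s) (F s) = freePropₗᵢ t (freeProp (-s) (F s)) := fun s => by
    rw [sub_eq_add_neg, freeProp_add_left]; rfl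
  simp_rw [duhamel, h]
  exact (freePropₗᵢ t).toContinuousLinearMap.intervalIntegral_comp_comm
    (intervalIntegrable_freeProp hF continuous_neg 0 t)

theorem continuous_intervalIntegral_freeProp (hF : LocallyIntegrable F) :
    Continuous fun t => ∫ s in (0 : ℝ)..t, freeProp (-s) (F s) :=
  intervalIntegral.continuous_primitive (fun a b => intervalIntegrable_freeProp hF continuous_neg a b)
    0

theorem _root_.Continuous.comp_prodMk_id {X E F : Type*} [TopologicalSpace X] [TopologicalSpace E]
    [TopologicalSpace F] {Φ : X → E → F} (hΦ : Continuous fun x : X × E => Φ x.1 x.2) {f : X → E}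
    (hf : Continuous f) : Continuous fun t => Φ t (f t) :=
  hΦ.comp (continuous_id.prodMk hf)

theorem continuous_freeProp_comp {f : ℝ → L2} (hf : Continuous f) :
    Continuous fun t => freeProp t (f t) :=
  Continuous.comp_prodMk_id (Φ := freeProp) continuous_freeProp hf

theorem continuous_duhamel (hF : LocallyIntegrable F) : Continuous (duhamel F) := by
  have : duhamel F = fun t => freeProp t (∫ s in (0 : ℝ)..t, freeProp (-s) (F s)) :=
    funext fun t => duhamel_eq hF t
  rw [this]
  exact continuous_freeProp_comp (continuous_intervalIntegral_freeProp hF)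

theorem enorm_duhamel_le (hp : p ∈ Set.Ioc (0 : ℝ) 2) (hF : LocallyIntegrable F) (t : ℝ) :
    ‖duhamel F t‖ₑ ≤ cS p * dN p volume F := by
  rw [duhamel_eq hF, ← ofReal_norm, norm_freeProp, ofReal_norm]
  refine (enorm_intervalIntegral_freeProp_le hp hF 0 t).trans ?_
  gcongr
  exact lpn_mono_measure (by linarith [one_le_δE hp]) Measure.restrict_le_self _

theorem sN_duhamel_le (hp : p ∈ Set.Ioc (0 : ℝ) 2) (hF : LocallyIntegrable F) :
    sN p volume (duhamel F) ≤ cS p * dN p volume F := by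
  have h8 := eight_le_rE hp
  exact (lpn_duhamel_le (holderConjugate_rE hp) (by linarith) hF).trans
    (mul_le_mul_left (le_max_right _ _) _)

theorem sN_freeProp_le (hp : p ∈ Set.Ioc (0 : ℝ) 2) (f : L2) :
    sN p volume (fun t => freeProp t f) ≤ cS p * ‖f‖ₑ := by
  have h8 := eight_le_rE hp
  exact (lpn_freeProp_le (holderConjugate_rE hp) (by linarith) f).trans
    (mul_le_mul_left (le_max_left _ _) _)

theorem duhamel_sub (hF : LocallyIntegrable F) (hG : LocallyIntegrable G) (t : ℝ) :
    duhamel (fun s => F s - G s) t = duhamel F t - duhamel G t := by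
  have hc : Continuous fun s => t - s := continuous_const.sub continuous_id
  simp_rw [duhamel, freeProp_sub]
  exact intervalIntegral.integral_sub (intervalIntegrable_freeProp hF hc 0 t)
    (intervalIntegrable_freeProp hG hc 0 t)

theorem locallyIntegrable_translate (hF : LocallyIntegrable F) (h : Plane) :
    LocallyIntegrable fun s => translate h (F s) := by
  refine hF.mono ((translate h).continuous.comp_aestronglyMeasurable hF.aestronglyMeasurable)
    (ae_of_all _ fun s => ?_)
  rw [LinearIsometry.norm_map]

theorem translate_duhamel (hF : LocallyIntegrable F) (h : Plane) (t : ℝ) :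
    translate h (duhamel F t) = duhamel (fun s => translate h (F s)) t := by
  have hc : Continuous fun s => t - s := continuous_const.sub continuous_id
  simp_rw [duhamel, ← translate_freeProp]
  exact ((translate h).toContinuousLinearMap.intervalIntegral_comp_comm
    (intervalIntegrable_freeProp hF hc 0 t)).symm

end StrichartzSpecialised

section FixedPoint

variable {p : ℝ}

theorem nr_le_liminf {r : ℝ} {z : ℕ → L2} {f : L2} (h : Tendsto z atTop (𝓝 f)) :
    nr r f ≤ liminf (fun k => nr r (z k)) atTop := by
  refine le_of_forall_gt fun c hc => ?_
  by_contra! hlt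
  obtain ⟨d, hd1, hd2⟩ := exists_between hc
  have h2 : ∃ᶠ k in atTop, z k ∈ {f : L2 | nr r f ≤ d} :=
    (frequently_lt_of_liminf_lt (by isBoundedDefault) hd1).mono fun k hk => hk.le
  have h3 : f ∈ {f : L2 | nr r f ≤ d} :=
    (isClosed_setOf_nr_le r d).mem_of_frequently_of_tendsto h2 h
  exact absurd (hlt.trans h3) (not_le.2 hd2)

theorem sN_le_of_tendsto (hp : p ∈ Set.Ioc (0 : ℝ) 2) {z : ℕ → ℝ → L2} {f : ℝ → L2} {c : ℝ≥0∞}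
    (hz : ∀ k, Continuous (z k)) (h : ∀ t, Tendsto (fun k => z k t) atTop (𝓝 (f t)))
    (hc : ∀ k, sN p volume (z k) ≤ c) : sN p volume f ≤ c := by
  have hγ := one_le_γE hp
  rw [sN, lpn, one_div, ENNReal.rpow_inv_le_iff (by linarith)]
  calc ∫⁻ t, nr (rE p) (f t) ^ γE p
      ≤ ∫⁻ t, liminf (fun k => nr (rE p) (z k t) ^ γE p) atTop := by
        refine lintegral_mono fun t => ?_
        have hm : Monotone fun x : ℝ≥0∞ => x ^ γE p := ENNReal.monotone_rpow_of_nonneg (by linarith)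
        refine (hm (nr_le_liminf (h t))).trans (le_of_eq ?_)
        exact hm.map_liminf_of_continuousAt (F := atTop) (fun k => nr (rE p) (z k t))
          ENNReal.continuous_rpow_const.continuousAt
    _ ≤ liminf (fun k => ∫⁻ t, nr (rE p) (z k t) ^ γE p) atTop :=
        lintegral_liminf_le' fun k => (aemeasurable_nr (hz k).aestronglyMeasurable).pow_const _
    _ ≤ c ^ γE p := by
        refine liminf_le_of_le (by isBoundedDefault) fun b hb => ?_
        obtain ⟨k, hk⟩ := hb.exists
        refine hk.trans ?_
        have := ENNReal.rpow_le_rpow (hc k) (by linarith : 0 ≤ γE p)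
        rwa [sN, lpn_rpow (by linarith)] at this

theorem exists_fixedPoint (hp : p ∈ Set.Ioc (0 : ℝ) 2) {B : (ℝ → L2) → Prop}
    {T : (ℝ → L2) → ℝ → L2} (h0 : B 0) (hT : ∀ z, B z → B (T z)) (hc : ∀ z, B z → Continuous z)
    (hb : ∀ z, B z → (∀ t, ‖z t‖ₑ ≤ 1) ∧ sN p volume z ≤ 1)
    (hL : ∀ z z', B z → B z' →
      (∀ t, ‖T z t - T z' t‖ₑ ≤ 1 / 2 * sN p volume (fun t => z t - z' t)) ∧
      sN p volume (fun t => T z t - T z' t) ≤ 1 / 2 * sN p volume (fun t => z t - z' t))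
    (hcl : ∀ (zs : ℕ → ℝ → L2) (z : ℝ → L2), (∀ k, B (zs k)) → Continuous z →
      (∀ t, Tendsto (fun k => zs k t) atTop (𝓝 (z t))) → B z) :
    ∃ z, B z ∧ T z = z := by
  set zs : ℕ → ℝ → L2 := fun k => T^[k] 0 with hzs
  have hsucc : ∀ k, zs (k + 1) = T (zs k) := fun k => Function.iterate_succ_apply' T k 0
  have hB : ∀ k, B (zs k) := fun k => by
    induction k with
    | zero => exact h0
    | succ k ih => rw [hsucc]; exact hT _ ih
  set b : ℕ → ℝ≥0∞ := fun k => (1 / 2) ^ k * 2 with hbdef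
  have hb1 : ∀ k, 1 / 2 * b k = b (k + 1) := fun k => by simp only [hbdef, pow_succ]; ring
  have hblim : Tendsto b atTop (𝓝 0) := by
    have : Tendsto (fun k : ℕ => ((1 : ℝ≥0∞) / 2) ^ k) atTop (𝓝 0) :=
      ENNReal.tendsto_pow_atTop_nhds_zero_of_lt_one (by simp)
    have h2 := ENNReal.Tendsto.mul_const this (Or.inr (by norm_num : (2 : ℝ≥0∞) ≠ ⊤))
    rwa [zero_mul] at h2
  have hsub : ∀ z z', B z → B z' → sN p volume (fun t => z t - z' t) ≤ 2 := fun z z' hz hz' => by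
    have h1 := sN_add_le (μ := volume) hp (hc z hz) (hc z' hz').neg
    have h2 : sN p volume (-z') = sN p volume z' := by
      simp only [sN, Pi.neg_apply, nr_neg]
    rw [h2] at h1
    simp_rw [sub_eq_add_neg]
    refine h1.trans ((add_le_add (hb z hz).2 (hb z' hz').2).trans ?_)
    norm_num
  have key : ∀ k i j, (∀ t, ‖zs (i + k) t - zs (j + k) t‖ₑ ≤ b k) ∧
      sN p volume (fun t => zs (i + k) t - zs (j + k) t) ≤ b k := fun k => by
    induction k with
    | zero =>
      intro i j
      have hb0 : b 0 = 2 := by simp [hbdef]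
      rw [hb0]
      refine ⟨fun t => (enorm_sub_le).trans
        ((add_le_add ((hb _ (hB i)).1 t) ((hb _ (hB j)).1 t)).trans (by norm_num)),
        hsub _ _ (hB _) (hB _)⟩
    | succ k ih =>
      intro i j
      have h1 := hL _ _ (hB (i + k)) (hB (j + k))
      have h2 := (ih i j).2
      rw [← hb1, ← add_assoc, ← add_assoc, hsucc, hsucc]
      exact ⟨fun t => (h1.1 t).trans (mul_le_mul_right h2 _), h1.2.trans (mul_le_mul_right h2 _)⟩
  have key' : ∀ N n m, N ≤ n → N ≤ m → (∀ t, ‖zs n t - zs m t‖ₑ ≤ b N) ∧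
      sN p volume (fun t => zs n t - zs m t) ≤ b N := fun N n m hn hm => by
    have := key N (n - N) (m - N)
    rwa [Nat.sub_add_cancel hn, Nat.sub_add_cancel hm] at this
  have hcau : ∀ t, CauchySeq fun k => zs k t := fun t => by
    rw [EMetric.cauchySeq_iff]
    intro ε hε
    obtain ⟨N, hN⟩ := (hblim.eventually (gt_mem_nhds hε)).exists
    refine ⟨N, fun m hm n hn => ?_⟩
    rw [edist_eq_enorm_sub]
    exact ((key' N m n hm hn).1 t).trans_lt hN
  choose z hz using fun t => cauchySeq_tendsto_of_complete (hcau t)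
  have hunif : ∀ N t, ‖zs N t - z t‖ₑ ≤ b N := fun N t => by
    refine le_of_tendsto ((tendsto_const_nhds.sub (hz t)).enorm) ?_
    filter_upwards [eventually_ge_atTop N] with k hk
    exact (key' N N k le_rfl hk).1 t
  have hzc : Continuous z := by
    refine TendstoUniformly.continuous (F := zs) (p := atTop) ?_
      (Frequently.of_forall fun k => hc _ (hB k))
    rw [EMetric.tendstoUniformly_iff]
    intro ε hε
    filter_upwards [hblim.eventually (gt_mem_nhds hε)] with k hk t
    rw [edist_comm, edist_eq_enorm_sub]
    exact (hunif k t).trans_lt hk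
  have hBz : B z := hcl zs z hB hzc hz
  refine ⟨z, hBz, funext fun t => ?_⟩
  have hs : ∀ N, sN p volume (fun t => z t - zs N t) ≤ b N := fun N => by
    refine sN_le_of_tendsto hp (z := fun k t => zs (k + N) t - zs N t)
      (fun k => (hc _ (hB _)).sub (hc _ (hB _))) (fun t => ?_) (fun k => ?_)
    · exact ((tendsto_add_atTop_iff_nat N).2 (hz t)).sub tendsto_const_nhds
    · exact (key' N _ _ (Nat.le_add_left _ _) le_rfl).2
  have h1 : Tendsto (fun k => zs (k + 1) t) atTop (𝓝 (T z t)) := by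
    rw [tendsto_iff_edist_tendsto_0]
    refine tendsto_of_tendsto_of_tendsto_of_le_of_le tendsto_const_nhds
      (hblim.comp (tendsto_add_atTop_nat 1)) (fun _ => zero_le) fun k => ?_
    simp only [Function.comp]
    rw [← hb1, edist_comm, edist_eq_enorm_sub, hsucc]
    exact ((hL _ _ hBz (hB k)).1 t).trans (mul_le_mul_right (hs k) _)
  exact tendsto_nhds_unique h1 ((tendsto_add_atTop_iff_nat 1).2 (hz t))

end FixedPoint
section Picard

variable {p : ℝ}

theorem exists_nr_le_h1Norm (hp : p ∈ Set.Ioc (0 : ℝ) 2) :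
    ∃ C : ℝ≥0, ∀ f : L2, nr (rE p) f ≤ C * h1Norm f :=
  exists_eLpNorm_le_h1Norm (holderConjugate_rE hp) (by linarith [eight_le_rE hp])

/-- Data for which the nonlinearity is a small perturbation along the free evolution. -/
structure SmallData (p : ℝ) (a : Plane → ℝ) (φ : L2) (A M ε : ℝ≥0) : Prop where
  h1Norm_le : h1Norm φ ≤ M
  weight_le : lpn (mE p) volume (fun x => ‖a x‖ₑ) ≤ A
  weight_diff_le : ∀ h : Plane, ‖h‖ ≤ 1 →
    lpn (mE p) volume (fun x => ‖a (x + h) - a x‖ₑ) ≤ A * ‖h‖ₑ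
  lam_le : lam p volume a (fun t => freeProp t φ) ≤ ε
  lam_diff_le : ∀ h : Plane, ‖h‖ ≤ 1 →
    lam p volume (fun x => a (x + h) - a x) (fun t => freeProp t φ) ≤ ε * ‖h‖ₑ

/-- The size of the potential along perturbations of size `η` of the free evolution. -/
def kap (p : ℝ) (C A ε η : ℝ≥0) : ℝ≥0∞ :=
  2 ^ p * (ε + A * ((C * 2) ^ (1 - γE p / qE p) * (η : ℝ≥0∞) ^ (γE p / qE p)) ^ p)

/-- The smallness conditions that make the Duhamel map a contraction. -/
structure SmallConst (p : ℝ) (C A M ε η : ℝ≥0) : Prop where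
  le_one : η ≤ 1
  contraction : cS p * (ENNReal.ofReal (p + 2) * (2 * kap p C A ε η)) ≤ 1 / 2
  source : cS p * (ε * (cS p * M)) ≤ 1 / 2 * η
  derivative : cS p * (kap p C A ε η * ((3 * ENNReal.ofReal (p + 2) + 1) * (cS p * M + 1))) ≤ 1

/-- The set of perturbations of the free evolution in which the solution is sought. -/
structure PicardBall (p : ℝ) (η : ℝ≥0) (z : ℝ → L2) : Prop where
  continuous : Continuous z
  enorm_le : ∀ t, ‖z t‖ₑ ≤ η
  sN_le : sN p volume z ≤ η
  enorm_diff_le : ∀ h : Plane, ‖h‖ ≤ 1 → ∀ t, ‖translate h (z t) - z t‖ₑ ≤ ‖h‖ₑ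
  sN_diff_le : ∀ h : Plane, ‖h‖ ≤ 1 → sN p volume (fun t => translate h (z t) - z t) ≤ ‖h‖ₑ

theorem sN_zero (hp : p ∈ Set.Ioc (0 : ℝ) 2) {μ : Measure ℝ} : sN p μ (fun _ => 0) = 0 := by
  have := one_le_γE hp
  simp only [sN, lpn, nr_zero]
  rw [ENNReal.zero_rpow_of_pos (by linarith), lintegral_zero, ENNReal.zero_rpow_of_pos (by positivity)]

theorem PicardBall.zero (hp : p ∈ Set.Ioc (0 : ℝ) 2) (η : ℝ≥0) : PicardBall p η 0 where
  continuous := continuous_const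
  enorm_le t := by simp
  sN_le := (sN_zero hp).le.trans zero_le
  enorm_diff_le h _ t := by simp
  sN_diff_le h _ := by
    simp only [Pi.zero_apply, map_zero, sub_zero]
    exact (sN_zero hp).le.trans zero_le

theorem PicardBall.of_tendsto (hp : p ∈ Set.Ioc (0 : ℝ) 2) {η : ℝ≥0} {zs : ℕ → ℝ → L2}
    {z : ℝ → L2} (hzs : ∀ k, PicardBall p η (zs k)) (hz : Continuous z)
    (h : ∀ t, Tendsto (fun k => zs k t) atTop (𝓝 (z t))) : PicardBall p η z := by
  have hd : ∀ (h : Plane) t, Tendsto (fun k => translate h (zs k t) - zs k t) atTop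
      (𝓝 (translate h (z t) - z t)) := fun k t =>
    (((translate k).continuous.tendsto _).comp (h t)).sub (h t)
  exact
    { continuous := hz
      enorm_le := fun t => le_of_tendsto (h t).enorm (Eventually.of_forall fun k =>
        (hzs k).enorm_le t)
      sN_le := sN_le_of_tendsto hp (fun k => (hzs k).continuous) h fun k => (hzs k).sN_le
      enorm_diff_le := fun h hh t => le_of_tendsto (hd h t).enorm (Eventually.of_forall fun k =>
        (hzs k).enorm_diff_le h hh t)
      sN_diff_le := fun h hh => sN_le_of_tendsto hp
        (fun k => ((translate h).continuous.comp (hzs k).continuous).sub (hzs k).continuous) (hd h)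
        fun k => (hzs k).sN_diff_le h hh }

variable {C A M ε η : ℝ≥0} {z z' : ℝ → L2}

theorem PicardBall.h1Norm_le (hz : PicardBall p η z) (hη : η ≤ 1) (t : ℝ) : h1Norm (z t) ≤ 2 := by
  have := h1Norm_le_of_translate (z t) 1 ((hz.enorm_le t).trans (by exact_mod_cast hη))
    fun h hh => (hz.enorm_diff_le h hh t).trans (by rw [mul_one])
  rwa [mul_one] at this

variable (hC : ∀ f : L2, nr (rE p) f ≤ C * h1Norm f)
include hC

theorem PicardBall.nr_le (hz : PicardBall p η z) (hη : η ≤ 1) (t : ℝ) :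
    nr (rE p) (z t) ≤ C * 2 :=
  (hC _).trans (mul_le_mul_right (hz.h1Norm_le hη t) _)

theorem PicardBall.xN_le (hp : p ∈ Set.Ioc (0 : ℝ) 2) (hz : PicardBall p η z) (hη : η ≤ 1) :
    xN p volume z ≤ (C * 2) ^ (1 - γE p / qE p) * (η : ℝ≥0∞) ^ (γE p / qE p) := by
  have h1 := one_le_γE hp
  have h2 := one_le_qE hp
  refine (InhomNLS.xN_le hp hz.continuous (hz.nr_le hC hη)).trans ?_
  gcongr
  exact hz.sN_le

variable {a : Plane → ℝ} {φ : L2} (ha : BoundedWeight a) (hd : SmallData p a φ A M ε)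
include hd

theorem nr_freeProp_le (t : ℝ) : nr (rE p) (freeProp t φ) ≤ C * M := by
  refine (hC _).trans ?_
  rw [h1Norm_freeProp]
  exact mul_le_mul_right hd.h1Norm_le _

theorem PicardBall.nr_add_le (hp : p ∈ Set.Ioc (0 : ℝ) 2) (hz : PicardBall p η z) (hη : η ≤ 1)
    (t : ℝ) : nr (rE p) (freeProp t φ + z t) ≤ C * M + C * 2 :=
  (InhomNLS.nr_add_le (one_le_rE hp) _ _).trans
    (add_le_add (nr_freeProp_le hC hd t) (hz.nr_le hC hη t))

theorem PicardBall.nr_add_ne_top (hp : p ∈ Set.Ioc (0 : ℝ) 2) (hz : PicardBall p η z)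
    (hη : η ≤ 1) (t : ℝ) : nr (rE p) (freeProp t φ + z t) ≠ ⊤ :=
  ((hz.nr_add_le hC hd hp hη t).trans_lt (by
    rw [← ENNReal.coe_mul]
    exact ENNReal.add_lt_top.2 ⟨ENNReal.coe_lt_top, ENNReal.mul_lt_top ENNReal.coe_lt_top
      (by norm_num)⟩)).ne

omit hC hd in
theorem PicardBall.continuous_add (hz : PicardBall p η z) :
    Continuous fun t => freeProp t φ + z t :=
  (continuous_freeProp_left φ).add hz.continuous

theorem PicardBall.locallyIntegrable_nl (hp : p ∈ Set.Ioc (0 : ℝ) 2) (hz : PicardBall p η z)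
    (hη : η ≤ 1) : LocallyIntegrable fun t => nl p a ha (freeProp t φ + z t) := by
  refine InhomNLS.locallyIntegrable_nl ha hp hz.continuous_add (K := (C * M + C * 2) + (M + 1)) ?_
    (fun t => ?_) fun t => (hz.nr_add_le hC hd hp hη t).trans le_self_add
  · finiteness
  · refine (enorm_add_le _ _).trans (le_trans (add_le_add ?_ ?_) le_add_self)
    · rw [← ofReal_norm, norm_freeProp, ofReal_norm]
      exact (enorm_le_h1Norm φ).trans hd.h1Norm_le
    · exact (hz.enorm_le t).trans (by exact_mod_cast hη)

theorem PicardBall.lam_add_le (hp : p ∈ Set.Ioc (0 : ℝ) 2) (hz : PicardBall p η z) (hη : η ≤ 1)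
    (ha : BoundedWeight a) :
    lam p volume a (fun t => freeProp t φ + z t) ≤ kap p C A ε η := by
  refine (InhomNLS.lam_add_le hp ha.measurable (continuous_freeProp_left φ) hz.continuous).trans ?_
  refine mul_le_mul_right (add_le_add hd.lam_le ((InhomNLS.lam_le hp ha.measurable hz.continuous).trans ?_)) _
  exact mul_le_mul' hd.weight_le (ENNReal.rpow_le_rpow (hz.xN_le hC hp hη) hp.1.le)

theorem PicardBall.lam_diff_add_le (hp : p ∈ Set.Ioc (0 : ℝ) 2) (hz : PicardBall p η z)
    (hη : η ≤ 1) (ha : BoundedWeight a) {h : Plane} (hh : ‖h‖ ≤ 1) :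
    lam p volume (fun x => a (x + h) - a x) (fun t => freeProp t φ + z t) ≤
      kap p C A ε η * ‖h‖ₑ := by
  have mb : Measurable fun x => a (x + h) - a x :=
    (ha.measurable.comp (measurable_add_const h)).sub ha.measurable
  refine (InhomNLS.lam_add_le hp mb (continuous_freeProp_left φ) hz.continuous).trans ?_
  rw [kap, mul_assoc, add_mul]
  refine mul_le_mul_right (add_le_add (hd.lam_diff_le h hh)
    ((InhomNLS.lam_le hp mb hz.continuous).trans ?_)) _
  rw [mul_right_comm]
  exact mul_le_mul' (hd.weight_diff_le h hh) (ENNReal.rpow_le_rpow (hz.xN_le hC hp hη) hp.1.le)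

omit hC in
theorem sN_translate_freeProp_sub_le (hp : p ∈ Set.Ioc (0 : ℝ) 2) (h : Plane) :
    sN p volume (fun t => translate h (freeProp t φ) - freeProp t φ) ≤ cS p * M * ‖h‖ₑ := by
  have e : ∀ t, translate h (freeProp t φ) - freeProp t φ = freeProp t (translate h φ - φ) :=
    fun t => by rw [translate_freeProp, freeProp_sub]
  simp_rw [e]
  refine (sN_freeProp_le hp _).trans ?_
  rw [mul_assoc, mul_comm (M : ℝ≥0∞)]
  gcongr
  exact (enorm_translate_sub_le h φ).trans (mul_le_mul_right hd.h1Norm_le _)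

omit hC in
theorem sN_freeProp_le_mul (hp : p ∈ Set.Ioc (0 : ℝ) 2) :
    sN p volume (fun t => freeProp t φ) ≤ cS p * M :=
  (sN_freeProp_le hp _).trans (mul_le_mul_right ((enorm_le_h1Norm φ).trans hd.h1Norm_le) _)

omit hC in
theorem PicardBall.sN_add_le (hp : p ∈ Set.Ioc (0 : ℝ) 2) (hz : PicardBall p η z) (hη : η ≤ 1) :
    sN p volume (fun t => freeProp t φ + z t) ≤ cS p * M + 1 :=
  (InhomNLS.sN_add_le hp (continuous_freeProp_left φ) hz.continuous).trans
    (add_le_add (sN_freeProp_le_mul hd hp) (hz.sN_le.trans (by exact_mod_cast hη)))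

omit hC in
theorem PicardBall.sN_diff_add_le (hp : p ∈ Set.Ioc (0 : ℝ) 2) (hz : PicardBall p η z) {h : Plane}
    (hh : ‖h‖ ≤ 1) :
    sN p volume (fun t => translate h (freeProp t φ + z t) - (freeProp t φ + z t)) ≤
      (cS p * M + 1) * ‖h‖ₑ := by
  have e : ∀ t, translate h (freeProp t φ + z t) - (freeProp t φ + z t) =
      (translate h (freeProp t φ) - freeProp t φ) + (translate h (z t) - z t) := fun t => by
    rw [map_add]; abel
  simp_rw [e]
  have hw := continuous_freeProp_left φ
  refine (InhomNLS.sN_add_le hp (((translate h).continuous.comp hw).sub hw)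
    (((translate h).continuous.comp hz.continuous).sub hz.continuous)).trans ?_
  rw [add_mul, one_mul]
  exact add_le_add (sN_translate_freeProp_sub_le hd hp h) (hz.sN_diff_le h hh)

/-- The bound for the differences of the nonlinear term on a set of times, in terms of bounds for
the potential on that set. -/
theorem PicardBall.dN_translate_nl_sub_le (hp : p ∈ Set.Ioc (0 : ℝ) 2) (hz : PicardBall p η z)
    (hη : η ≤ 1) {h : Plane} (hh : ‖h‖ ≤ 1) {μ : Measure ℝ} (hμ : μ ≤ volume) {κ : ℝ≥0∞}
    (h1 : lam p μ a (fun t => freeProp t φ + z t) ≤ κ)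
    (h2 : lam p μ (fun x => a (x + h) - a x) (fun t => freeProp t φ + z t) ≤ κ * ‖h‖ₑ) :
    dN p μ (fun t => translate h (nl p a ha (freeProp t φ + z t)) -
      nl p a ha (freeProp t φ + z t)) ≤
      κ * ((3 * ENNReal.ofReal (p + 2) + 1) * (cS p * M + 1)) * ‖h‖ₑ := by
  have hγ := one_le_γE hp
  have h3 : sN p μ (fun t => freeProp t φ + z t) ≤ cS p * M + 1 :=
    (lpn_mono_measure (by linarith) hμ _).trans (hz.sN_add_le hd hp hη)
  have h4 : sN p μ (fun t => translate h (freeProp t φ + z t) - (freeProp t φ + z t)) ≤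
      (cS p * M + 1) * ‖h‖ₑ :=
    (lpn_mono_measure (by linarith) hμ _).trans (hz.sN_diff_add_le hd hp hh)
  have h5 : κ * ‖h‖ₑ ≤ κ := by
    refine mul_le_of_le_one_right zero_le ?_
    rw [← ofReal_norm]
    exact ENNReal.ofReal_le_one.2 hh
  refine (InhomNLS.dN_translate_nl_sub_le ha hp hz.continuous_add
    (hz.nr_add_ne_top hC hd hp hη) h).trans ?_
  calc _ ≤ ENNReal.ofReal (p + 2) * ((2 * κ + κ) * ((cS p * M + 1) * ‖h‖ₑ)) +
        κ * ‖h‖ₑ * (cS p * M + 1) := by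
        gcongr
        exact h2.trans h5
    _ = _ := by ring

/-- The Duhamel map in terms of the perturbation of the free evolution. -/
def duhamelMap (p : ℝ) {a : Plane → ℝ} (ha : BoundedWeight a) (φ : L2) (z : ℝ → L2) (t : ℝ) : L2 :=
  (-Complex.I) • duhamel (fun s => nl p a ha (freeProp s φ + z s)) t

theorem dN_nl_add_le (hp : p ∈ Set.Ioc (0 : ℝ) 2) (hz : PicardBall p η z) (hη : η ≤ 1) :
    dN p volume (fun t => nl p a ha (freeProp t φ + z t)) ≤
      lam p volume a (fun t => freeProp t φ) * sN p volume (fun t => freeProp t φ) +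
        ENNReal.ofReal (p + 2) * (2 * kap p C A ε η * sN p volume z) := by
  have hδ := one_le_δE hp
  have h0 := PicardBall.zero hp η
  have hw : Continuous fun t => freeProp t φ := continuous_freeProp_left φ
  have hnw : ∀ t, nr (rE p) (freeProp t φ) ≠ ⊤ := fun t =>
    ((nr_freeProp_le hC hd t).trans_lt (by finiteness)).ne
  have m1 := aestronglyMeasurable_nl ha hp (μ := volume) hw.aestronglyMeasurable hnw
  have m2 := aestronglyMeasurable_nl ha hp (μ := volume) hz.continuous_add.aestronglyMeasurable
    (hz.nr_add_ne_top hC hd hp hη)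
  have e : ∀ t, nl p a ha (freeProp t φ + z t) = nl p a ha (freeProp t φ) +
      (nl p a ha (freeProp t φ + z t) - nl p a ha (freeProp t φ)) := fun t => by abel
  have h1 : lam p volume a (fun t => freeProp t φ) ≤ kap p C A ε η := by
    simpa using h0.lam_add_le hC hd hp hη ha
  have hs : (fun t => freeProp t φ + z t - freeProp t φ) = z := by
    funext t; abel
  calc dN p volume (fun t => nl p a ha (freeProp t φ + z t))
      ≤ dN p volume (fun t => nl p a ha (freeProp t φ)) +
        dN p volume (fun t => nl p a ha (freeProp t φ + z t) - nl p a ha (freeProp t φ)) := by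
        refine (lpn_mono (by linarith) fun t => ?_).trans
          (lpn_add_le hδ (aemeasurable_nr m1) (aemeasurable_nr (m2.sub m1)))
        have h2 := InhomNLS.nr_add_le (one_le_ρE hp) (nl p a ha (freeProp t φ))
          (nl p a ha (freeProp t φ + z t) - nl p a ha (freeProp t φ))
        rwa [← e t] at h2
    _ ≤ _ := by
        refine add_le_add (dN_nl_le ha hp hw hnw) ?_
        refine (dN_nl_sub_le ha hp hz.continuous_add hw (hz.nr_add_ne_top hC hd hp hη) hnw).trans ?_
        rw [hs, two_mul]
        gcongr
        exact hz.lam_add_le hC hd hp hη ha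

omit hC hd in
theorem sN_smul {c : ℂ} (hc : ‖c‖ₑ = 1) {μ : Measure ℝ} (u : ℝ → L2) :
    sN p μ (fun t => c • u t) = sN p μ u := by
  simp only [sN, nr_smul, hc, one_mul]

omit hC hd in
theorem enorm_neg_I : ‖(-Complex.I : ℂ)‖ₑ = 1 := by
  rw [enorm_neg, ← ofReal_norm]; simp

theorem PicardBall.map (hp : p ∈ Set.Ioc (0 : ℝ) 2) (hs : SmallConst p C A M ε η)
    (hz : PicardBall p η z) : PicardBall p η (duhamelMap p ha φ z) := by
  have hη := hs.le_one
  have hF := hz.locallyIntegrable_nl hC ha hd hp hη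
  have b1 : cS p * dN p volume (fun t => nl p a ha (freeProp t φ + z t)) ≤ η := by
    calc _ ≤ cS p * (ε * (cS p * M) + ENNReal.ofReal (p + 2) * (2 * kap p C A ε η * η)) := by
          refine mul_le_mul_right ((dN_nl_add_le hC ha hd hp hz hη).trans ?_) _
          gcongr
          · exact hd.lam_le
          · exact sN_freeProp_le_mul hd hp
          · exact hz.sN_le
      _ = cS p * (ε * (cS p * M)) + cS p * (ENNReal.ofReal (p + 2) * (2 * kap p C A ε η)) * η := by
          ring
      _ ≤ 1 / 2 * η + 1 / 2 * η := add_le_add hs.source (mul_le_mul_left hs.contraction _)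
      _ = η := by rw [← add_mul, ENNReal.add_halves, one_mul]
  have hG : ∀ h : Plane, LocallyIntegrable fun s => translate h (nl p a ha (freeProp s φ + z s)) -
      nl p a ha (freeProp s φ + z s) := fun h => (locallyIntegrable_translate hF h).sub hF
  have e : ∀ (h : Plane) t, translate h (duhamelMap p ha φ z t) - duhamelMap p ha φ z t =
      (-Complex.I) • duhamel (fun s => translate h (nl p a ha (freeProp s φ + z s)) -
        nl p a ha (freeProp s φ + z s)) t := fun h t => by
    rw [duhamel_sub (locallyIntegrable_translate hF h) hF, ← translate_duhamel hF, smul_sub,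
      duhamelMap, map_smul]
  have b2 : ∀ h : Plane, ‖h‖ ≤ 1 → cS p * dN p volume (fun s =>
      translate h (nl p a ha (freeProp s φ + z s)) - nl p a ha (freeProp s φ + z s)) ≤ ‖h‖ₑ :=
    fun h hh => by
    refine (mul_le_mul_right (hz.dN_translate_nl_sub_le hC ha hd hp hη hh le_rfl
      (hz.lam_add_le hC hd hp hη ha) (hz.lam_diff_add_le hC hd hp hη ha hh)) _).trans ?_
    rw [← mul_assoc]
    exact mul_le_of_le_one_left zero_le hs.derivative
  exact
    { continuous := (continuous_const_smul (-Complex.I)).comp (continuous_duhamel hF)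
      enorm_le := fun t => by
        rw [duhamelMap, enorm_smul, enorm_neg_I, one_mul]
        exact (enorm_duhamel_le hp hF t).trans b1
      sN_le := by
        refine (sN_smul enorm_neg_I _).le.trans ?_
        exact (sN_duhamel_le hp hF).trans b1
      enorm_diff_le := fun h hh t => by
        rw [e, enorm_smul, enorm_neg_I, one_mul]
        exact (enorm_duhamel_le hp (hG h) t).trans (b2 h hh)
      sN_diff_le := fun h hh => by
        simp_rw [e]
        refine (sN_smul enorm_neg_I _).le.trans ?_
        exact (sN_duhamel_le hp (hG h)).trans (b2 h hh) }

theorem duhamelMap_contraction (hp : p ∈ Set.Ioc (0 : ℝ) 2) (hs : SmallConst p C A M ε η)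
    (hz : PicardBall p η z) (hz' : PicardBall p η z') :
    (∀ t, ‖duhamelMap p ha φ z t - duhamelMap p ha φ z' t‖ₑ ≤
      1 / 2 * sN p volume (fun t => z t - z' t)) ∧
    sN p volume (fun t => duhamelMap p ha φ z t - duhamelMap p ha φ z' t) ≤
      1 / 2 * sN p volume (fun t => z t - z' t) := by
  have hη := hs.le_one
  have hF := hz.locallyIntegrable_nl hC ha hd hp hη
  have hG := hz'.locallyIntegrable_nl hC ha hd hp hη
  have b : cS p * dN p volume (fun t => nl p a ha (freeProp t φ + z t) -
      nl p a ha (freeProp t φ + z' t)) ≤ 1 / 2 * sN p volume (fun t => z t - z' t) := by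
    have h1 := dN_nl_sub_le (μ := volume) ha hp (hz.continuous_add (φ := φ))
      (hz'.continuous_add (φ := φ)) (hz.nr_add_ne_top hC hd hp hη) (hz'.nr_add_ne_top hC hd hp hη)
    simp_rw [add_sub_add_left_eq_sub] at h1
    calc _ ≤ cS p * (ENNReal.ofReal (p + 2) * ((kap p C A ε η + kap p C A ε η) *
          sN p volume (fun t => z t - z' t))) := by
          refine mul_le_mul_right (h1.trans ?_) _
          gcongr
          · exact hz.lam_add_le hC hd hp hη ha
          · exact hz'.lam_add_le hC hd hp hη ha
      _ = cS p * (ENNReal.ofReal (p + 2) * (2 * kap p C A ε η)) *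
          sN p volume (fun t => z t - z' t) := by ring
      _ ≤ _ := mul_le_mul_left hs.contraction _
  have e : ∀ t, duhamelMap p ha φ z t - duhamelMap p ha φ z' t = (-Complex.I) •
      duhamel (fun t => nl p a ha (freeProp t φ + z t) - nl p a ha (freeProp t φ + z' t)) t :=
    fun t => by rw [duhamel_sub hF hG, smul_sub]; rfl
  refine ⟨fun t => ?_, ?_⟩
  · rw [e, enorm_smul, enorm_neg_I, one_mul]
    exact (enorm_duhamel_le hp (hF.sub hG) t).trans b
  · simp_rw [e]
    refine (sN_smul enorm_neg_I _).le.trans ?_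
    exact (sN_duhamel_le hp (hF.sub hG)).trans b

theorem exists_picard_solution (hp : p ∈ Set.Ioc (0 : ℝ) 2) (hs : SmallConst p C A M ε η) :
    ∃ z, PicardBall p η z ∧ duhamelMap p ha φ z = z ∧
      sN p volume z ≤ 2 * (cS p * (lam p volume a (fun t => freeProp t φ) * (cS p * M))) := by
  have hη : (η : ℝ≥0∞) ≤ 1 := by exact_mod_cast hs.le_one
  obtain ⟨z, hz, hfix⟩ := exists_fixedPoint hp (B := PicardBall p η) (T := duhamelMap p ha φ)
    (PicardBall.zero hp η) (fun z hz => hz.map hC ha hd hp hs) (fun z hz => hz.continuous)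
    (fun z hz => ⟨fun t => (hz.enorm_le t).trans hη, hz.sN_le.trans hη⟩)
    (fun z z' hz hz' => duhamelMap_contraction hC ha hd hp hs hz hz')
    (fun zs z hzs hc h => PicardBall.of_tendsto hp hzs hc h)
  refine ⟨z, hz, hfix, ?_⟩
  have hF := hz.locallyIntegrable_nl hC ha hd hp hs.le_one
  set s := sN p volume z with hsdef
  have hfin : s ≠ ⊤ := (hz.sN_le.trans_lt ENNReal.coe_lt_top).ne
  set L := cS p * (lam p volume a (fun t => freeProp t φ) * (cS p * M)) with hL
  have h1 : s ≤ L + 1 / 2 * s := by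
    calc s = sN p volume (duhamelMap p ha φ z) := by rw [hfix]
      _ ≤ cS p * dN p volume (fun t => nl p a ha (freeProp t φ + z t)) :=
          (sN_smul enorm_neg_I _).le.trans (sN_duhamel_le hp hF)
      _ ≤ cS p * (lam p volume a (fun t => freeProp t φ) * (cS p * M) +
          ENNReal.ofReal (p + 2) * (2 * kap p C A ε η * s)) := by
          refine mul_le_mul_right ((dN_nl_add_le hC ha hd hp hz hs.le_one).trans ?_) _
          gcongr
          exact sN_freeProp_le_mul hd hp
      _ = L + cS p * (ENNReal.ofReal (p + 2) * (2 * kap p C A ε η)) * s := by rw [hL]; ring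
      _ ≤ _ := by gcongr; exact hs.contraction
  have h2 : 1 / 2 * s + 1 / 2 * s ≤ L + 1 / 2 * s := by
    rwa [← add_mul, ENNReal.add_halves, one_mul]
  have h3 : 1 / 2 * s ≤ L := (ENNReal.add_le_add_iff_right
    (ENNReal.mul_ne_top (by simp) hfin)).1 h2
  calc s = 2 * (1 / 2 * s) := by
        rw [← mul_assoc, one_div, ENNReal.mul_inv_cancel (by norm_num) (by norm_num), one_mul]
    _ ≤ 2 * L := by gcongr

end Picard
section Scattering

theorem isClosed_setOf_h1Norm_le (c : ℝ≥0∞) : IsClosed {f : L2 | h1Norm f ≤ c} :=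
  (isClosed_setOf_eLpNorm_le (fun ξ z => h1Symbol ξ * z) (fun _ => continuous_const.mul continuous_id)
    (fun f => continuous_h1Symbol.aestronglyMeasurable.mul (Lp.aestronglyMeasurable f)) 2 c).preimage
      (Lp.fourierTransformₗᵢ Plane ℂ).continuous

/-- If the `H¹` oscillation of `f` along `l` vanishes, then `f` converges in `H¹` along `l`. -/
theorem exists_tendsto_h1Norm {l : Filter ℝ} [l.NeBot] {f : ℝ → L2} (hf : ∀ t, MemH1 (f t))
    (h : ∀ ε : ℝ≥0∞, 0 < ε → ∃ S ∈ l, ∀ t₁ ∈ S, ∀ t₂ ∈ S, h1Norm (f t₂ - f t₁) < ε) :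
    ∃ g : L2, MemH1 g ∧ Tendsto (fun t => h1Norm (f t - g)) l (𝓝 0) := by
  have hcau : Cauchy (map f l) := by
    rw [EMetric.cauchy_iff]
    refine ⟨NeBot.ne inferInstance, fun ε hε => ?_⟩
    obtain ⟨S, hS, hS'⟩ := h ε hε
    refine ⟨f '' S, image_mem_map hS, ?_⟩
    rintro _ ⟨t₁, h₁, rfl⟩ _ ⟨t₂, h₂, rfl⟩
    rw [edist_eq_enorm_sub]
    exact (enorm_le_h1Norm _).trans_lt (hS' t₂ h₂ t₁ h₁)
  obtain ⟨g, hg⟩ := cauchy_map_iff_exists_tendsto.1 hcau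
  have key : ∀ ε : ℝ≥0∞, 0 < ε → ∃ S ∈ l, ∀ t ∈ S, h1Norm (f t - g) ≤ ε := fun ε hε => by
    obtain ⟨S, hS, hS'⟩ := h ε hε
    refine ⟨S, hS, fun t ht => ?_⟩
    refine (isClosed_setOf_h1Norm_le ε).mem_of_tendsto (tendsto_const_nhds.sub hg) ?_
    filter_upwards [hS] with s hs
    exact (hS' s hs t ht).le
  refine ⟨g, ?_, ?_⟩
  · obtain ⟨S, hS, hS'⟩ := key 1 one_pos
    obtain ⟨t, ht⟩ := nonempty_of_mem hS
    have e : g = f t - (f t - g) := by abel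
    rw [MemH1, e]
    exact (h1Norm_sub_le _ _).trans_lt
      (ENNReal.add_lt_top.2 ⟨hf t, (hS' t ht).trans_lt ENNReal.one_lt_top⟩)
  · rw [ENNReal.tendsto_nhds_zero]
    intro ε hε
    obtain ⟨S, hS, hS'⟩ := key ε hε
    exact mem_of_superset hS hS'

theorem exists_setLIntegral_lt {X : Type*} [MeasurableSpace X] {μ : Measure X} {g : X → ℝ≥0∞}
    (hg : ∫⁻ t, g t ∂μ ≠ ⊤) {S : ℕ → Set X} (hS : ∀ n, MeasurableSet (S n))
    (hS' : Antitone S) (h0 : ⋂ n, S n = ∅) {ε : ℝ≥0∞} (hε : 0 < ε) :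
    ∃ n, ∫⁻ t in S n, g t ∂μ < ε := by
  have hfin : μ.withDensity g (S 0) ≠ ⊤ := by
    rw [withDensity_apply _ (hS 0)]
    exact ((setLIntegral_le_lintegral _ _).trans_lt hg.lt_top).ne
  have h1 := tendsto_measure_iInter_atTop (μ := μ.withDensity g)
    (fun n => (hS n).nullMeasurableSet) hS' ⟨0, hfin⟩
  rw [h0, measure_empty] at h1
  obtain ⟨n, hn⟩ := (h1.eventually (gt_mem_nhds hε)).exists
  refine ⟨n, ?_⟩
  rwa [Function.comp, withDensity_apply _ (hS n)] at hn

/-- A curve whose `H¹` increments are controlled by an integrable function of time gives rise,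
after applying the free group, to a continuous curve in `H¹` that scatters. -/
theorem scatters_of_increments {f : ℝ → L2} {g : ℝ → ℝ≥0∞} (hg : ∫⁻ t, g t ≠ ⊤) {K : ℝ≥0∞}
    (hK : K ≠ ⊤) {e : ℝ} (he : 0 < e) (hf : ∀ t, MemH1 (f t))
    (h : ∀ t₁ t₂, h1Norm (f t₂ - f t₁) ≤ K * (∫⁻ s in Set.uIoc t₁ t₂, g s) ^ e) :
    (∀ t₀, Tendsto (fun t => h1Norm (freeProp t (f t) - freeProp t₀ (f t₀))) (𝓝 t₀) (𝓝 0)) ∧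
    ScattersForward (fun t => freeProp t (f t)) ∧ ScattersBackward (fun t => freeProp t (f t)) := by
  have small : ∀ ε : ℝ≥0∞, 0 < ε → ∃ η : ℝ≥0∞, 0 < η ∧ ∀ S : Set ℝ, S.OrdConnected →
      ∫⁻ s in S, g s < η → ∀ t₁ ∈ S, ∀ t₂ ∈ S, h1Norm (f t₂ - f t₁) < ε := fun ε hε => by
    have hc : Tendsto (fun x : ℝ≥0∞ => K * x ^ e) (𝓝 0) (𝓝 0) := by
      have h1 : Tendsto (fun x : ℝ≥0∞ => x ^ e) (𝓝 0) (𝓝 0) := by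
        have := (ENNReal.continuous_rpow_const (y := e)).tendsto 0
        rwa [ENNReal.zero_rpow_of_pos he] at this
      have := ENNReal.Tendsto.const_mul h1 (Or.inr hK)
      rwa [mul_zero] at this
    obtain ⟨η, hη, hη'⟩ := (ENNReal.nhds_zero_basis.eventually_iff).1
      (hc.eventually (gt_mem_nhds hε))
    refine ⟨η, hη, fun S hS hSη t₁ h₁ t₂ h₂ => (h t₁ t₂).trans_lt (hη' ?_)⟩
    refine lt_of_le_of_lt (lintegral_mono_set ?_) hSη
    exact Set.uIoc_subset_uIcc.trans (hS.uIcc_subset h₁ h₂)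
  have scat : ∀ l : Filter ℝ, l.NeBot →
      (∀ η : ℝ≥0∞, 0 < η → ∃ S ∈ l, S.OrdConnected ∧ ∫⁻ s in S, g s < η) →
      ∃ φ : L2, MemH1 φ ∧ Tendsto (fun t => h1Norm (freeProp t (f t) - freeProp t φ)) l (𝓝 0) := by
    intro l hl hS
    obtain ⟨φ, h1, h2⟩ := exists_tendsto_h1Norm (l := l) hf fun ε hε => by
      obtain ⟨η, hη, h3⟩ := small ε hε
      obtain ⟨S, hSl, hSo, hSη⟩ := hS η hη
      exact ⟨S, hSl, h3 S hSo hSη⟩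
    refine ⟨φ, h1, h2.congr fun t => ?_⟩
    rw [← freeProp_sub, h1Norm_freeProp]
  refine ⟨fun t₀ => ?_, scat atTop inferInstance fun η hη => ?_,
    scat atBot inferInstance fun η hη => ?_⟩
  · have h1 : Tendsto (fun t => h1Norm (f t - f t₀)) (𝓝 t₀) (𝓝 0) := by
      rw [ENNReal.tendsto_nhds_zero]
      intro ε hε
      obtain ⟨η, hη, h3⟩ := small ε hε
      have hv : Tendsto (fun δ : ℝ => volume (Metric.ball t₀ δ)) (𝓝[>] 0) (𝓝 0) := by
        simp_rw [Real.volume_ball]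
        have : Tendsto (fun δ : ℝ => ENNReal.ofReal (2 * δ)) (𝓝 0) (𝓝 (ENNReal.ofReal (2 * 0))) :=
          ENNReal.tendsto_ofReal (tendsto_id.const_mul 2)
        rw [mul_zero, ENNReal.ofReal_zero] at this
        exact this.mono_left nhdsWithin_le_nhds
      obtain ⟨δ, hδ, hδ'⟩ := (((tendsto_setLIntegral_zero hg hv).eventually
        (gt_mem_nhds hη)).and self_mem_nhdsWithin).exists
      filter_upwards [Metric.ball_mem_nhds t₀ hδ'] with t ht
      refine (h3 (Metric.ball t₀ δ) ?_ hδ t₀ (Metric.mem_ball_self hδ') t ht).le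
      rw [Real.ball_eq_Ioo]
      exact Set.ordConnected_Ioo
    have h2 := h1.add (tendsto_h1Norm_freeProp_sub (f t₀) (hf t₀) t₀)
    rw [add_zero] at h2
    refine tendsto_of_tendsto_of_tendsto_of_le_of_le tendsto_const_nhds h2 (fun _ => zero_le)
      fun t => ?_
    have e1 : freeProp t (f t) - freeProp t₀ (f t₀) =
        freeProp t (f t - f t₀) + (freeProp t (f t₀) - freeProp t₀ (f t₀)) := by
      rw [freeProp_sub]; abel
    simp only [e1]
    refine (h1Norm_add_le _ _).trans ?_
    rw [h1Norm_freeProp]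
  · obtain ⟨n, hn⟩ := exists_setLIntegral_lt hg (S := fun n : ℕ => Set.Ioi (n : ℝ))
      (fun n => measurableSet_Ioi) (fun m n hmn => Set.Ioi_subset_Ioi (by exact_mod_cast hmn))
      (by
        refine Set.eq_empty_of_forall_notMem fun x hx => ?_
        obtain ⟨n, hn⟩ := exists_nat_ge x
        exact absurd (Set.mem_iInter.1 hx n) (not_lt.2 hn)) hη
    exact ⟨_, Ioi_mem_atTop _, Set.ordConnected_Ioi, hn⟩
  · obtain ⟨n, hn⟩ := exists_setLIntegral_lt hg (S := fun n : ℕ => Set.Iio (-(n : ℝ)))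
      (fun n => measurableSet_Iio)
      (fun m n hmn => Set.Iio_subset_Iio (neg_le_neg (by exact_mod_cast hmn)))
      (by
        refine Set.eq_empty_of_forall_notMem fun x hx => ?_
        obtain ⟨n, hn⟩ := exists_nat_ge (-x)
        exact absurd (Set.mem_iInter.1 hx n) (not_lt.2 (neg_le.1 hn))) hη
    exact ⟨_, Iio_mem_atBot _, Set.ordConnected_Iio, hn⟩

variable {p : ℝ} {C A M ε η : ℝ≥0} {z : ℝ → L2} {a : Plane → ℝ} {φ : L2}

theorem xN_freeProp_le (hp : p ∈ Set.Ioc (0 : ℝ) 2) (hC : ∀ f : L2, nr (rE p) f ≤ C * h1Norm f)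
    (φ : L2) : xN p volume (fun t => freeProp t φ) ≤
      (C * h1Norm φ) ^ (1 - γE p / qE p) * (cS p * h1Norm φ) ^ (γE p / qE p) := by
  have h1 := one_le_γE hp
  have h2 := one_le_qE hp
  refine (xN_le hp (continuous_freeProp_left φ) fun t => (hC _).trans ?_).trans
    (mul_le_mul_right (ENNReal.rpow_le_rpow ((sN_freeProp_le hp φ).trans
      (mul_le_mul_right (enorm_le_h1Norm φ) _)) (by positivity)) _)
  rw [h1Norm_freeProp]

theorem one_sub_γE_div_pos (hp : p ∈ Set.Ioc (0 : ℝ) 2) : 0 < 1 - γE p / qE p := by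
  have := γE_lt_qE hp
  have := one_le_qE hp
  rw [sub_pos, div_lt_one (by linarith)]
  linarith

theorem γE_div_pos (hp : p ∈ Set.Ioc (0 : ℝ) 2) : 0 < γE p / qE p := by
  have := one_le_γE hp
  have := one_le_qE hp
  positivity

theorem PicardBall.xN_add_ne_top (hp : p ∈ Set.Ioc (0 : ℝ) 2)
    (hC : ∀ f : L2, nr (rE p) f ≤ C * h1Norm f) (hd : SmallData p a φ A M ε)
    (hz : PicardBall p η z) (hη : η ≤ 1) :
    xN p volume (fun t => freeProp t φ + z t) ≠ ⊤ := by
  have hθ := (γE_div_pos hp).le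
  have hθ' := (one_sub_γE_div_pos hp).le
  have hφ : h1Norm φ ≠ ⊤ := (hd.h1Norm_le.trans_lt ENNReal.coe_lt_top).ne
  refine ((InhomNLS.xN_add_le hp (continuous_freeProp_left φ) hz.continuous).trans_lt
    (ENNReal.add_lt_top.2 ⟨(xN_freeProp_le hp hC φ).trans_lt ?_,
      (hz.xN_le hC hp hη).trans_lt ?_⟩)).ne
  · exact ENNReal.mul_lt_top
      (ENNReal.rpow_lt_top_of_nonneg hθ' (ENNReal.mul_ne_top ENNReal.coe_ne_top hφ))
      (ENNReal.rpow_lt_top_of_nonneg hθ (ENNReal.mul_ne_top (cS_ne_top p) hφ))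
  · exact ENNReal.mul_lt_top
      (ENNReal.rpow_lt_top_of_nonneg hθ' (ENNReal.mul_ne_top ENNReal.coe_ne_top (by norm_num)))
      (ENNReal.rpow_lt_top_of_nonneg hθ ENNReal.coe_ne_top)

theorem PicardBall.h1Norm_intervalIntegral_le (hp : p ∈ Set.Ioc (0 : ℝ) 2)
    (hC : ∀ f : L2, nr (rE p) f ≤ C * h1Norm f) (ha : BoundedWeight a)
    (hd : SmallData p a φ A M ε) (hz : PicardBall p η z) (hη : η ≤ 1) (t₁ t₂ : ℝ) :
    h1Norm (∫ s in t₁..t₂, freeProp (-s) (nl p a ha (freeProp s φ + z s))) ≤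
      2 * (cS p * (A * ((3 * ENNReal.ofReal (p + 2) + 1) * (cS p * M + 1)))) *
        (∫⁻ s in Set.uIoc t₁ t₂, nr (rE p) (freeProp s φ + z s) ^ qE p) ^ (p / qE p) := by
  have hγ := one_le_γE hp
  have hq := one_le_qE hp
  set μ : Measure ℝ := volume.restrict (Set.uIoc t₁ t₂)
  have hμ : μ ≤ volume := Measure.restrict_le_self
  have hF := hz.locallyIntegrable_nl hC ha hd hp hη
  set F : ℝ → L2 := fun s => nl p a ha (freeProp s φ + z s) with hFdef
  set X : ℝ≥0∞ := (∫⁻ s in Set.uIoc t₁ t₂, nr (rE p) (freeProp s φ + z s) ^ qE p) ^ (p / qE p)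
  have hX : xN p μ (fun t => freeProp t φ + z t) ^ p = X := by
    rw [xN, lpn, ← ENNReal.rpow_mul]
    congr 1; field_simp
  set Q : ℝ≥0∞ := (3 * ENNReal.ofReal (p + 2) + 1) * (cS p * M + 1) with hQ
  have l1 : lam p μ a (fun t => freeProp t φ + z t) ≤ A * X := by
    rw [← hX]
    exact (lam_le hp ha.measurable hz.continuous_add).trans (mul_le_mul_left hd.weight_le _)
  have l2 : ∀ h : Plane, ‖h‖ ≤ 1 →
      lam p μ (fun x => a (x + h) - a x) (fun t => freeProp t φ + z t) ≤ A * X * ‖h‖ₑ :=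
    fun h hh => by
    rw [← hX, mul_right_comm]
    exact (lam_le hp ((ha.measurable.comp (measurable_add_const h)).sub ha.measurable)
      hz.continuous_add).trans (mul_le_mul_left (hd.weight_diff_le h hh) _)
  have b1 : ‖∫ s in t₁..t₂, freeProp (-s) (F s)‖ₑ ≤ cS p * (A * Q) * X := by
    refine (enorm_intervalIntegral_freeProp_le hp hF t₁ t₂).trans ?_
    calc cS p * dN p μ F ≤ cS p * (A * X * (cS p * M + 1)) := by
          refine mul_le_mul_right ((dN_nl_le ha hp hz.continuous_add
            (hz.nr_add_ne_top hC hd hp hη)).trans (mul_le_mul' l1 ?_)) _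
          exact (lpn_mono_measure (by linarith) hμ _).trans (hz.sN_add_le hd hp hη)
      _ ≤ cS p * (A * X * Q) := by
          gcongr
          exact le_mul_of_one_le_left zero_le le_add_self
      _ = _ := by ring
  have b2 : ∀ h : Plane, ‖h‖ ≤ 1 → ‖translate h (∫ s in t₁..t₂, freeProp (-s) (F s)) -
      ∫ s in t₁..t₂, freeProp (-s) (F s)‖ₑ ≤ ‖h‖ₑ * (cS p * (A * Q) * X) := fun h hh => by
    have hτ := locallyIntegrable_translate hF h
    have e : translate h (∫ s in t₁..t₂, freeProp (-s) (F s)) -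
        ∫ s in t₁..t₂, freeProp (-s) (F s) =
        ∫ s in t₁..t₂, freeProp (-s) (translate h (F s) - F s) := by
      simp_rw [freeProp_sub]
      rw [intervalIntegral.integral_sub (intervalIntegrable_freeProp hτ continuous_neg t₁ t₂)
        (intervalIntegrable_freeProp hF continuous_neg t₁ t₂)]
      simp_rw [← translate_freeProp]
      congr 1
      exact ((translate h).toContinuousLinearMap.intervalIntegral_comp_comm
        (intervalIntegrable_freeProp hF continuous_neg t₁ t₂)).symm
    rw [e]
    refine (enorm_intervalIntegral_freeProp_le hp (hτ.sub hF) t₁ t₂).trans ?_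
    refine (mul_le_mul_right (hz.dN_translate_nl_sub_le hC ha hd hp hη hh hμ l1 (l2 h hh)) _).trans
      (le_of_eq ?_)
    ring
  refine (h1Norm_le_of_translate _ _ b1 b2).trans (le_of_eq ?_)
  ring

/-- Existence of a global scattering solution close to the free evolution. -/
theorem exists_solution (hp : p ∈ Set.Ioc (0 : ℝ) 2) (hC : ∀ f : L2, nr (rE p) f ≤ C * h1Norm f)
    (ha : BoundedWeight a) (hd : SmallData p a φ A M ε) (hs : SmallConst p C A M ε η) :
    ∃ u : ℝ → L2, IsGlobalSolution p a u ∧ u 0 = φ ∧ ScattersForward u ∧ ScattersBackward u ∧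
      Continuous u ∧ xN p volume (fun t => u t - freeProp t φ) ≤
        (C * 2) ^ (1 - γE p / qE p) *
          (2 * (cS p * (lam p volume a (fun t => freeProp t φ) * (cS p * M)))) ^ (γE p / qE p) := by
  have hη := hs.le_one
  have hq := one_le_qE hp
  have hp0 := hp.1
  obtain ⟨z, hz, hfix, hsz⟩ := exists_picard_solution hC ha hd hp hs
  have hF := hz.locallyIntegrable_nl hC ha hd hp hη
  set F : ℝ → L2 := fun s => nl p a ha (freeProp s φ + z s) with hFdef
  set G : ℝ → L2 := fun t => ∫ s in (0 : ℝ)..t, freeProp (-s) (F s) with hG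
  set f : ℝ → L2 := fun t => φ - Complex.I • G t with hf
  set u : ℝ → L2 := fun t => freeProp t φ + z t with hu
  have hzt : ∀ t, z t = (-Complex.I) • duhamel F t := fun t => (congrFun hfix t).symm
  have hz0 : z 0 = 0 := by rw [hzt, duhamel]; simp
  have hu0 : u 0 = φ := by simp [hu, hz0, freeProp_zero_left]
  have huf : ∀ t, u t = freeProp t (f t) := fun t => by
    simp only [hu, hf]
    rw [hzt, duhamel_eq hF, freeProp_sub, freeProp_smul, neg_smul, sub_eq_add_neg]
  set K : ℝ≥0∞ := 2 * (cS p * (A * ((3 * ENNReal.ofReal (p + 2) + 1) * (cS p * M + 1))))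
  have hK : K ≠ ⊤ := by
    have := cS_ne_top p
    finiteness
  have hinc : ∀ t₁ t₂, h1Norm (f t₂ - f t₁) ≤
      K * (∫⁻ s in Set.uIoc t₁ t₂, nr (rE p) (u s) ^ qE p) ^ (p / qE p) := fun t₁ t₂ => by
    have e : f t₂ - f t₁ = (-Complex.I) • ∫ s in t₁..t₂, freeProp (-s) (F s) := by
      rw [← intervalIntegral.integral_interval_sub_left
        (intervalIntegrable_freeProp hF continuous_neg 0 t₂)
        (intervalIntegrable_freeProp hF continuous_neg 0 t₁), smul_sub]
      simp only [hf, hG, neg_smul]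
      abel
    rw [e, h1Norm_smul, enorm_neg_I, one_mul]
    exact hz.h1Norm_intervalIntegral_le hp hC ha hd hη t₁ t₂
  have hg : ∫⁻ t, nr (rE p) (u t) ^ qE p ≠ ⊤ := by
    rw [← lpn_rpow (by linarith)]
    exact ENNReal.rpow_ne_top_of_nonneg (by linarith) (hz.xN_add_ne_top hp hC hd hη)
  have hmem : ∀ t, MemH1 (f t) := fun t => by
    have e : f t = φ + (f t - f 0) := by simp [hf, hG, sub_eq_add_neg]
    rw [MemH1, e]
    refine (h1Norm_add_le _ _).trans_lt (ENNReal.add_lt_top.2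
      ⟨hd.h1Norm_le.trans_lt ENNReal.coe_lt_top, (hinc 0 t).trans_lt ?_⟩)
    refine ENNReal.mul_lt_top hK.lt_top (ENNReal.rpow_lt_top_of_nonneg (by positivity) ?_)
    exact ((setLIntegral_le_lintegral _ _).trans_lt hg.lt_top).ne
  obtain ⟨c1, c2, c3⟩ := scatters_of_increments hg hK (by positivity : 0 < p / qE p) hmem hinc
  have hu' : (fun t => freeProp t (f t)) = u := funext fun t => (huf t).symm
  rw [hu'] at c2 c3
  refine ⟨u, ⟨fun t => ?_, fun t₀ => ?_, F, fun s => ?_, fun t => ⟨?_, ?_⟩⟩, hu0, c2, c3,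
    hz.continuous_add, ?_⟩
  · rw [huf, MemH1, h1Norm_freeProp]
    exact hmem t
  · simp_rw [huf]
    exact c1 t₀
  · filter_upwards [coeFn_nl ha hp (hz.nr_add_ne_top hC hd hp hη s)] with x hx
    rw [hFdef, hx, mul_assoc]
  · exact intervalIntegrable_freeProp hF (continuous_const.sub continuous_id) 0 t
  · rw [hu0]
    simp only [hu]
    rw [hzt, neg_smul, sub_eq_add_neg]
    rfl
  · have e : (fun t => u t - freeProp t φ) = z := by funext t; simp [hu]
    rw [e]
    refine (xN_le hp hz.continuous (hz.nr_le hC hη)).trans ?_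
    gcongr
    exact (γE_div_pos hp).le

end Scattering
section Weights

variable {a : Plane → ℝ} {K : ℝ≥0}

theorem setLIntegral_ball_comp_add_le (g : Plane → ℝ≥0∞) (x₀ : Plane) (R : ℝ) {v : Plane}
    (hv : ‖v‖ ≤ 1) :
    ∫⁻ x in Metric.ball x₀ R, g (x + v) ≤ ∫⁻ x in Metric.ball x₀ (R + 1), g x := by
  rw [← lintegral_indicator Metric.isOpen_ball.measurableSet,
    ← lintegral_indicator Metric.isOpen_ball.measurableSet,
    ← lintegral_add_right_eq_self (fun x => (Metric.ball x₀ (R + 1)).indicator g x) v]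
  refine lintegral_mono fun x => ?_
  by_cases hx : x ∈ Metric.ball x₀ R
  · have h2 : x + v ∈ Metric.ball x₀ (R + 1) := by
      rw [Metric.mem_ball, dist_eq_norm] at hx ⊢
      have : x + v - x₀ = (x - x₀) + v := by abel
      rw [this]
      linarith [norm_add_le (x - x₀) v]
    simp only [Set.indicator_of_mem hx, Set.indicator_of_mem h2, le_refl]
  · simp only [Set.indicator_of_notMem hx, zero_le]

theorem setLIntegral_ball_diff_le_nat_mul (ha : Continuous a) (x₀ : Plane) (R : ℝ) {h : Plane}
    (hh : ‖h‖ ≤ 1) {N : ℕ} (hN : 0 < N) :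
    ∫⁻ x in Metric.ball x₀ R, ‖a (x + h) - a x‖ₑ ≤
      N * ∫⁻ x in Metric.ball x₀ (R + 1), ‖a (x + (N : ℝ)⁻¹ • h) - a x‖ₑ := by
  have hN' : (0 : ℝ) < N := by exact_mod_cast hN
  set k : Plane := (N : ℝ)⁻¹ • h with hk
  set I := ∫⁻ x in Metric.ball x₀ (R + 1), ‖a (x + k) - a x‖ₑ
  have key : ∀ j : ℕ, j ≤ N → ∫⁻ x in Metric.ball x₀ R, ‖a (x + (j : ℝ) • k) - a x‖ₑ ≤ j * I := by
    intro j
    induction j with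
    | zero => intro _; simp
    | succ j ih =>
      intro hj
      have hv : ‖(j : ℝ) • k‖ ≤ 1 := by
        have hj' : (j : ℝ) ≤ N := by exact_mod_cast (Nat.le_of_succ_le hj)
        rw [hk, smul_smul, norm_smul, Real.norm_of_nonneg (by positivity)]
        have : (j : ℝ) * (N : ℝ)⁻¹ ≤ 1 := by
          rw [← div_eq_mul_inv, div_le_one hN']; exact hj'
        exact mul_le_one₀ this (norm_nonneg _) hh
      have h1 : ∀ x, ‖a (x + ((j + 1 : ℕ) : ℝ) • k) - a x‖ₑ ≤
          ‖a ((x + (j : ℝ) • k) + k) - a (x + (j : ℝ) • k)‖ₑ + ‖a (x + (j : ℝ) • k) - a x‖ₑ :=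
        fun x => by
        have e : x + ((j + 1 : ℕ) : ℝ) • k = (x + (j : ℝ) • k) + k := by
          push_cast; rw [add_smul, one_smul, add_assoc]
        rw [e]
        refine le_of_eq_of_le ?_ (enorm_add_le _ _)
        congr 1; abel
      refine (lintegral_mono h1).trans ?_
      rw [lintegral_add_right _ (by
        exact ((ha.comp (continuous_id.add continuous_const)).sub ha).measurable.enorm)]
      push_cast
      rw [add_mul, one_mul, add_comm]
      refine add_le_add (ih (Nat.le_of_succ_le hj)) ?_
      exact setLIntegral_ball_comp_add_le (fun y => ‖a (y + k) - a y‖ₑ) x₀ R hv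
  have := key N le_rfl
  rwa [hk, smul_smul, mul_inv_cancel₀ hN'.ne', one_smul] at this

/-- The `L¹` modulus of continuity of a Lipschitz function on a ball is controlled by the integral
of its gradient. -/
theorem setLIntegral_ball_diff_le (ha : LipschitzWith K a) (x₀ : Plane) (R : ℝ) {h : Plane}
    (hh : ‖h‖ ≤ 1) :
    ∫⁻ x in Metric.ball x₀ R, ‖a (x + h) - a x‖ₑ ≤
      (∫⁻ x in Metric.ball x₀ (R + 1), ‖gradient a x‖ₑ) * ‖h‖ₑ := by
  have hac := ha.continuous
  set B := Metric.ball x₀ (R + 1)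
  have e1 : ∀ (N : ℕ) x, (N : ℝ≥0∞) * ‖a (x + (N : ℝ)⁻¹ • h) - a x‖ₑ =
      ‖(N : ℝ) • (a (x + (N : ℝ)⁻¹ • h) - a x)‖ₑ := fun N x => by
    rw [enorm_smul, ← ofReal_norm (N : ℝ), Real.norm_natCast, ENNReal.ofReal_natCast]
  have hm : ∀ N : ℕ, Measurable fun x => ‖(N : ℝ) • (a (x + (N : ℝ)⁻¹ • h) - a x)‖ₑ := fun N => by
    have : Continuous fun x => (N : ℝ) • (a (x + (N : ℝ)⁻¹ • h) - a x) := by fun_prop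
    exact this.measurable.enorm
  have lim : Tendsto (fun N : ℕ => ∫⁻ x in B, ‖(N : ℝ) • (a (x + (N : ℝ)⁻¹ • h) - a x)‖ₑ) atTop
      (𝓝 (∫⁻ x in B, ‖fderiv ℝ a x h‖ₑ)) := by
    refine tendsto_lintegral_of_dominated_convergence (fun _ => K * ‖h‖ₑ) hm (fun N => ?_) ?_ ?_
    · refine ae_of_all _ fun x => ?_
      rcases Nat.eq_zero_or_pos N with rfl | hN
      · simp
      have hN' : (0 : ℝ) < N := by exact_mod_cast hN
      have h1 := ha.dist_le_mul (x + (N : ℝ)⁻¹ • h) x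
      rw [dist_eq_norm, dist_eq_norm, add_sub_cancel_left, norm_smul, norm_inv,
        Real.norm_of_nonneg hN'.le] at h1
      beta_reduce
      rw [← ofReal_norm ((N : ℝ) • _), norm_smul, Real.norm_of_nonneg hN'.le, ← ofReal_norm h,
        ← ENNReal.ofReal_coe_nnreal, ← ENNReal.ofReal_mul K.coe_nonneg]
      refine ENNReal.ofReal_le_ofReal ((mul_le_mul_of_nonneg_left h1 hN'.le).trans (le_of_eq ?_))
      field_simp
    · rw [lintegral_const, Measure.restrict_apply_univ]
      exact ENNReal.mul_ne_top (ENNReal.mul_ne_top ENNReal.coe_ne_top enorm_ne_top)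
        measure_ball_lt_top.ne
    · filter_upwards [ae_restrict_of_ae (ha.ae_differentiableAt (μ := volume))] with x hx
      exact ((hx.hasFDerivAt.lim_real h).comp tendsto_natCast_atTop_atTop).enorm
  refine le_trans (ge_of_tendsto lim ?_) ?_
  · filter_upwards [eventually_gt_atTop 0] with N hN
    refine (setLIntegral_ball_diff_le_nat_mul hac x₀ R hh hN).trans (le_of_eq ?_)
    rw [← lintegral_const_mul' _ _ (ENNReal.natCast_ne_top N)]
    simp_rw [e1]
    rfl
  · rw [← lintegral_mul_const' _ _ enorm_ne_top]
    refine lintegral_mono fun x => ?_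
    have h1 : ‖fderiv ℝ a x‖ₑ = ‖gradient a x‖ₑ := by
      rw [gradient, ← ofReal_norm, ← ofReal_norm, LinearIsometryEquiv.norm_map]
    rw [← h1]
    exact ContinuousLinearMap.le_opENorm _ _

theorem lpn_le_of_le_const {X : Type*} [MeasurableSpace X] {μ : Measure X} {m : ℝ} (hm : 1 ≤ m)
    {f : X → ℝ≥0∞} {c : ℝ≥0∞} (hc : c ≠ ⊤) (hf : ∀ x, f x ≤ c) :
    lpn m μ f ≤ (c ^ (m - 1) * ∫⁻ x, f x ∂μ) ^ (1 / m) := by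
  refine ENNReal.rpow_le_rpow ?_ (by positivity)
  rw [← lintegral_const_mul' _ _ (ENNReal.rpow_ne_top_of_nonneg (by linarith) hc)]
  refine lintegral_mono fun x => ?_
  calc f x ^ m = f x ^ (m - 1) * f x := by
        nth_rewrite 3 [← ENNReal.rpow_one (f x)]
        rw [← ENNReal.rpow_add_of_nonneg _ _ (by linarith) zero_le_one, sub_add_cancel]
    _ ≤ _ := by
        gcongr
        exact hf x

theorem lpn_ball_diff_le {m : ℝ} (hm : 1 ≤ m) (ha : LipschitzWith K a) (x₀ : Plane) (R : ℝ)
    {h : Plane} (hh : ‖h‖ ≤ 1) :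
    lpn m (volume.restrict (Metric.ball x₀ R)) (fun x => ‖a (x + h) - a x‖ₑ) ≤
      ((K : ℝ≥0∞) ^ (m - 1) * ∫⁻ x in Metric.ball x₀ (R + 1), ‖gradient a x‖ₑ) ^ (1 / m) *
        ‖h‖ₑ := by
  have hb : ∀ x, ‖a (x + h) - a x‖ₑ ≤ K * ‖h‖ₑ := fun x => by
    have := ha (x + h) x
    rwa [edist_eq_enorm_sub, edist_eq_enorm_sub, add_sub_cancel_left] at this
  refine (lpn_le_of_le_const hm (by finiteness) hb).trans ?_
  refine (ENNReal.rpow_le_rpow (mul_le_mul_right (setLIntegral_ball_diff_le ha x₀ R hh) _)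
    (by positivity)).trans (le_of_eq ?_)
  set I := ∫⁻ x in Metric.ball x₀ (R + 1), ‖gradient a x‖ₑ
  have e : ‖h‖ₑ = (‖h‖ₑ ^ (m - 1) * ‖h‖ₑ) ^ (1 / m) := by
    nth_rewrite 3 [← ENNReal.rpow_one ‖h‖ₑ]
    rw [← ENNReal.rpow_add_of_nonneg _ _ (by linarith) zero_le_one, sub_add_cancel,
      ← ENNReal.rpow_mul, mul_one_div_cancel (by linarith), ENNReal.rpow_one]
  nth_rewrite 3 [e]
  rw [← ENNReal.mul_rpow_of_nonneg _ _ (by positivity),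
    ENNReal.mul_rpow_of_nonneg _ _ (by linarith : 0 ≤ m - 1)]
  congr 1
  ring

theorem lpn_diff_le {m : ℝ} (hm : 1 ≤ m) (ha : LipschitzWith K a) {h : Plane} (hh : ‖h‖ ≤ 1) :
    lpn m volume (fun x => ‖a (x + h) - a x‖ₑ) ≤
      ((K : ℝ≥0∞) ^ (m - 1) * ∫⁻ x, ‖gradient a x‖ₑ) ^ (1 / m) * ‖h‖ₑ := by
  have hmeas : Measurable fun x => ‖a (x + h) - a x‖ₑ ^ m :=
    ((ha.continuous.comp (continuous_id.add continuous_const)).sub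
      ha.continuous).measurable.enorm.pow_const _
  have hcov : AECover (volume : Measure Plane) atTop fun n : ℕ => Metric.ball (0 : Plane) n :=
    aecover_ball tendsto_natCast_atTop_atTop
  have h1 := hcov.lintegral_tendsto_of_nat hmeas.aemeasurable
  have h2 := (ENNReal.continuous_rpow_const (y := 1 / m)).tendsto _ |>.comp h1
  refine le_of_tendsto h2 (Eventually.of_forall fun n => ?_)
  refine (lpn_ball_diff_le hm ha 0 n hh).trans ?_
  refine mul_le_mul_left (ENNReal.rpow_le_rpow (mul_le_mul_right ?_ _) (by positivity)) _
  exact setLIntegral_le_lintegral _ _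

theorem tendsto_setLIntegral_ball {g : Plane → ℝ≥0∞} (hg : ∫⁻ x, g x ≠ ⊤) {x : ℕ → Plane}
    (hx : Tendsto (fun n => ‖x n‖) atTop atTop) (R : ℝ) :
    Tendsto (fun n => ∫⁻ y in Metric.ball (x n) R, g y) atTop (𝓝 0) := by
  rw [ENNReal.tendsto_nhds_zero]
  intro ε hε
  obtain ⟨N, hN⟩ := exists_setLIntegral_lt hg (S := fun n : ℕ => {y : Plane | (n : ℝ) < ‖y‖})
    (fun n => measurableSet_lt measurable_const measurable_norm)
    (fun m n hmn y hy => show (m : ℝ) < ‖y‖ from lt_of_le_of_lt (Nat.cast_le.2 hmn) hy)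
    (by
      refine Set.eq_empty_of_forall_notMem fun y hy => ?_
      obtain ⟨n, hn⟩ := exists_nat_ge ‖y‖
      exact absurd (Set.mem_iInter.1 hy n) (not_lt.2 hn)) hε
  filter_upwards [hx.eventually_ge_atTop (N + R)] with n hn
  refine le_trans (lintegral_mono_set fun y hy => ?_) hN.le
  rw [Metric.mem_ball, dist_eq_norm] at hy
  have := norm_sub_norm_le (x n) y
  rw [norm_sub_rev] at this
  show (N : ℝ) < ‖y‖
  linarith

end Weights
section Approximation

variable {p : ℝ}

theorem lpn_indicator {X : Type*} [MeasurableSpace X] {μ : Measure X} {e : ℝ} (he : 0 < e)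
    {S : Set X} (hS : MeasurableSet S) (f : X → ℝ≥0∞) :
    lpn e μ (S.indicator f) = lpn e (μ.restrict S) f := by
  unfold lpn
  rw [← lintegral_indicator hS]
  congr 1
  refine lintegral_congr fun x => ?_
  by_cases hx : x ∈ S
  · simp [hx]
  · simp [hx, he]

theorem wt_le_of_le_off (hp : p ∈ Set.Ioc (0 : ℝ) 2) {b : Plane → ℝ} (hb : Measurable b) (f : L2)
    {S : Set Plane} (hS : MeasurableSet S) {G : Plane → ℝ≥0∞} (hG : AEMeasurable G volume)
    (hfG : ∀ x, x ∉ S → ‖f x‖ₑ ≤ G x) :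
    wt p b f ≤ lpn (mE p) (volume.restrict S) (fun x => ‖b x‖ₑ) * nr (rE p) f ^ p +
      lpn (mE p) volume (fun x => ‖b x‖ₑ) * lpn (rE p) volume G ^ p := by
  have h8 := eight_le_rE hp
  have hσ := one_le_σE hp
  have hm := one_le_mE hp
  have hp0 := hp.1
  have mb : AEMeasurable (fun x => ‖b x‖ₑ) volume := hb.enorm.aemeasurable
  have mi : AEMeasurable (S.indicator fun x => ‖b x‖ₑ) volume := mb.indicator hS
  have mf : AEMeasurable (fun x => ‖f x‖ₑ ^ p) volume := (aemeasurable_enorm_L2 f).pow_const _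
  rw [nr_eq_lpn (by linarith), ← lpn_rpow_fun hp0, ← lpn_rpow_fun hp0,
    ← lpn_indicator (by linarith) hS]
  have hh : ∀ {g k : Plane → ℝ≥0∞}, AEMeasurable g volume → AEMeasurable k volume →
      lpn (σE p) volume (fun x => g x * k x) ≤ lpn (mE p) volume g * lpn (rE p / p) volume k :=
    fun hg hk => lpn_mul_le (by linarith) (by positivity) (by linarith) (one_div_σE hp) hg hk
  refine le_trans ?_ (add_le_add (hh mi mf) (hh mb (hG.pow_const p)))
  refine le_trans (lpn_mono (by linarith) fun x => ?_)
    (lpn_add_le hσ (mi.mul mf) (mb.mul (hG.pow_const p)))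
  by_cases hx : x ∈ S
  · simp only [Set.indicator_of_mem hx]
    exact le_self_add
  · simp only [Set.indicator_of_notMem hx, zero_mul, zero_add]
    gcongr
    exact hfG x hx

theorem freeProp_translate_freeProp (s t : ℝ) (x : Plane) (φ : L2) :
    freeProp s (translate (-x) (freeProp t φ)) = translate (-x) (freeProp (s + t) φ) := by
  rw [← translate_freeProp, freeProp_add_left]

theorem wt_translate_neg (b : Plane → ℝ) (x : Plane) (f : L2) :
    wt p b (translate (-x) f) = wt p (fun y => b (y + x)) f := by
  have := wt_translate (p := p) (fun y => b (y + x)) (-x) f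
  simpa using this

theorem lpn_restrict_ball_comp_add {e : ℝ} (he : 0 < e) (g : Plane → ℝ≥0∞) (x : Plane) (R : ℝ) :
    lpn e (volume.restrict (Metric.ball 0 R)) (fun y => g (y + x)) =
      lpn e (volume.restrict (Metric.ball x R)) g := by
  rw [← lpn_indicator he Metric.isOpen_ball.measurableSet,
    ← lpn_indicator he Metric.isOpen_ball.measurableSet, ← lpn_comp_add_right e ((Metric.ball x R).indicator g) x]
  congr 1
  funext y
  simp only [Set.indicator, Metric.mem_ball, dist_eq_norm, sub_zero, add_sub_cancel_right]

theorem lpn_comp_add_right_real (e : ℝ) (g : ℝ → ℝ≥0∞) (t : ℝ) :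
    lpn e volume (fun s => g (s + t)) = lpn e volume g := by
  unfold lpn
  rw [lintegral_add_right_eq_self (fun s => g s ^ e)]

/-- The potential along the free evolution from translated data, in terms of an approximation of
the untranslated evolution by a compactly supported function. -/
theorem lam_freeProp_translate_le (hp : p ∈ Set.Ioc (0 : ℝ) 2) {b : Plane → ℝ} (hb : Measurable b)
    (φ : L2) (t : ℝ) (x : Plane) {ψ : ℝ × Plane → ℂ} (hψ : Continuous ψ) {R : ℝ}
    (hR : ∀ s y, y ∉ Metric.ball (0 : Plane) R → ψ (s, y) = 0)
    (hm : AEMeasurable (fun s => eLpNorm (fun y => freeProp s φ y - ψ (s, y))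
      (ENNReal.ofReal (rE p)) volume) volume) :
    lam p volume b (fun s => freeProp s (translate (-x) (freeProp t φ))) ≤
      lpn (mE p) (volume.restrict (Metric.ball x R)) (fun y => ‖b y‖ₑ) *
          xN p volume (fun s => freeProp s φ) ^ p +
        lpn (mE p) volume (fun y => ‖b y‖ₑ) * lpn (qE p) volume (fun s =>
          eLpNorm (fun y => freeProp s φ y - ψ (s, y)) (ENNReal.ofReal (rE p)) volume) ^ p := by
  have h8 := eight_le_rE hp
  have hq := one_le_qE_div hp
  have hm1 := one_le_mE hp
  set e : ℝ → ℝ≥0∞ := fun s =>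
    eLpNorm (fun y => freeProp s φ y - ψ (s, y)) (ENNReal.ofReal (rE p)) volume with he
  set c₁ := lpn (mE p) (volume.restrict (Metric.ball x R)) (fun y => ‖b y‖ₑ)
  set c₂ := lpn (mE p) volume (fun y => ‖b y‖ₑ)
  have hpt : ∀ s, wt p b (freeProp s (translate (-x) (freeProp t φ))) ≤
      (fun s => c₁ * nr (rE p) (freeProp s φ) ^ p + c₂ * e s ^ p) (s + t) := fun s => by
    rw [freeProp_translate_freeProp, wt_translate_neg]
    have hbx : Measurable fun y => b (y + x) := hb.comp (measurable_add_const x)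
    have hG : AEMeasurable (fun y => ‖freeProp (s + t) φ y - ψ (s + t, y)‖ₑ) volume :=
      ((Lp.aestronglyMeasurable _).sub
        (hψ.comp (Continuous.prodMk_right (s + t))).aestronglyMeasurable).enorm
    have h1 := wt_le_of_le_off hp hbx (freeProp (s + t) φ)
      (Metric.isOpen_ball (x := (0 : Plane)) (ε := R)).measurableSet hG fun y hy => by
        rw [hR _ _ hy, sub_zero]
    rw [lpn_restrict_ball_comp_add (by linarith) (fun y => ‖b y‖ₑ),
      lpn_comp_add_right _ (fun y => ‖b y‖ₑ),
      ← eLpNorm_ofReal_eq_lpn (by linarith)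
        (fun y => freeProp (s + t) φ y - ψ (s + t, y))] at h1
    exact h1
  have m1 : AEMeasurable (fun s => nr (rE p) (freeProp s φ) ^ p) volume :=
    (aemeasurable_nr (continuous_freeProp_left φ).aestronglyMeasurable).pow_const _
  have m2 : AEMeasurable (fun s => e s ^ p) volume := hm.pow_const _
  refine (lpn_mono (by linarith) hpt).trans ?_
  refine (lpn_comp_add_right_real _
    (fun s => c₁ * nr (rE p) (freeProp s φ) ^ p + c₂ * e s ^ p) t).le.trans ?_
  refine (lpn_add_le hq (m1.const_mul _) (m2.const_mul _)).trans ?_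
  rw [lpn_const_mul (by linarith) _ _ m1, lpn_const_mul (by linarith) _ _ m2, lpn_rpow_fun hp.1,
    lpn_rpow_fun hp.1]
  rfl

section Density

variable {r q : ℝ≥0∞} [Fact (1 ≤ r)]

/-- A curve in `L^r` that is given by a smooth compactly supported function. -/
def IsTestCurve (g : ℝ → Lp ℂ r (volume : Measure Plane)) : Prop :=
  Continuous g ∧ ∃ ψ : ℝ × Plane → ℂ, ContDiff ℝ (⊤ : ℕ∞) ψ ∧ HasCompactSupport ψ ∧
    ∀ t, g t =ᵐ[volume] fun y => ψ (t, y)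

theorem IsTestCurve.add {g g' : ℝ → Lp ℂ r (volume : Measure Plane)} (hg : IsTestCurve g)
    (hg' : IsTestCurve g') : IsTestCurve (g + g') := by
  obtain ⟨c, ψ, h1, h2, h3⟩ := hg
  obtain ⟨c', ψ', h1', h2', h3'⟩ := hg'
  refine ⟨c.add c', ψ + ψ', h1.add h1', h2.add h2', fun t => ?_⟩
  filter_upwards [Lp.coeFn_add (g t) (g' t), h3 t, h3' t] with y e1 e2 e3
  rw [Pi.add_apply, e1, Pi.add_apply, e2, e3, Pi.add_apply]

theorem exists_isTestCurve_indicator (hr : r ≠ ⊤) (hq : q ≠ ⊤) (hq1 : 1 ≤ q)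
    (c : Lp ℂ r (volume : Measure Plane)) {s : Set ℝ} (hs : MeasurableSet s) (hsv : volume s < ⊤)
    {ε : ℝ≥0∞} (hε : ε ≠ 0) :
    ∃ g : ℝ → Lp ℂ r (volume : Measure Plane), eLpNorm (g - s.indicator fun _ => c) q volume ≤ ε ∧
      IsTestCurve g := by
  obtain ⟨κ, hκ0, hκ⟩ := ENNReal.lt_iff_exists_nnreal_btwn.1 (pos_iff_ne_zero.2 hε)
  have hκ0' : (0 : ℝ) < κ := by exact_mod_cast hκ0
  have hs1 : MemLp (s.indicator fun _ => (1 : ℂ)) q volume :=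
    memLp_indicator_const q hs 1 (Or.inr hsv.ne)
  set V := (eLpNorm (s.indicator fun _ => (1 : ℂ)) q volume).toReal with hV
  have hV0 : 0 ≤ V := ENNReal.toReal_nonneg
  obtain ⟨f, hf1, hf2, hf3⟩ := MemLp.exist_eLpNorm_sub_le hr Fact.out (Lp.memLp c)
    (by positivity : 0 < κ / 2 / (V + 1))
  have hf4 : MemLp f r volume := hf2.continuous.memLp_of_hasCompactSupport hf1
  set F : Lp ℂ r (volume : Measure Plane) := hf4.toLp f with hF
  obtain ⟨χ, hχ1, hχ2, hχ3⟩ := MemLp.exist_eLpNorm_sub_le hq hq1 hs1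
    (by positivity : 0 < κ / 2 / (‖F‖ + 1))
  have hcF : ‖F - c‖ ≤ κ / 2 / (V + 1) := by
    rw [norm_sub_rev, Lp.norm_def]
    refine ENNReal.toReal_le_of_le_ofReal (by positivity) (le_of_eq_of_le (eLpNorm_congr_ae ?_) hf3)
    filter_upwards [Lp.coeFn_sub c F, hf4.coeFn_toLp] with y e1 e2
    rw [e1, Pi.sub_apply, Pi.sub_apply, hF, e2]
  have hgc : Continuous fun t => χ t • F := hχ2.continuous.smul continuous_const
  refine ⟨fun t => χ t • F, ?_, hgc, fun x => χ x.1 * f x.2, ?_, ?_, fun t => ?_⟩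
  · have e : (fun t => χ t • F) - s.indicator (fun _ => c) =
        (fun t => (χ t - s.indicator (fun _ => (1 : ℂ)) t) • F) +
          fun t => s.indicator (fun _ => (1 : ℂ)) t • (F - c) := by
      funext t
      simp only [Pi.sub_apply, Pi.add_apply]
      by_cases ht : t ∈ s <;> simp [ht, sub_smul]
    have m1 : AEStronglyMeasurable (fun t => χ t - s.indicator (fun _ => (1 : ℂ)) t) volume :=
      hχ2.continuous.aestronglyMeasurable.sub hs1.1
    rw [e]
    refine (eLpNorm_add_le (m1.smul_const F) (hs1.1.smul_const _) hq1).trans ?_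
    have b1 : eLpNorm (fun t => (χ t - s.indicator (fun _ => (1 : ℂ)) t) • F) q volume ≤
        ENNReal.ofReal ‖F‖ * eLpNorm (s.indicator (fun _ => (1 : ℂ)) - χ) q volume := by
      refine eLpNorm_le_mul_eLpNorm_of_ae_le_mul (ae_of_all _ fun t => ?_) _
      rw [norm_smul, mul_comm, Pi.sub_apply, norm_sub_rev]
    have b2 : eLpNorm (fun t => s.indicator (fun _ => (1 : ℂ)) t • (F - c)) q volume ≤
        ENNReal.ofReal ‖F - c‖ * eLpNorm (s.indicator (fun _ => (1 : ℂ))) q volume := by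
      refine eLpNorm_le_mul_eLpNorm_of_ae_le_mul (ae_of_all _ fun t => ?_) _
      rw [norm_smul, mul_comm]
    have b1' : ENNReal.ofReal ‖F‖ * eLpNorm (s.indicator (fun _ => (1 : ℂ)) - χ) q volume ≤
        ENNReal.ofReal (κ / 2) := by
      refine (mul_le_mul_right hχ3 _).trans ?_
      rw [← ENNReal.ofReal_mul (norm_nonneg _)]
      refine ENNReal.ofReal_le_ofReal ?_
      rw [mul_div_assoc', div_le_iff₀ (by positivity)]
      nlinarith [norm_nonneg F]
    have b2' : ENNReal.ofReal ‖F - c‖ * eLpNorm (s.indicator (fun _ => (1 : ℂ))) q volume ≤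
        ENNReal.ofReal (κ / 2) := by
      rw [← ENNReal.ofReal_toReal hs1.2.ne, ← ENNReal.ofReal_mul (norm_nonneg _), ← hV]
      refine ENNReal.ofReal_le_ofReal ((mul_le_mul_of_nonneg_right hcF hV0).trans ?_)
      rw [div_mul_eq_mul_div, div_le_iff₀ (by positivity)]
      nlinarith
    refine (add_le_add (b1.trans b1') (b2.trans b2')).trans (le_trans (le_of_eq ?_) hκ.le)
    rw [← ENNReal.ofReal_add (by positivity) (by positivity), add_halves,
      ENNReal.ofReal_coe_nnreal]
  · exact (hχ2.comp contDiff_fst).mul (hf2.comp contDiff_snd)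
  · refine HasCompactSupport.intro (hχ1.isCompact.prod hf1.isCompact) fun x hx => ?_
    rw [Set.mem_prod, not_and_or] at hx
    rcases hx with hx | hx
    · rw [image_eq_zero_of_notMem_tsupport hx, zero_mul]
    · rw [image_eq_zero_of_notMem_tsupport hx, mul_zero]
  · filter_upwards [Lp.coeFn_smul (χ t) F, hf4.coeFn_toLp] with y e1 e2
    rw [e1, Pi.smul_apply, hF, e2, smul_eq_mul]

theorem exists_isTestCurve (hr : r ≠ ⊤) (hq : q ≠ ⊤) (hq1 : 1 ≤ q)
    {f : ℝ → Lp ℂ r (volume : Measure Plane)} (hf : MemLp f q volume) {ε : ℝ≥0∞} (hε : ε ≠ 0) :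
    ∃ g : ℝ → Lp ℂ r (volume : Measure Plane), eLpNorm (f - g) q volume ≤ ε ∧ IsTestCurve g :=
  hf.induction_dense hq IsTestCurve
    (fun c _ hs hsv _ hε => exists_isTestCurve_indicator hr hq hq1 c hs hsv hε)
    (fun _ _ h h' => h.add h') (fun _ h => h.1.aestronglyMeasurable) hε

end Density

/-- Approximation of a free `H¹` evolution in the scattering norm by test functions. -/
theorem exists_test_approx (hp : p ∈ Set.Ioc (0 : ℝ) 2) {φ : L2} (hφ : MemH1 φ) {ε : ℝ≥0∞}
    (hε : ε ≠ 0) :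
    ∃ ψ : ℝ × Plane → ℂ, ContDiff ℝ (⊤ : ℕ∞) ψ ∧ HasCompactSupport ψ ∧
      AEMeasurable (fun s => eLpNorm (fun y => freeProp s φ y - ψ (s, y))
        (ENNReal.ofReal (rE p)) volume) volume ∧
      lpn (qE p) volume (fun s => eLpNorm (fun y => freeProp s φ y - ψ (s, y))
        (ENNReal.ofReal (rE p)) volume) ≤ ε := by
  obtain ⟨C, hC⟩ := exists_nr_le_h1Norm hp
  have h8 := eight_le_rE hp
  have hq := one_le_qE hp
  have hθ := (γE_div_pos hp).le
  have hθ' := (one_sub_γE_div_pos hp).le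
  have hnr : ∀ t, nr (rE p) (freeProp t φ) < ⊤ := fun t => (hC _).trans_lt (by
    rw [h1Norm_freeProp]
    exact ENNReal.mul_lt_top ENNReal.coe_lt_top hφ)
  have : Fact (1 ≤ ENNReal.ofReal (rE p)) := ⟨by
    rw [← ENNReal.ofReal_one]; exact ENNReal.ofReal_le_ofReal (by linarith)⟩
  have hmem : ∀ t, MemLp (freeProp t φ) (ENNReal.ofReal (rE p)) volume := fun t =>
    ⟨Lp.aestronglyMeasurable _, hnr t⟩
  set w : ℝ → Lp ℂ (ENNReal.ofReal (rE p)) (volume : Measure Plane) := fun t => (hmem t).toLp _ with hw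
  have hwn : ∀ t, ‖w t‖ₑ = nr (rE p) (freeProp t φ) := fun t => Lp.enorm_toLp (hmem t)
  have hwc : Continuous w := by
    rw [continuous_iff_continuousAt]
    intro t₀
    rw [ContinuousAt, tendsto_iff_edist_tendsto_0]
    have h1 := ENNReal.Tendsto.const_mul (tendsto_h1Norm_freeProp_sub φ hφ t₀)
      (Or.inr (ENNReal.coe_ne_top (r := C)))
    rw [mul_zero] at h1
    refine tendsto_of_tendsto_of_tendsto_of_le_of_le tendsto_const_nhds h1 (fun _ => zero_le)
      fun t => ?_
    refine le_of_eq_of_le ?_ (hC _)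
    rw [hw, Lp.edist_toLp_toLp, nr]
    exact eLpNorm_congr_ae (Lp.coeFn_sub _ _).symm
  have hwm : MemLp w (ENNReal.ofReal (qE p)) volume := by
    refine ⟨hwc.aestronglyMeasurable, ?_⟩
    rw [eLpNorm_ofReal_eq_lpn (by linarith)]
    simp_rw [hwn]
    refine (xN_freeProp_le hp hC φ).trans_lt (ENNReal.mul_lt_top ?_ ?_)
    · exact ENNReal.rpow_lt_top_of_nonneg hθ' (ENNReal.mul_ne_top ENNReal.coe_ne_top hφ.ne)
    · exact ENNReal.rpow_lt_top_of_nonneg hθ (ENNReal.mul_ne_top (cS_ne_top p) hφ.ne)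
  obtain ⟨g, hg, hgc, ψ, h1, h2, h3⟩ := exists_isTestCurve ENNReal.ofReal_ne_top
    ENNReal.ofReal_ne_top (by rw [← ENNReal.ofReal_one]; exact ENNReal.ofReal_le_ofReal hq) hwm hε
  have e : ∀ s, eLpNorm (fun y => freeProp s φ y - ψ (s, y)) (ENNReal.ofReal (rE p)) volume =
      ‖w s - g s‖ₑ := fun s => by
    rw [Lp.enorm_def]
    refine eLpNorm_congr_ae ?_
    filter_upwards [Lp.coeFn_sub (w s) (g s), (hmem s).coeFn_toLp, h3 s] with y e1 e2 e3
    rw [e1, Pi.sub_apply, e3, hw, e2]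
  refine ⟨ψ, h1, h2, ?_, ?_⟩
  · simp_rw [e]
    exact (hwc.sub hgc).aestronglyMeasurable.enorm
  · simp_rw [e]
    rwa [eLpNorm_ofReal_eq_lpn (by linarith)] at hg

end Approximation
section FarAway

variable {p : ℝ}

theorem exists_pos_mul_le {D δ : ℝ≥0∞} (hD : D ≠ ⊤) (hδ : 0 < δ) :
    ∃ ε : ℝ≥0, 0 < ε ∧ D * ε ≤ δ := by
  have h1 : Tendsto (fun x : ℝ≥0∞ => D * x) (𝓝 0) (𝓝 0) := by
    have := ENNReal.Tendsto.const_mul (tendsto_id (x := 𝓝 (0 : ℝ≥0∞))) (Or.inr hD)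
    rwa [mul_zero] at this
  obtain ⟨η, hη, hη'⟩ := (ENNReal.nhds_zero_basis.eventually_iff).1
    (h1.eventually (ge_mem_nhds hδ))
  obtain ⟨ε, h0, hε⟩ := ENNReal.lt_iff_exists_nnreal_btwn.1 hη
  exact ⟨ε, by exact_mod_cast h0, hη' hε⟩

theorem tendsto_const_mul_rpow {ι : Type*} {l : Filter ι} {f : ι → ℝ≥0∞} {c : ℝ≥0∞} (hc : c ≠ ⊤)
    {e : ℝ} (he : 0 < e) (hf : Tendsto f l (𝓝 0)) :
    Tendsto (fun i => c * f i ^ e) l (𝓝 0) := by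
  have h1 := ((ENNReal.continuous_rpow_const (y := e)).tendsto 0).comp hf
  rw [ENNReal.zero_rpow_of_pos he] at h1
  have := ENNReal.Tendsto.const_mul h1 (Or.inr hc)
  rwa [mul_zero] at this

theorem exists_smallConst (hp : p ∈ Set.Ioc (0 : ℝ) 2) (C A M : ℝ≥0) :
    ∃ ε η : ℝ≥0, 0 < ε ∧ SmallConst p C A M ε η := by
  have hS := cS_ne_top p
  have hθ := γE_div_pos hp
  have hθ' := one_sub_γE_div_pos hp
  have hp0 := hp.1
  set P := ENNReal.ofReal (p + 2)
  set Q : ℝ≥0∞ := (3 * P + 1) * (cS p * M + 1)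
  have hQ : Q ≠ ⊤ := by finiteness
  have h2p : (2 : ℝ≥0∞) ^ p ≠ ⊤ := ENNReal.rpow_ne_top_of_nonneg hp0.le (by norm_num)
  obtain ⟨κ, hκ0, hκ⟩ := exists_pos_mul_le (D := cS p * (P * 2) + cS p * Q) (δ := 1 / 2)
    (by finiteness) (by simp)
  have hκ2 : (0 : ℝ≥0∞) < (κ : ℝ≥0∞) / 2 := ENNReal.half_pos (by exact_mod_cast hκ0.ne')
  have hlim : Tendsto (fun x : ℝ≥0∞ => 2 ^ p * (A * (((C : ℝ≥0∞) * 2) ^ (1 - γE p / qE p) *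
      x ^ (γE p / qE p)) ^ p)) (𝓝 0) (𝓝 0) := by
    have h1 := tendsto_const_mul_rpow (c := ((C : ℝ≥0∞) * 2) ^ (1 - γE p / qE p))
      (ENNReal.rpow_ne_top_of_nonneg hθ'.le (by finiteness)) hθ (tendsto_id (x := 𝓝 (0 : ℝ≥0∞)))
    have h2 := tendsto_const_mul_rpow (ENNReal.coe_ne_top (r := A)) hp0 h1
    have h3 := ENNReal.Tendsto.const_mul h2 (Or.inr h2p)
    rwa [mul_zero] at h3
  obtain ⟨d, hd, hd'⟩ := (ENNReal.nhds_zero_basis.eventually_iff).1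
    (hlim.eventually (ge_mem_nhds hκ2))
  obtain ⟨η, hη0, hη⟩ := ENNReal.lt_iff_exists_nnreal_btwn.1 (lt_min hd one_pos)
  have hη0' : (0 : ℝ≥0∞) < 1 / 2 * η := ENNReal.mul_pos (by simp) hη0.ne'
  obtain ⟨ε, hε0, hε⟩ := exists_pos_mul_le (D := 2 ^ p + cS p * (cS p * M))
    (δ := min ((κ : ℝ≥0∞) / 2) (1 / 2 * η)) (by finiteness) (lt_min hκ2 hη0')
  have hk : kap p C A ε η ≤ κ := by
    rw [kap, mul_add, ← ENNReal.add_halves (κ : ℝ≥0∞)]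
    refine add_le_add ?_ (hd' (hη.trans_le (min_le_left _ _)))
    refine le_trans ?_ (hε.trans (min_le_left _ _))
    gcongr
    exact le_self_add
  refine ⟨ε, η, hε0, ?_, ?_, ?_, ?_⟩
  · exact_mod_cast (hη.trans_le (min_le_right _ _)).le
  · refine le_trans ?_ hκ
    calc cS p * (P * (2 * kap p C A ε η)) = cS p * (P * 2) * kap p C A ε η := by ring
      _ ≤ (cS p * (P * 2) + cS p * Q) * κ := by
        gcongr
        exact le_self_add
  · refine le_trans ?_ (hε.trans (min_le_right _ _))
    calc cS p * (ε * (cS p * M)) = cS p * (cS p * M) * ε := by ring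
      _ ≤ _ := by
        gcongr
        exact le_add_self
  · refine le_trans ?_ (hκ.trans (by norm_num))
    calc cS p * (kap p C A ε η * Q) = cS p * Q * kap p C A ε η := by ring
      _ ≤ _ := by
        gcongr
        exact le_add_self

theorem xNorm_eq_lpn (hp : p ∈ Set.Ioc (0 : ℝ) 2) (u : ℝ → Plane → ℂ) :
    xNorm p u = lpn (qE p) volume fun t => eLpNorm (u t) (ENNReal.ofReal (rE p)) volume := by
  have hq := one_le_qE hp
  have h1 : qExp p = qE p := if_pos hp.2
  have h2 : rExp p = rE p := if_pos hp.2
  rw [xNorm, h1, h2, eLpNorm_ofReal_eq_lpn (by linarith)]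
  simp only [enorm_eq_self]

variable {a : Plane → ℝ}

theorem Admissible.boundedWeight (ha : Admissible p a) : BoundedWeight a where
  measurable := ha.lipschitz.choose_spec.continuous.measurable
  bounded := by
    obtain ⟨B, hB⟩ := ha.bounded
    exact ⟨B, fun x => by rw [Real.norm_of_nonneg (ha.nonneg x)]; exact hB x⟩

/-- On balls that escape to infinity the `L^m` norms of the weight and of its difference quotients
tend to zero; on the whole plane they are bounded. -/
theorem Admissible.exists_weight_bounds (ha : Admissible p a) (hp : p ∈ Set.Ioc (0 : ℝ) 2) :
    (∃ A : ℝ≥0, lpn (mE p) volume (fun x => ‖a x‖ₑ) ≤ A ∧ ∀ h : Plane, ‖h‖ ≤ 1 →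
      lpn (mE p) volume (fun x => ‖a (x + h) - a x‖ₑ) ≤ A * ‖h‖ₑ) ∧
    ∀ x : ℕ → Plane, Tendsto (fun n => ‖x n‖) atTop atTop → ∀ R : ℝ, ∃ c : ℕ → ℝ≥0∞,
      Tendsto c atTop (𝓝 0) ∧ ∀ n,
        lpn (mE p) (volume.restrict (Metric.ball (x n) R)) (fun y => ‖a y‖ₑ) ≤ c n ∧
        ∀ h : Plane, ‖h‖ ≤ 1 → lpn (mE p) (volume.restrict (Metric.ball (x n) R))
          (fun y => ‖a (y + h) - a y‖ₑ) ≤ c n * ‖h‖ₑ := by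
  have hm := one_le_mE hp
  have hm' : 0 < 1 / mE p := by positivity
  obtain ⟨K, hK⟩ := ha.lipschitz
  obtain ⟨B, hB⟩ := ha.bounded
  obtain ⟨i1, i2⟩ := ha.integrable hp.2
  have hB' : ∀ x, ‖a x‖ₑ ≤ ENNReal.ofReal B := fun x => by
    rw [← ofReal_norm, Real.norm_of_nonneg (ha.nonneg x)]
    exact ENNReal.ofReal_le_ofReal (hB x)
  have j1 : ∫⁻ x, ‖a x‖ₑ ≠ ⊤ := i1.2.ne
  have j2 : ∫⁻ x, ‖gradient a x‖ₑ ≠ ⊤ := i2.2.ne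
  have k1 : ENNReal.ofReal B ^ (mE p - 1) ≠ ⊤ :=
    ENNReal.rpow_ne_top_of_nonneg (by linarith) ENNReal.ofReal_ne_top
  have k2 : (K : ℝ≥0∞) ^ (mE p - 1) ≠ ⊤ :=
    ENNReal.rpow_ne_top_of_nonneg (by linarith) ENNReal.coe_ne_top
  refine ⟨?_, fun x hx R => ?_⟩
  · set D := (ENNReal.ofReal B ^ (mE p - 1) * ∫⁻ x, ‖a x‖ₑ) ^ (1 / mE p) +
      ((K : ℝ≥0∞) ^ (mE p - 1) * ∫⁻ x, ‖gradient a x‖ₑ) ^ (1 / mE p)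
    have hD : D ≠ ⊤ := ENNReal.add_ne_top.2
      ⟨ENNReal.rpow_ne_top_of_nonneg hm'.le (ENNReal.mul_ne_top k1 j1),
        ENNReal.rpow_ne_top_of_nonneg hm'.le (ENNReal.mul_ne_top k2 j2)⟩
    refine ⟨D.toNNReal, ?_, fun h hh => ?_⟩
    · rw [ENNReal.coe_toNNReal hD]
      exact (lpn_le_of_le_const hm ENNReal.ofReal_ne_top hB').trans le_self_add
    · rw [ENNReal.coe_toNNReal hD]
      exact (lpn_diff_le hm hK hh).trans (mul_le_mul_left le_add_self _)
  · have t1 : Tendsto (fun n => (ENNReal.ofReal B ^ (mE p - 1) *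
        ∫⁻ y in Metric.ball (x n) R, ‖a y‖ₑ) ^ (1 / mE p)) atTop (𝓝 0) := by
      simp_rw [ENNReal.mul_rpow_of_nonneg _ _ hm'.le]
      exact tendsto_const_mul_rpow (ENNReal.rpow_ne_top_of_nonneg hm'.le k1) hm'
        (tendsto_setLIntegral_ball j1 hx R)
    have t2 : Tendsto (fun n => ((K : ℝ≥0∞) ^ (mE p - 1) *
        ∫⁻ y in Metric.ball (x n) (R + 1), ‖gradient a y‖ₑ) ^ (1 / mE p)) atTop (𝓝 0) := by
      simp_rw [ENNReal.mul_rpow_of_nonneg _ _ hm'.le]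
      exact tendsto_const_mul_rpow (ENNReal.rpow_ne_top_of_nonneg hm'.le k2) hm'
        (tendsto_setLIntegral_ball j2 hx (R + 1))
    have t3 := t1.add t2
    rw [add_zero] at t3
    refine ⟨_, t3, fun n => ⟨?_, fun h hh => ?_⟩⟩
    · exact (lpn_le_of_le_const hm ENNReal.ofReal_ne_top hB').trans le_self_add
    · exact (lpn_ball_diff_le hm hK (x n) R hh).trans (mul_le_mul_left le_add_self _)

theorem eventually_lam_le (hp : p ∈ Set.Ioc (0 : ℝ) 2) (ha : Admissible p a) {φ : L2}
    (hφ : MemH1 φ) (t : ℕ → ℝ) {x : ℕ → Plane} (hx : Tendsto (fun n => ‖x n‖) atTop atTop)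
    {ε : ℝ≥0∞} (hε : 0 < ε) :
    ∀ᶠ n in atTop,
      lam p volume a (fun s => freeProp s (translate (-x n) (freeProp (t n) φ))) ≤ ε ∧
      ∀ h : Plane, ‖h‖ ≤ 1 → lam p volume (fun y => a (y + h) - a y)
        (fun s => freeProp s (translate (-x n) (freeProp (t n) φ))) ≤ ε * ‖h‖ₑ := by
  have hp0 := hp.1
  obtain ⟨C, hC⟩ := exists_nr_le_h1Norm hp
  obtain ⟨⟨A, hA, hA'⟩, hball⟩ := ha.exists_weight_bounds hp
  have hε2 : 0 < ε / 2 := ENNReal.half_pos hε.ne'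
  obtain ⟨d, hd, hd'⟩ := (ENNReal.nhds_zero_basis.eventually_iff).1
    ((tendsto_const_mul_rpow (ENNReal.coe_ne_top (r := A)) hp0
      (tendsto_id (x := 𝓝 (0 : ℝ≥0∞)))).eventually (ge_mem_nhds hε2))
  obtain ⟨d', hd0, hdd⟩ := exists_between hd
  obtain ⟨ψ, s1, s2, s3, s4⟩ := exists_test_approx hp hφ hd0.ne'
  have s5 := hd' (lt_of_le_of_lt s4 hdd)
  obtain ⟨R, hR⟩ := s2.isCompact.isBounded.subset_ball (0 : ℝ × Plane)
  have hR' : ∀ s y, y ∉ Metric.ball (0 : Plane) R → ψ (s, y) = 0 := fun s y hy => by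
    refine image_eq_zero_of_notMem_tsupport fun hmem => hy ?_
    have h1 := hR hmem
    rw [Metric.mem_ball, dist_eq_norm, sub_zero] at h1 ⊢
    exact (norm_snd_le (s, y)).trans_lt h1
  obtain ⟨c, hc, hcn⟩ := hball x hx R
  have hX : xN p volume (fun s => freeProp s φ) ^ p ≠ ⊤ := by
    refine ENNReal.rpow_ne_top_of_nonneg hp0.le ((xN_freeProp_le hp hC φ).trans_lt
      (ENNReal.mul_lt_top ?_ ?_)).ne
    · exact ENNReal.rpow_lt_top_of_nonneg (one_sub_γE_div_pos hp).le
        (ENNReal.mul_ne_top ENNReal.coe_ne_top hφ.ne)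
    · exact ENNReal.rpow_lt_top_of_nonneg (γE_div_pos hp).le
        (ENNReal.mul_ne_top (cS_ne_top p) hφ.ne)
  have hlim : Tendsto (fun n => c n * xN p volume (fun s => freeProp s φ) ^ p) atTop (𝓝 0) := by
    have := ENNReal.Tendsto.mul_const hc (Or.inr hX)
    rwa [zero_mul] at this
  filter_upwards [hlim.eventually (ge_mem_nhds hε2)] with n hn
  refine ⟨?_, fun h hh => ?_⟩
  · refine (lam_freeProp_translate_le hp ha.boundedWeight.measurable φ (t n) (x n) s1.continuous
      hR' s3).trans ?_
    rw [← ENNReal.add_halves ε]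
    exact add_le_add ((mul_le_mul_left (hcn n).1 _).trans hn) ((mul_le_mul_left hA _).trans s5)
  · have mb : Measurable fun y => a (y + h) - a y :=
      (ha.boundedWeight.measurable.comp (measurable_add_const h)).sub ha.boundedWeight.measurable
    refine (lam_freeProp_translate_le hp mb φ (t n) (x n) s1.continuous hR' s3).trans ?_
    rw [← ENNReal.add_halves ε, add_mul]
    refine add_le_add ?_ ?_
    · refine (mul_le_mul_left ((hcn n).2 h hh) _).trans ?_
      rw [mul_right_comm]
      exact mul_le_mul_left hn _
    · refine (mul_le_mul_left (hA' h hh) _).trans ?_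
      rw [mul_right_comm]
      exact mul_le_mul_left s5 _

/-- The bound for the scattering norm in terms of the `H¹` norm of the profile. -/
def scatteringBound (p : ℝ) (C : ℝ≥0) (m : ℝ≥0∞) : ℝ≥0 :=
  ((C * m) ^ (1 - γE p / qE p) * (cS p * m) ^ (γE p / qE p) + 1).toNNReal

theorem coe_scatteringBound (hp : p ∈ Set.Ioc (0 : ℝ) 2) (C : ℝ≥0) {m : ℝ≥0∞} (hm : m ≠ ⊤) :
    (scatteringBound p C m : ℝ≥0∞) =
      (C * m) ^ (1 - γE p / qE p) * (cS p * m) ^ (γE p / qE p) + 1 := by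
  refine ENNReal.coe_toNNReal (ENNReal.add_ne_top.2 ⟨ENNReal.mul_ne_top ?_ ?_, ENNReal.one_ne_top⟩)
  · exact ENNReal.rpow_ne_top_of_nonneg (one_sub_γE_div_pos hp).le
      (ENNReal.mul_ne_top ENNReal.coe_ne_top hm)
  · exact ENNReal.rpow_ne_top_of_nonneg (γE_div_pos hp).le (ENNReal.mul_ne_top (cS_ne_top p) hm)

/-- For profiles that are far away the equation has global scattering solutions that are
asymptotic to the free evolution in the scattering norm. -/
theorem exists_farAway_solutions (hp : p ∈ Set.Ioc (0 : ℝ) 2) (ha : Admissible p a) {φ : L2}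
    (hφ : MemH1 φ) (t : ℕ → ℝ) {x : ℕ → Plane} (hx : Tendsto (fun n => ‖x n‖) atTop atTop) :
    ∃ v : ℕ → ℝ → L2, (∀ᶠ n in atTop, IsGlobalSolution p a (v n) ∧
        v n 0 = translate (-x n) (freeProp (t n) φ) ∧ ScattersForward (v n) ∧
        ScattersBackward (v n) ∧ Continuous (v n)) ∧
      ∀ ε : ℝ≥0∞, 0 < ε → ∀ᶠ n in atTop, xN p volume (fun s => v n s -
        freeProp s (translate (-x n) (freeProp (t n) φ))) ≤ ε := by
  obtain ⟨C, hC⟩ := exists_nr_le_h1Norm hp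
  obtain ⟨⟨A, hA, hA'⟩, -⟩ := ha.exists_weight_bounds hp
  have hθ := γE_div_pos hp
  have hθ' := one_sub_γE_div_pos hp
  have hS := cS_ne_top p
  set M := (h1Norm φ).toNNReal with hM
  have hMc : (M : ℝ≥0∞) = h1Norm φ := ENNReal.coe_toNNReal hφ.ne
  obtain ⟨ε₀, η, hε₀, hs⟩ := exists_smallConst hp C A M
  set φn : ℕ → L2 := fun n => translate (-x n) (freeProp (t n) φ) with hφn
  set L : ℕ → ℝ≥0∞ := fun n => lam p volume a (fun s => freeProp s (φn n)) with hL
  have hex : ∀ᶠ n in atTop, ∃ u : ℝ → L2, (IsGlobalSolution p a u ∧ u 0 = φn n ∧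
      ScattersForward u ∧ ScattersBackward u ∧ Continuous u) ∧
      xN p volume (fun s => u s - freeProp s (φn n)) ≤
        (C * 2) ^ (1 - γE p / qE p) * (2 * (cS p * (L n * (cS p * M)))) ^ (γE p / qE p) := by
    have hε₀' : (0 : ℝ≥0∞) < ε₀ := by exact_mod_cast hε₀
    filter_upwards [eventually_lam_le hp ha hφ t hx hε₀'] with n hn
    have hd : SmallData p a (φn n) A M ε₀ :=
      { h1Norm_le := by rw [hMc, hφn, h1Norm_translate, h1Norm_freeProp]
        weight_le := hA
        weight_diff_le := hA'
        lam_le := hn.1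
        lam_diff_le := hn.2 }
    obtain ⟨u, u1, u2, u3, u4, u5, u6⟩ := exists_solution hp hC ha.boundedWeight hd hs
    exact ⟨u, ⟨u1, u2, u3, u4, u5⟩, u6⟩
  obtain ⟨N, hN⟩ := eventually_atTop.1 hex
  choose! v hv using hN
  have hLlim : Tendsto L atTop (𝓝 0) := by
    rw [ENNReal.tendsto_nhds_zero]
    intro ε hε
    filter_upwards [eventually_lam_le hp ha hφ t hx hε] with n hn
    exact hn.1
  have hlim : Tendsto (fun n => ((C : ℝ≥0∞) * 2) ^ (1 - γE p / qE p) *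
      (2 * (cS p * (L n * (cS p * M)))) ^ (γE p / qE p)) atTop (𝓝 0) := by
    refine tendsto_const_mul_rpow (ENNReal.rpow_ne_top_of_nonneg hθ'.le (by finiteness)) hθ ?_
    have h1 : ∀ n, 2 * (cS p * (L n * (cS p * M))) = 2 * (cS p * (cS p * M)) * L n := fun n => by
      ring
    simp_rw [h1]
    have := ENNReal.Tendsto.const_mul hLlim
      (Or.inr (by finiteness : 2 * (cS p * (cS p * (M : ℝ≥0∞))) ≠ ⊤))
    rwa [mul_zero] at this
  refine ⟨v, ?_, fun ε hε => ?_⟩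
  · filter_upwards [eventually_ge_atTop N] with n hn
    exact (hv n hn).1
  · filter_upwards [eventually_ge_atTop N, hlim.eventually (ge_mem_nhds hε)] with n hn hn'
    exact (hv n hn).2.trans hn'

theorem xNorm_sub_translate_le (hp : p ∈ Set.Ioc (0 : ℝ) 2) {u : ℝ → L2} (hu : Continuous u)
    (φ : L2) (t : ℝ) (x : Plane) {ψ : ℝ × Plane → ℂ} (hψ : Continuous ψ)
    (hm : AEMeasurable (fun s => eLpNorm (fun y => freeProp s φ y - ψ (s, y))
      (ENNReal.ofReal (rE p)) volume) volume) :
    xNorm p (fun s y => u s y - ψ (s + t, y - x)) ≤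
      xN p volume (fun s => u s - freeProp s (translate (-x) (freeProp t φ))) +
      lpn (qE p) volume (fun s => eLpNorm (fun y => freeProp s φ y - ψ (s, y))
        (ENNReal.ofReal (rE p)) volume) := by
  have hq := one_le_qE hp
  have hr := one_le_rE hp
  set e : ℝ → ℝ≥0∞ := fun s =>
    eLpNorm (fun y => freeProp s φ y - ψ (s, y)) (ENNReal.ofReal (rE p)) volume with he
  set w : ℝ → L2 := fun s => freeProp s (translate (-x) (freeProp t φ)) with hw
  have hwc : Continuous w := continuous_freeProp_left _
  have hpt : ∀ s, eLpNorm (fun y => u s y - ψ (s + t, y - x)) (ENNReal.ofReal (rE p)) volume ≤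
      nr (rE p) (u s - w s) + e (s + t) := fun s => by
    have hψs : Continuous fun y => ψ (s + t, y) := hψ.comp (Continuous.prodMk_right (s + t))
    have hψx : Continuous fun y => ψ (s + t, y - x) := hψs.comp (continuous_sub_right x)
    have h1 : eLpNorm (fun y => w s y - ψ (s + t, y - x)) (ENNReal.ofReal (rE p)) volume =
        e (s + t) := by
      rw [he]
      beta_reduce
      rw [← eLpNorm_comp_add_right (fun y => freeProp (s + t) φ y - ψ (s + t, y))
        ((Lp.aestronglyMeasurable _).sub hψs.aestronglyMeasurable) _ (-x)]
      refine eLpNorm_congr_ae ?_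
      rw [hw]
      beta_reduce
      rw [freeProp_translate_freeProp]
      filter_upwards [coeFn_translate (-x) (freeProp (s + t) φ)] with y hy
      rw [hy, sub_eq_add_neg y x]
    rw [← h1, nr]
    refine le_trans (le_of_eq (eLpNorm_congr_ae ?_)) (eLpNorm_add_le (Lp.aestronglyMeasurable _)
      ((Lp.aestronglyMeasurable (w s)).sub hψx.aestronglyMeasurable)
      (by rw [← ENNReal.ofReal_one]; exact ENNReal.ofReal_le_ofReal hr))
    filter_upwards [Lp.coeFn_sub (u s) (w s)] with y hy
    rw [Pi.add_apply, hy, Pi.sub_apply]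
    ring
  rw [xNorm_eq_lpn hp]
  refine (lpn_mono (by linarith) hpt).trans ?_
  have hme : AEMeasurable (fun s => e (s + t)) volume :=
    hm.comp_quasiMeasurePreserving (measurePreserving_add_right volume t).quasiMeasurePreserving
  refine (lpn_add_le hq (aemeasurable_nr (hu.sub hwc).aestronglyMeasurable) hme).trans ?_
  rw [lpn_comp_add_right_real]
  rfl

end FarAway

end InhomNLS

end

open InhomNLS in
theorem mainTheorem5 (p : ℝ) (hp0 : 0 < p) (hp2 : p ≤ 2) :
    ∃ C : ℝ≥0∞ → ℝ≥0,
      ∀ (a : Plane → ℝ), Admissible p a →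
      ∀ (φ : L2), MemH1 φ →
      ∀ (t : ℕ → ℝ), ((∀ n, t n = 0) ∨ Tendsto (fun n => |t n|) atTop atTop) →
      ∀ (x : ℕ → Plane), Tendsto (fun n => ‖x n‖) atTop atTop →
      ∃ v : ℕ → ℝ → L2,
        (∃ N₀ : ℕ, ∀ n ≥ N₀,
          IsGlobalSolution p a (v n) ∧
          (v n 0 =ᵐ[volume] fun y : Plane => freeProp (t n) φ (y - x n)) ∧
          xNorm p (fun s => v n s) ≤ C (h1Norm φ) ∧
          ScattersForward (v n) ∧ ScattersBackward (v n)) ∧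
        ∀ ε : ℝ, 0 < ε → ∃ (N : ℕ) (ψ : ℝ × Plane → ℂ),
          ContDiff ℝ (⊤ : ℕ∞) ψ ∧ HasCompactSupport ψ ∧
          ∀ n ≥ N,
            xNorm p (fun s y => v n s y - ψ (s + t n, y - x n)) < ENNReal.ofReal ε := by
  have hp : p ∈ Set.Ioc (0 : ℝ) 2 := ⟨hp0, hp2⟩
  obtain ⟨C, hC⟩ := exists_nr_le_h1Norm hp
  refine ⟨scatteringBound p C, fun a ha φ hφ t _ x hx => ?_⟩
  obtain ⟨v, hv, hvx⟩ := exists_farAway_solutions hp ha hφ t hx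
  refine ⟨v, ?_, fun ε hε => ?_⟩
  · obtain ⟨N₀, hN₀⟩ := eventually_atTop.1 (hv.and (hvx 1 one_pos))
    refine ⟨N₀, fun n hn => ?_⟩
    obtain ⟨⟨h1, h2, h3, h4, h5⟩, h6⟩ := hN₀ n hn
    refine ⟨h1, ?_, ?_, h3, h4⟩
    · rw [h2]
      filter_upwards [coeFn_translate (-x n) (freeProp (t n) φ)] with y hy
      rw [hy, sub_eq_add_neg]
    · rw [coe_scatteringBound hp C hφ.ne, xNorm_eq_lpn hp]
      set w : ℝ → L2 := fun s => freeProp s (translate (-x n) (freeProp (t n) φ)) with hw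
      have hwc : Continuous w := continuous_freeProp_left _
      have e : (fun s => w s + (v n - w) s) = v n := by
        funext s
        rw [Pi.sub_apply]
        abel
      have hadd := xN_add_le (μ := volume) hp hwc (h5.sub hwc)
      have hwx := xN_freeProp_le hp hC (translate (-x n) (freeProp (t n) φ))
      rw [h1Norm_translate, h1Norm_freeProp] at hwx
      rw [e] at hadd
      exact hadd.trans (add_le_add hwx h6)
  · have hε3 : 0 < ENNReal.ofReal (ε / 3) := ENNReal.ofReal_pos.2 (by positivity)
    obtain ⟨ψ, s1, s2, s3, s4⟩ := exists_test_approx hp hφ hε3.ne'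
    obtain ⟨N, hN⟩ := eventually_atTop.1 (hv.and (hvx _ hε3))
    refine ⟨N, ψ, s1, s2, fun n hn => ?_⟩
    obtain ⟨⟨-, -, -, -, h5⟩, h6⟩ := hN n hn
    refine (xNorm_sub_translate_le hp h5 φ (t n) (x n) s1.continuous s3).trans_lt ?_
    refine (add_le_add h6 s4).trans_lt ?_
    rw [← ENNReal.ofReal_add (by positivity) (by positivity)]
    exact (ENNReal.ofReal_lt_ofReal_iff hε).2 (by linarith)
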